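/- **Notation.** Let $N\ge 1$ be an integer, $\kappa\in\mathbb C\setminus\{0\}$, $\lambda=(\lambda_1,\dots,\lambda_N)\in\mathbb Z_{\ge0}^N$, $n=\lambda_1+\dots+\lambda_N$, and $\lambda^{(k)}=\lambda_1+\dots+\lambda_k$. Let $\mathcal I_\lambda$ be the set of partitions $I=(I_1,\dots,I_N)$ of $\{1,\dots,n\}$ into disjoint subsets with $|I_j|=\lambda_j$, and write $\bigcup_{l\le k}I_l=\{i^{(k)}_1<\dots<i^{(k)}_{\lambda^{(k)}}\}$. Let $v_1,\dots,v_N$ be the standard basis of $\mathbb C^N$, and for $I\in\mathcal I_\lambda$ put $v_I=v_{i_1}\otimes\dots\otimes v_{i_n}\in(\mathbb C^N)^{\otimes n}$, where $i_j=m$ if $j\in I_m$; let $(\mathbb C^N)^{\otimes n}_\lambda$ be the span of the $v_I$, $I\in\mathcal I_\lambda$. Let $e^{(a)}_{i,j}$ be the matrix unit $e_{i,j}$ acting on the $a$-th tensor factor, $\eta_{i,j}=\sum_{a=1}^n e_{i,j}^{(a)}$, and $$X_i(z;h;q)=\sum_{a=1}^n z_ae^{(a)}_{i,i}-h\Bigl(\tfrac{\eta_{i,i}(1-\eta_{i,i})}2+\sum_{1\le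 a<b\le n}\sum_{k=1}^N e_{i,k}^{(a)}e_{k,i}^{(b)}+\sum_{j\ne i}\frac{q_j}{q_i-q_j}(\eta_{i,j}\eta_{j,i}-\eta_{i,i})\Bigr).$$ The dynamical differential equations for a $(\mathbb C^N)^{\otimes n}$-valued function $f(z;h;q)$ are $\kappa q_i\,\partial f/\partial q_i=X_i(z;h;q)f$, $i=1,\dots,N$. Let $T=(t^{(k)}_a)$, $1\le k\le N-1$, $1\le a\le\lambda^{(k)}$, and $t^{(N)}_a=z_a$. For $I\in\mathcal I_\lambda$ let $W_I(T;z;h)$ be the sum of $U_I$ over all permutations of the variables within each group $t^{(k)}$, $k=1,\dots,N-1$, where $$U_I=\prod_{j=1}^{N-1}\prod_{a=1}^{\lambda^{(j)}}\Bigl(\prod_{c:\,i^{(j+1)}_c<i^{(j)}_a}(t^{(j)}_a-t^{(j+1)}_c)\prod_{d:\,i^{(j+1)}_d>i^{(j)}_a}(t^{(j)}_a-t^{(j+1)}_d-h)\prod_{b=a+1}^{\lambda^{(j)}}\frac{t^{(j)}_b-t^{(j)}_a-h}{t^{(j)}_b-t^{(j)}_a}\Bigr).$$ Put $\varphi(x)=\Gamma(x/\kappa)\Gamma((h-x)/\kappa)$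 and $$\Phi_\lambda=(e^{\pi i(n-\lambda_N)}q_N)^{\sum_a z_a/\kappa}\prod_{k=1}^{N-1}\Bigl(e^{\pi i(\lambda_{k+1}-\lambda_k)}\frac{q_k}{q_{k+1}}\Bigr)^{\sum_j t^{(k)}_j/\kappa}\prod_{k=1}^{N-1}\prod_{a=1}^{\lambda^{(k)}}\Bigl(\prod_{b\ne a}\frac1{(t^{(k)}_a-t^{(k)}_b-h)\,\varphi(t^{(k)}_a-t^{(k)}_b)}\prod_{c=1}^{\lambda^{(k+1)}}\varphi(t^{(k)}_a-t^{(k+1)}_c)\Bigr),$$ where, for integers $m$ and given values of $\log q_j$, $(e^{\pi i m}q_N)^s=e^{s(\pi i m+\log q_N)}$ and $(e^{\pi i m}q_k/q_{k+1})^s=e^{s(\pi i m+\log q_k-\log q_{k+1})}$. Put $\Omega_\lambda=\prod_{1\le i<j\le N}(1-q_j/q_i)^{h\lambda_i/\kappa}$ (principal branch). Let $J\in\mathcal I_\lambda$ with $\bigcup_{l\le k}J_l=\{j^{(k)}_1<\dots<j^{(k)}_{\lambda^{(k)}}\}$, and let $\Sigma_J$ be the point $t^{(k)}_i=z_{j^{(k)}_i}$,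 $1\le k\le N-1$. Let $\operatorname{Res}_{T=s}$ be the iterated residue $\operatorname{Res}_{t^{(1)}_1=s^{(1)}_1}\cdots\operatorname{Res}_{t^{(1)}_{\lambda^{(1)}}=s^{(1)}_{\lambda^{(1)}}}\cdots\operatorname{Res}_{t^{(N-1)}_1=s^{(N-1)}_1}\cdots\operatorname{Res}_{t^{(N-1)}_{\lambda^{(N-1)}}=s^{(N-1)}_{\lambda^{(N-1)}}}$ (rightmost taken first), let $\lambda^{\{1\}}=\lambda^{(1)}+\dots+\lambda^{(N-1)}$, and $$\mathcal M_J(\Phi_\lambda W_I)=\sum_{r\in\mathbb Z^{\lambda^{\{1\}}}}\operatorname{Res}_{T=\Sigma_J+r\kappa}(\Phi_\lambda W_I),\qquad \Psi_J=\Omega_\lambda\sum_{I\in\mathcal I_\lambda}\mathcal M_J(\Phi_\lambda W_I)\,v_I.$$ **Theorem.** Let $U\subset(\mathbb C\setminus\{0\})^N$ be an open set on which $|q_{i+1}/q_i|<1$ for $i=1,\dots,N-1$ and on which a continuous branch of $\log q_i$ is fixed for each $i=1,\dots,N$. Let $L$ be the set of $(z,h,q)\in\mathbb C^n\times\mathbb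 C\times U$ such that $h\notin\kappa\mathbb Z$ and $z_a-z_b\notin\kappa\mathbb Z$, $z_a-z_b+h\notin\kappa\mathbb Z$ for all $a\ne b$, and let $\tilde L\supset L$ be the set defined by the same conditions with $h\notin\kappa\mathbb Z$ weakened to $h\notin\kappa\mathbb Z_{\le0}$. Then for every $J\in\mathcal I_\lambda$ the series $\mathcal M_J(\Phi_\lambda W_I)$, $I\in\mathcal I_\lambda$, converge absolutely at every point of $L$, and the function $\Psi_J$ they define on $L$ extends to a holomorphic $(\mathbb C^N)^{\otimes n}_\lambda$-valued function on $\tilde L$. This extension is a solution of the dynamical differential equations on $\tilde L$. -/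

import Mathlib

open scoped BigOperators TensorProduct

noncomputable section

namespace JacksonIntegral

/-! The number of steps is `N = M + 1`; the composition is `lam = (λ_1, …, λ_N)`, indexed by
`Fin (M + 1)` (so indices are shifted by one: `lam i` is `λ_{i+1}`). -/

/-- `n = |λ| = λ_1 + … + λ_N`. -/
abbrev size {M : ℕ} (lam : Fin (M + 1) → ℕ) : ℕ := ∑ i, lam i

/-- The partial sums: `psum lam k` is `λ_1 + … + λ_{k+1}`, i.e. `λ^{(k+1)}`. -/
def psum {M : ℕ} (lam : Fin (M + 1) → ℕ) (k : Fin (M + 1)) : ℕ := ∑ i ∈ Finset.Iic k, lam i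

theorem psum_last {M : ℕ} (lam : Fin (M + 1) → ℕ) : psum lam (Fin.last M) = size lam := by
  have h : Finset.Iic (Fin.last M) = Finset.univ := by
    ext i
    simp [Fin.le_last]
  simp [psum, h]

/-- The set `I_λ` of partitions `I = (I_1, …, I_N)` of `{1, …, n}` into disjoint subsets with
`|I_j| = λ_j`. The partition is recorded by the map sending `a` to the index `j` with `a ∈ I_j`. -/
abbrev Parts {M : ℕ} (lam : Fin (M + 1) → ℕ) : Type :=
  {p : Fin (size lam) → Fin (M + 1) // ∀ j, (Finset.univ.filter fun a => p a = j).card = lam j}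

/-- The union `I_1 ∪ … ∪ I_k`. -/
def blockUnion {M : ℕ} {lam : Fin (M + 1) → ℕ} (I : Parts lam) (k : Fin (M + 1)) :
    Finset (Fin (size lam)) :=
  Finset.univ.filter fun a => I.1 a ≤ k

theorem card_blockUnion {M : ℕ} {lam : Fin (M + 1) → ℕ} (I : Parts lam) (k : Fin (M + 1)) :
    (blockUnion I k).card = psum lam k := by
  have h : ∀ a ∈ blockUnion I k, I.1 a ∈ Finset.Iic k := by
    intro a ha
    simpa [blockUnion] using ha
  rw [Finset.card_eq_sum_card_fiberwise h, psum]
  refine Finset.sum_congr rfl fun j hj => ?_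
  rw [← I.2 j]
  congr 1
  ext a
  simp only [blockUnion, Finset.mem_filter, Finset.mem_univ, true_and, and_iff_right_iff_imp]
  rintro rfl
  simpa using hj

/-- The elements `i^{(k)}_1 < i^{(k)}_2 < …` of `I_1 ∪ … ∪ I_k`, in increasing order. -/
def pos {M : ℕ} {lam : Fin (M + 1) → ℕ} (I : Parts lam) (k : Fin (M + 1)) :
    Fin (psum lam k) ↪o Fin (size lam) :=
  (blockUnion I k).orderEmbOfFin (card_blockUnion I k)

/-- Labels of the integration variables `t^{(k)}_a`, `k = 1, …, N - 1`, `a = 1, …, λ^{(k)}`. -/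
abbrev TVar {M : ℕ} (lam : Fin (M + 1) → ℕ) : Type :=
  (k : Fin M) × Fin (psum lam k.castSucc)

/-- All the variables `t^{(k)}_a`, `k = 1, …, N`, where `t^{(N)}_a = z_a`. -/
def tz {M : ℕ} {lam : Fin (M + 1) → ℕ} (T : TVar lam → ℂ) (z : Fin (size lam) → ℂ)
    (k : Fin (M + 1)) : Fin (psum lam k) → ℂ :=
  Fin.lastCases (motive := fun k => Fin (psum lam k) → ℂ)
    (fun a => z (Fin.cast (psum_last lam) a)) (fun i a => T ⟨i, a⟩) k

/-! ### Weight functions -/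

/-- The function `U_I(T; z)`. -/
def weightU {M : ℕ} {lam : Fin (M + 1) → ℕ} (I : Parts lam) (T : TVar lam → ℂ)
    (z : Fin (size lam) → ℂ) (h : ℂ) : ℂ :=
  ∏ j : Fin M, ∏ a : Fin (psum lam j.castSucc),
    ((∏ c with pos I j.succ c < pos I j.castSucc a, (tz T z j.castSucc a - tz T z j.succ c)) *
      (∏ d with pos I j.castSucc a < pos I j.succ d,
        (tz T z j.castSucc a - tz T z j.succ d - h)) *
      ∏ b with a < b, (tz T z j.castSucc b - tz T z j.castSucc a - h) /
        (tz T z j.castSucc b - tz T z j.castSucc a))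

/-- The weight function `W_I(T; z)`: the sum of `U_I` over all permutations of the variables within
each of the groups `t^{(k)}`, `k = 1, …, N - 1`. -/
def weightW {M : ℕ} {lam : Fin (M + 1) → ℕ} (I : Parts lam) (T : TVar lam → ℂ)
    (z : Fin (size lam) → ℂ) (h : ℂ) : ℂ :=
  ∑ σ : (k : Fin M) → Equiv.Perm (Fin (psum lam k.castSucc)),
    weightU I (fun x => T ⟨x.1, σ x.1 x.2⟩) z h

/-! ### Master function -/

/-- `φ(x) = Γ(x/κ) Γ((h - x)/κ)`. -/
def phi (κ h x : ℂ) : ℂ := Complex.Gamma (x / κ) * Complex.Gamma ((h - x) / κ)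

/-- The master function `Φ_λ(T; z; h; q)`. It depends on `q` through the chosen values
`l i` of `log q_i`, a power `(e^{iπm} q)^s` being `exp ((iπm + log q) s)`. -/
def masterPhi {M : ℕ} (lam : Fin (M + 1) → ℕ) (κ : ℂ) (T : TVar lam → ℂ)
    (z : Fin (size lam) → ℂ) (h : ℂ) (l : Fin (M + 1) → ℂ) : ℂ :=
  Complex.exp ((Real.pi * Complex.I * ((size lam : ℂ) - lam (Fin.last M)) + l (Fin.last M)) *
      ((∑ a, z a) / κ)) *
    (∏ i : Fin M, Complex.exp
      ((Real.pi * Complex.I * ((lam i.succ : ℂ) - lam i.castSucc) + (l i.castSucc - l i.succ)) *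
        ((∑ j, tz T z i.castSucc j) / κ))) *
    ∏ i : Fin M, ∏ a : Fin (psum lam i.castSucc),
      ((∏ b with b ≠ a, 1 / ((tz T z i.castSucc a - tz T z i.castSucc b - h) *
          phi κ h (tz T z i.castSucc a - tz T z i.castSucc b))) *
        ∏ c : Fin (psum lam i.succ), phi κ h (tz T z i.castSucc a - tz T z i.succ c))

/-- `Ω_λ(q) = ∏_{i<j} (1 - q_j/q_i)^{h λ_i/κ}`, with the principal branch of the power. -/
def omega {M : ℕ} (lam : Fin (M + 1) → ℕ) (κ h : ℂ) (q : Fin (M + 1) → ℂ) : ℂ :=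
  ∏ i, ∏ j with i < j, (1 - q j / q i) ^ (h * lam i / κ)

/-! ### Residues and the Jackson integral -/

/-- The residue at `s` of a function with an isolated singularity at `s`: the integral over small
circles around `s`, divided by `2πi`. -/
def residue (f : ℂ → ℂ) (s : ℂ) : ℂ :=
  Filter.limUnder (nhdsWithin (0 : ℝ) (Set.Ioi 0)) fun ε : ℝ =>
    (2 * Real.pi * Complex.I)⁻¹ * ∮ t in C(s, ε), f t

/-- The iterated residue `Res_{x_1 = s_1} Res_{x_2 = s_2} … Res_{x_r = s_r} F`, for the list
`[x_1, …, x_r]` of variables; the residue in the last variable of the list is taken first.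
The variables outside the list have the values given by `T`. -/
def iterRes {ι : Type} [DecidableEq ι] (s : ι → ℂ) (F : (ι → ℂ) → ℂ) : List ι → (ι → ℂ) → ℂ
  | [], T => F T
  | x :: xs, T => residue (fun t => iterRes s F xs (Function.update T x t)) (s x)

/-- The list `t^{(1)}_1, …, t^{(1)}_{λ^{(1)}}, …, t^{(N-1)}_1, …, t^{(N-1)}_{λ^{(N-1)}}`. -/
def varList {M : ℕ} (lam : Fin (M + 1) → ℕ) : List (TVar lam) :=
  (List.finRange M).flatMap fun k =>
    (List.finRange (psum lam k.castSucc)).map fun a => ⟨k, a⟩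

/-- `Res_{T = s}`. All variables are in the list, so the last argument of `iterRes` is
irrelevant. -/
def resT {M : ℕ} {lam : Fin (M + 1) → ℕ} (s : TVar lam → ℂ) (F : (TVar lam → ℂ) → ℂ) : ℂ :=
  iterRes s F (varList lam) s

/-- The point `T` of the discrete cycle `Σ_J` over `z`: `t^{(k)}_i = z_{j^{(k)}_i}`. -/
def cycle {M : ℕ} {lam : Fin (M + 1) → ℕ} (J : Parts lam) (z : Fin (size lam) → ℂ) :
    TVar lam → ℂ :=
  fun x => z (pos J x.1.castSucc x.2)

/-- The term with index `r` of the Jackson integral of `Φ_λ W_I` over `Σ_J`: the residue at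
`T = Σ_J + r κ`. -/
def jacksonTerm {M : ℕ} {lam : Fin (M + 1) → ℕ} (κ : ℂ) (J I : Parts lam)
    (z : Fin (size lam) → ℂ) (h : ℂ) (l : Fin (M + 1) → ℂ) (r : TVar lam → ℤ) : ℂ :=
  resT (fun x => cycle J z x + r x * κ)
    (fun T => masterPhi lam κ T z h l * weightW I T z h)

/-- The Jackson integral `M_J(Φ_λ W_I)`. -/
def jackson {M : ℕ} {lam : Fin (M + 1) → ℕ} (κ : ℂ) (J I : Parts lam)
    (z : Fin (size lam) → ℂ) (h : ℂ) (l : Fin (M + 1) → ℂ) : ℂ :=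
  ∑' r : TVar lam → ℤ, jacksonTerm κ J I z h l r

/-! ### The tensor product and the dynamical Hamiltonians -/

/-- `(ℂ^N)^{⊗ n}`, `N = M + 1`. -/
abbrev TensorPow (M n : ℕ) : Type := ⨂[ℂ] _ : Fin n, (Fin (M + 1) → ℂ)

/-- The basis vector `v_p = v_{p_1} ⊗ … ⊗ v_{p_n}`. -/
def basisVec {M n : ℕ} (p : Fin n → Fin (M + 1)) : TensorPow M n :=
  PiTensorProduct.tprod ℂ fun a => Pi.single (p a) (1 : ℂ)

/-- The weight subspace, spanned by the `v_I`, `I ∈ I_λ`. -/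
def weightSpace {M : ℕ} (lam : Fin (M + 1) → ℕ) : Submodule ℂ (TensorPow M (size lam)) :=
  Submodule.span ℂ (Set.range fun I : Parts lam => basisVec I.1)

/-- `e_{i,j}^{(a)}`: the matrix unit `e_{i,j}` acting on the `a`-th tensor factor. -/
def eOp {M n : ℕ} (i j : Fin (M + 1)) (a : Fin n) : Module.End ℂ (TensorPow M n) :=
  PiTensorProduct.map
    (Function.update (fun _ => LinearMap.id) a (Matrix.toLin' (Matrix.single i j (1 : ℂ))))

/-- `η_{i,j} = ∑_a e_{i,j}^{(a)}`. -/
def etaOp {M n : ℕ} (i j : Fin (M + 1)) : Module.End ℂ (TensorPow M n) := ∑ a, eOp i j a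

/-- The dynamical Hamiltonian `X_i(z; h; q)`. -/
def hamiltonian {M n : ℕ} (i : Fin (M + 1)) (z : Fin n → ℂ) (h : ℂ) (q : Fin (M + 1) → ℂ) :
    Module.End ℂ (TensorPow M n) :=
  (∑ a, z a • eOp i i a) -
    h • ((1 / 2 : ℂ) • (etaOp i i * (1 - etaOp i i)) +
      (∑ a : Fin n, ∑ b with a < b, ∑ k, eOp i k a * eOp k i b) +
      ∑ j with j ≠ i, (q j / (q i - q j)) • (etaOp i j * etaOp j i - etaOp i i))

/-- The points `(z, h, q)`. -/
abbrev Param (M n : ℕ) : Type := (Fin n → ℂ) × ℂ × (Fin (M + 1) → ℂ)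

/-- A function of `(z, h, q)` with values in the (finite-dimensional) tensor product is
holomorphic on `s` if all its coordinates are. -/
def IsHolomorphicOn {M n : ℕ} (F : Param M n → TensorPow M n) (s : Set (Param M n)) : Prop :=
  ∀ ξ : Module.Dual ℂ (TensorPow M n), DifferentiableOn ℂ (fun p => ξ (F p)) s

/-- The dynamical differential equations `κ q_i ∂F/∂q_i = X_i F`, `i = 1, …, N`, at the points of
`s`; here `D` is the partial derivative `∂F/∂q_i`. -/
def SolvesDynamical {M n : ℕ} (κ : ℂ) (F : Param M n → TensorPow M n) (s : Set (Param M n)) :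
    Prop :=
  ∀ z h q, (z, h, q) ∈ s → ∀ i : Fin (M + 1), ∃ D : TensorPow M n,
    (∀ ξ : Module.Dual ℂ (TensorPow M n),
      HasDerivAt (fun x : ℂ => ξ (F (z, h, Function.update q i x))) (ξ D) (q i)) ∧
    (κ * q i) • D = hamiltonian i z h q (F (z, h, q))

/-- The function `Ψ_J = Ω_λ ∑_I M_J(Φ_λ W_I) v_I`; `logq` is the chosen branch of the logarithms
of the `q_i`. -/
def psi {M : ℕ} {lam : Fin (M + 1) → ℕ} (κ : ℂ) (J : Parts lam)
    (logq : (Fin (M + 1) → ℂ) → Fin (M + 1) → ℂ) (p : Param M (size lam)) :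
    TensorPow M (size lam) :=
  omega lam κ p.2.1 p.2.2 •
    ∑ I : Parts lam, jackson κ J I p.1 p.2.1 (logq p.2.2) • basisVec I.1

/-- The set of `(z, h, q)` with `h ∉ κℤ`, `z_a - z_b ∉ κℤ`, `z_a - z_b + h ∉ κℤ` for `a ≠ b`, and
`q ∈ U`. -/
def smallDomain {M n : ℕ} (κ : ℂ) (U : Set (Fin (M + 1) → ℂ)) : Set (Param M n) :=
  {p | (∀ m : ℤ, p.2.1 ≠ m * κ) ∧
    (∀ a b, a ≠ b → ∀ m : ℤ, p.1 a - p.1 b ≠ m * κ ∧ p.1 a - p.1 b + p.2.1 ≠ m * κ) ∧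
    p.2.2 ∈ U}

/-- The set of `(z, h, q)` with `h ∉ κℤ_{≤ 0}`, `z_a - z_b ∉ κℤ`, `z_a - z_b + h ∉ κℤ` for
`a ≠ b`, and `q ∈ U`. -/
def bigDomain {M n : ℕ} (κ : ℂ) (U : Set (Fin (M + 1) → ℂ)) : Set (Param M n) :=
  {p | (∀ m : ℤ, m ≤ 0 → p.2.1 ≠ m * κ) ∧
    (∀ a b, a ≠ b → ∀ m : ℤ, p.1 a - p.1 b ≠ m * κ ∧ p.1 a - p.1 b + p.2.1 ≠ m * κ) ∧
    p.2.2 ∈ U}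

end JacksonIntegral

end

open JacksonIntegral

/-!
The iterated residues of the Jackson integral are explicit: at a point `Σ_J + r κ` the only poles
of the integrand are the simple poles of the factors `φ(t_x - t_y)`, where `y` is the variable of
the next group which specializes to the same `z_a` as `x`. Hence the term with index `r` is the
product of a coefficient `masterCoef` (the master function with these factors replaced by their
residues) with the value of the weight function (`iterRes_eq_prod`, `jacksonTerm_eq`). The
coefficients, unlike the integrand itself, remain meaningful and holomorphic at `h ∈ κ ℤ_{> 0}`,
which gives the extension to the larger domain. They vanish unless all `r_x ≤ 0`, and are powers of
the ratios `q_{k+1} / q_k` times factors of polynomial growth in `r`; so the series and their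
derivatives converge locally uniformly (`exists_summable_bound`, `hasFDerivAt_tsum_of_norm_le`).

The differential equations are a computation in an associative algebra. The weight function `W_I`
is a product, in the shuffle ring whose kernel is formed by the factors of `U_I`, of one "site
vector" for each tensor factor (`weightW_latticePoint`). The shuffle ring also contains the
indicators `tau k` of a single variable of the `k`-th group; their iterated commutators are root
vectors, and the commutator of a root vector with a site vector changes the letter of the site
(`site_comm_root`). The operator `κ q_i ∂/∂q_i` multiplies the terms of the series by the sum of
the `i`-th group of variables minus the sum of the group before it. This is a derivation
`cartanDeg` of the shuffle ring, and on a site it is expressed through products of site vectors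
with root vectors (`deg_sub_deg_site`, `cartanDeg_site`); collecting the root vectors at the end of
the word gives `wordMove_eq`.

The remaining root vectors are eliminated by a twisted trace property of the Jackson sum: shifting
one coordinate of `r` by one turns multiplication by `tau k` on the right into multiplication on
the left, with a factor `q_{k+1} / q_k` (`masterCoef_shift`, `jackSum_mul_tau`,
`jackSum_mul_root`). Together with the commutation relations this determines the Jackson sum of a
word times a root vector, with the denominators `q_i - q_j` (`jackSum_siteWord_mul_root`,
`jackSum_cartanDeg`). The result is the Hamiltonian in coordinates (`hamiltonian_toVec`) up to a
diagonal term, which is the logarithmic derivative of `Ω_λ` (`jackSum_cartanDeg_add`).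
-/

open scoped BigOperators TensorProduct

noncomputable section

namespace JacksonIntegral

/-! ### The shuffle ring of a kernel -/

/-- The shuffle ring of a kernel `ω`: functions of a point `x` and a finite set `S` of variables,
multiplied by summing over the ways to split `S` into two parts, with the product of the kernel
over the pairs of variables from different parts as weight (`Shuffle.mul_apply`). The values of
the variables enter through the dependence of `ω` and of the elements on the point `x`, which is a
mere parameter. -/
def Shuffle {X V : Type*} (_ω : X → V → V → ℂ) : Type _ := X → Finset V → ℂ

namespace Shuffle

variable {X V : Type*} {ω : X → V → V → ℂ}

instance : AddCommGroup (Shuffle ω) := inferInstanceAs (AddCommGroup (X → Finset V → ℂ))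
instance : Module ℂ (Shuffle ω) := inferInstanceAs (Module ℂ (X → Finset V → ℂ))

@[ext] theorem ext {f g : Shuffle ω} (h : ∀ x S, f x S = g x S) : f = g :=
  funext fun x => funext fun S => h x S

@[simp] theorem add_apply (f g : Shuffle ω) (x : X) (S : Finset V) :
    (f + g) x S = f x S + g x S := rfl
@[simp] theorem sub_apply (f g : Shuffle ω) (x : X) (S : Finset V) :
    (f - g) x S = f x S - g x S := rfl
@[simp] theorem zero_apply (x : X) (S : Finset V) : (0 : Shuffle ω) x S = 0 := rfl
@[simp] theorem smul_apply (c : ℂ) (f : Shuffle ω) (x : X) (S : Finset V) :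
    (c • f) x S = c * f x S := rfl

variable [DecidableEq V]

/-- The product of the kernel over `A × B`. -/
def cross (ω : X → V → V → ℂ) (x : X) (A B : Finset V) : ℂ := ∏ a ∈ A, ∏ b ∈ B, ω x a b

theorem cross_union_left (x : X) {A A' B : Finset V} (h : Disjoint A A') :
    cross ω x (A ∪ A') B = cross ω x A B * cross ω x A' B := Finset.prod_union h

theorem cross_union_right (x : X) {A B B' : Finset V} (h : Disjoint B B') :
    cross ω x A (B ∪ B') = cross ω x A B * cross ω x A B' := by
  simp only [cross, Finset.prod_union h, Finset.prod_mul_distrib]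

instance : Mul (Shuffle ω) :=
  ⟨fun f g x S => ∑ A ∈ S.powerset, cross ω x A (S \ A) * f x A * g x (S \ A)⟩

instance : One (Shuffle ω) := ⟨fun _ S => if S = ∅ then 1 else 0⟩

theorem mul_apply (f g : Shuffle ω) (x : X) (S : Finset V) :
    (f * g) x S = ∑ A ∈ S.powerset, cross ω x A (S \ A) * f x A * g x (S \ A) := rfl

theorem one_apply (x : X) (S : Finset V) : (1 : Shuffle ω) x S = if S = ∅ then 1 else 0 := rfl

theorem mul_assoc' (f g k : Shuffle ω) : f * g * k = f * (g * k) := by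
  ext x S
  simp only [mul_apply, Finset.mul_sum, Finset.sum_mul]
  rw [Finset.sum_sigma', Finset.sum_sigma']
  refine Finset.sum_bij' (fun y _ => ⟨y.2, y.1 \ y.2⟩) (fun y _ => ⟨y.1 ∪ y.2, y.1⟩) ?_ ?_ ?_ ?_ ?_
  · rintro ⟨A, B⟩ h
    simp only [Finset.mem_sigma, Finset.mem_powerset] at h ⊢
    exact ⟨h.2.trans h.1, Finset.sdiff_subset_sdiff h.1 le_rfl⟩
  · rintro ⟨B, C⟩ h
    simp only [Finset.mem_sigma, Finset.mem_powerset] at h ⊢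
    exact ⟨Finset.union_subset h.1 (h.2.trans Finset.sdiff_subset), Finset.subset_union_left⟩
  · rintro ⟨A, B⟩ h
    simp only [Finset.mem_sigma, Finset.mem_powerset] at h
    simp [Finset.union_sdiff_of_subset h.2]
  · rintro ⟨B, C⟩ h
    simp only [Finset.mem_sigma, Finset.mem_powerset] at h
    have hd : Disjoint C B := Finset.disjoint_of_subset_left h.2 Finset.sdiff_disjoint
    simp [Finset.union_sdiff_left, Finset.sdiff_eq_self_of_disjoint hd]
  · rintro ⟨A, B⟩ h
    simp only [Finset.mem_sigma, Finset.mem_powerset] at h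
    obtain ⟨hA, hB⟩ := h
    have e1 : (S \ B) \ (A \ B) = S \ A := by
      ext v; simp only [Finset.mem_sdiff]
      have := @hB v; tauto
    have e2 : S \ B = (S \ A) ∪ (A \ B) := by
      ext v; simp only [Finset.mem_sdiff, Finset.mem_union]
      have := @hB v; have := @hA v; tauto
    have e3 : cross ω x A (S \ A) = cross ω x B (S \ A) * cross ω x (A \ B) (S \ A) := by
      rw [← cross_union_left x Finset.disjoint_sdiff, Finset.union_sdiff_of_subset hB]
    have hd : Disjoint (S \ A) (A \ B) := by
      rw [Finset.disjoint_left]; intro v; simp only [Finset.mem_sdiff]; tauto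
    have e4 : cross ω x B (S \ B) = cross ω x B (S \ A) * cross ω x B (A \ B) := by
      rw [← cross_union_right x hd, ← e2]
    simp only [e1, e3, e4]
    ring

theorem one_mul' (f : Shuffle ω) : 1 * f = f := by
  ext x S
  rw [mul_apply, Finset.sum_eq_single ∅]
  · simp [one_apply, cross]
  · intro A _ hA
    simp [one_apply, hA]
  · simp

theorem mul_one' (f : Shuffle ω) : f * 1 = f := by
  ext x S
  rw [mul_apply, Finset.sum_eq_single S]
  · simp [one_apply, cross]
  · intro A hA hne
    have : S \ A ≠ ∅ := fun h0 => hne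
      (Finset.Subset.antisymm (Finset.mem_powerset.1 hA) (Finset.sdiff_eq_empty_iff_subset.1 h0))
    simp [one_apply, this]
  · simp

instance : Ring (Shuffle ω) :=
  { (inferInstance : AddCommGroup (Shuffle ω)) with
    mul := (· * ·)
    one := 1
    mul_assoc := mul_assoc'
    one_mul := one_mul'
    mul_one := mul_one'
    left_distrib := fun f g k => by
      ext x S; simp only [mul_apply, add_apply, mul_add, Finset.sum_add_distrib]
    right_distrib := fun f g k => by
      ext x S; simp only [mul_apply, add_apply, mul_add, add_mul, Finset.sum_add_distrib]
    zero_mul := fun f => by ext x S; simp [mul_apply]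
    mul_zero := fun f => by ext x S; simp [mul_apply] }

instance : Algebra ℂ (Shuffle ω) :=
  Algebra.ofModule
    (fun c f g => by
      ext x S; simp only [mul_apply, smul_apply, Finset.mul_sum]
      exact Finset.sum_congr rfl fun _ _ => by ring)
    (fun c f g => by
      ext x S; simp only [mul_apply, smul_apply, Finset.mul_sum]
      exact Finset.sum_congr rfl fun _ _ => by ring)

/-- Multiplication of the value on `S` by the sum of `c` over `S`; a derivation of the shuffle
ring, see `weightMul_mul`. -/
def weightMul (c : X → V → ℂ) : Shuffle ω →ₗ[ℂ] Shuffle ω where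
  toFun f x S := (∑ v ∈ S, c x v) * f x S
  map_add' _ _ := ext fun _ _ => mul_add _ _ _
  map_smul' _ _ := ext fun _ _ => mul_left_comm _ _ _

@[simp] theorem weightMul_apply (c : X → V → ℂ) (f : Shuffle ω) (x : X) (S : Finset V) :
    weightMul c f x S = (∑ v ∈ S, c x v) * f x S := rfl

theorem weightMul_mul (c : X → V → ℂ) (f g : Shuffle ω) :
    weightMul c (f * g) = weightMul c f * g + f * weightMul c g := by
  ext x S
  simp only [weightMul_apply, mul_apply, add_apply, Finset.mul_sum, ← Finset.sum_add_distrib]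
  refine Finset.sum_congr rfl fun A hA => ?_
  rw [← Finset.sum_sdiff (Finset.mem_powerset.1 hA)]
  ring

theorem weightMul_one (c : X → V → ℂ) : weightMul c (1 : Shuffle ω) = 0 := by
  ext x S
  by_cases h : S = ∅ <;> simp [one_apply, h]

/-- The element supported on the singletons `{v}` with `P v`, where its value is `1`. -/
def single (P : V → Prop) [DecidablePred P] : Shuffle ω :=
  fun _ S => ∑ v ∈ S with P v, if S = {v} then 1 else 0

theorem mul_single_apply (P : V → Prop) [DecidablePred P] (f : Shuffle ω) (x : X) (S : Finset V) :
    (f * single P : Shuffle ω) x S = ∑ v ∈ S with P v, (∏ u ∈ S.erase v, ω x u v) * f x (S.erase v) := by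
  rw [mul_apply]
  have hinj : Set.InjOn (fun v => S.erase v) (S.filter P : Finset V) := by
    intro u hu v hv h
    exact (Finset.erase_inj S (Finset.mem_of_mem_filter _ hu)).1 h
  symm
  refine Finset.sum_of_injOn (fun v => S.erase v) hinj ?_ ?_ ?_
  · intro v _
    simp
  · intro A hA hn
    have hz : single (ω := ω) P x (S \ A) = 0 := by
      refine Finset.sum_eq_zero fun v hv => ?_
      rw [Finset.mem_filter, Finset.mem_sdiff] at hv
      rw [if_neg]
      intro hs
      refine hn ⟨v, by simpa using ⟨hv.1.1, hv.2⟩, ?_⟩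
      have : S \ (S \ A) = A := Finset.sdiff_sdiff_eq_self (Finset.mem_powerset.1 hA)
      rw [← this, hs]
      exact (Finset.sdiff_singleton_eq_erase v S).symm
    rw [hz, mul_zero]
  · intro v hv
    rw [Finset.mem_filter] at hv
    have hs : S \ S.erase v = {v} := by
      ext u; simp only [Finset.mem_sdiff, Finset.mem_erase, Finset.mem_singleton]
      constructor
      · tauto
      · rintro rfl; exact ⟨hv.1, by tauto⟩
    have h1 : single (ω := ω) P x {v} = 1 := by
      simp [single, Finset.filter_singleton, hv.2]
    simp [cross, hs, h1]

theorem single_mul_apply (P : V → Prop) [DecidablePred P] (f : Shuffle ω) (x : X) (S : Finset V) :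
    (single P * f : Shuffle ω) x S = ∑ v ∈ S with P v, (∏ u ∈ S.erase v, ω x v u) * f x (S.erase v) := by
  rw [mul_apply]
  have hinj : Set.InjOn (fun v => ({v} : Finset V)) (S.filter P : Finset V) := by
    intro u hu v hv h
    simpa using h
  symm
  refine Finset.sum_of_injOn (fun v => ({v} : Finset V)) hinj ?_ ?_ ?_
  · intro v hv
    simpa using (Finset.mem_filter.1 hv).1
  · intro A hA hn
    have hz : single (ω := ω) P x A = 0 := by
      refine Finset.sum_eq_zero fun v hv => ?_
      rw [Finset.mem_filter] at hv
      rw [if_neg]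
      intro hs
      exact hn ⟨v, by simpa using ⟨Finset.mem_powerset.1 hA hv.1, hv.2⟩, hs.symm⟩
    rw [hz, mul_zero, zero_mul]
  · intro v hv
    rw [Finset.mem_filter] at hv
    have h1 : single (ω := ω) P x {v} = 1 := by
      simp [single, Finset.filter_singleton, hv.2]
    simp [cross, h1, Finset.sdiff_singleton_eq_erase]

end Shuffle

/-! ### Site vectors and simple root vectors -/

/-- A family `V` of variables, each with a colour, whose values depend on a point of `X`.
In the application the variables of colour `k < top` are the integration variables of the
`k`-th group, and those of colour `top` are the `z_a`. -/
structure ColoredVars (X V : Type*) where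
  /-- The colour of a variable. -/
  col : V → ℕ
  /-- The last colour; variables of this colour do not interact with each other. -/
  top : ℕ
  /-- The value of a variable at a point. -/
  val : X → V → ℂ
  /-- The deformation parameter. -/
  h : ℂ

namespace ColoredVars

variable {X V : Type*} (D : ColoredVars X V)

/-- The kernel of the shuffle product: the factor that the weight functions contain for a variable
`u` attached to an earlier tensor position than `w`. Only variables of equal or of neighbouring
colours interact. -/
def kernel (x : X) (u w : V) : ℂ :=
  if D.col w = D.col u + 1 then D.val x u - D.val x w - D.h
  else if D.col u = D.col w + 1 then D.val x w - D.val x u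
  else if D.col u = D.col w ∧ D.col u < D.top then
    (D.val x w - D.val x u - D.h) / (D.val x w - D.val x u)
  else 1

theorem kernel_up {u w : V} (hc : D.col w = D.col u + 1) (x : X) :
    D.kernel x u w = D.val x u - D.val x w - D.h := if_pos hc

theorem kernel_down {u w : V} (hc : D.col u = D.col w + 1) (x : X) :
    D.kernel x u w = D.val x w - D.val x u := by
  rw [kernel, if_neg (by omega), if_pos hc]

theorem kernel_same {u w : V} (hc : D.col u = D.col w) (ht : D.col u < D.top) (x : X) :
    D.kernel x u w = (D.val x w - D.val x u - D.h) / (D.val x w - D.val x u) := by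
  rw [kernel, if_neg (by omega), if_neg (by omega), if_pos ⟨hc, ht⟩]

theorem kernel_far {u w : V} (h1 : D.col w ≠ D.col u + 1) (h2 : D.col u ≠ D.col w + 1)
    (h3 : D.col u = D.col w → D.top ≤ D.col u) (x : X) : D.kernel x u w = 1 := by
  rw [kernel, if_neg h1, if_neg h2, if_neg]
  rintro ⟨h4, h5⟩
  exact absurd (h3 h4) (by omega)

/-- `S` contains exactly one variable of each colour from `m` to `top` and no others, the one of
colour `top` being `z`. -/
def IsSeg (z : V) (m : ℕ) (S : Finset V) : Prop :=
  Set.BijOn D.col S (Set.Icc m D.top) ∧ z ∈ S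

open Classical in
/-- The site vector of `z` with letter `m`: the indicator of the sets of variables which a tensor
factor with basis vector `v_m` contributes to a weight function. -/
def site (z : V) (m : ℕ) : Shuffle D.kernel := fun _ S => if D.IsSeg z m S then 1 else 0

variable {D}

theorem site_of_isSeg {z : V} {m : ℕ} {S : Finset V} (hS : D.IsSeg z m S) (x : X) :
    D.site z m x S = 1 := if_pos hS

theorem site_of_not_isSeg {z : V} {m : ℕ} {S : Finset V} (hS : ¬ D.IsSeg z m S) (x : X) :
    D.site z m x S = 0 := if_neg hS

theorem IsSeg.le_col {z : V} {m : ℕ} {S : Finset V} (hS : D.IsSeg z m S) {v : V} (hv : v ∈ S) :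
    m ≤ D.col v ∧ D.col v ≤ D.top := hS.1.mapsTo hv

theorem IsSeg.eq_of_col {z : V} {m : ℕ} {S : Finset V} (hS : D.IsSeg z m S) {v w : V}
    (hv : v ∈ S) (hw : w ∈ S) (h : D.col v = D.col w) : v = w := hS.1.injOn hv hw h

theorem IsSeg.exists_col {z : V} {m : ℕ} {S : Finset V} (hS : D.IsSeg z m S) {k : ℕ}
    (h1 : m ≤ k) (h2 : k ≤ D.top) : ∃ v ∈ S, D.col v = k := by
  obtain ⟨v, hv, hk⟩ := hS.1.surjOn ⟨h1, h2⟩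
  exact ⟨v, hv, hk⟩

theorem IsSeg.of_forall {z : V} {m : ℕ} {S : Finset V} (h1 : ∀ v ∈ S, m ≤ D.col v ∧ D.col v ≤ D.top)
    (h2 : ∀ v ∈ S, ∀ w ∈ S, D.col v = D.col w → v = w)
    (h3 : ∀ k, m ≤ k → k ≤ D.top → ∃ v ∈ S, D.col v = k) (hz : z ∈ S) : D.IsSeg z m S :=
  ⟨⟨fun v hv => h1 v hv, fun v hv w hw h => h2 v hv w hw h,
    fun k hk => by obtain ⟨v, hv, e⟩ := h3 k hk.1 hk.2; exact ⟨v, hv, e⟩⟩, hz⟩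

theorem IsSeg.sum_col {z : V} {m : ℕ} {S : Finset V} (hS : D.IsSeg z m S) {v : V} (hv : v ∈ S)
    (f : V → ℂ) {k : ℕ} (hk : D.col v = k) :
    (∑ u ∈ S, if D.col u = k then f u else 0) = f v := by
  rw [Finset.sum_eq_single v]
  · rw [if_pos hk]
  · intro u hu hne
    rw [if_neg]
    intro e
    exact hne (hS.eq_of_col hu hv (e.trans hk.symm))
  · exact fun h => absurd hv h

variable [DecidableEq V]

variable (D) in
/-- The simple root vector of colour `k`: the indicator of the singletons of colour `k`. -/
def tau (k : ℕ) : Shuffle D.kernel := Shuffle.single fun v => D.col v = k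

variable (D) in
/-- The derivation which multiplies by the sum of the values of the variables of colour `k`. -/
def deg (k : ℕ) : Shuffle D.kernel →ₗ[ℂ] Shuffle D.kernel :=
  Shuffle.weightMul fun x v => if D.col v = k then D.val x v else 0

/-- Removing the variable of the lowest colour of a segment leaves a segment. -/
theorem isSeg_erase {z : V} (hz : D.col z = D.top) {m : ℕ} (hm : m < D.top) {S : Finset V} {v : V}
    (hv : v ∈ S) (hc : D.col v = m) : D.IsSeg z (m + 1) (S.erase v) ↔ D.IsSeg z m S := by
  constructor
  · intro hS
    have key : ∀ w ∈ S, w = v ∨ w ∈ S.erase v := fun w hw => by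
      rw [Finset.mem_erase]; tauto
    refine IsSeg.of_forall ?_ ?_ ?_ (Finset.mem_of_mem_erase hS.2)
    · intro w hw
      rcases key w hw with rfl | hw
      · omega
      · have := hS.le_col hw; omega
    · intro w hw w' hw' h
      rcases key w hw with rfl | hw <;> rcases key w' hw' with rfl | hw'
      · rfl
      · have := hS.le_col hw'; omega
      · have := hS.le_col hw; omega
      · exact hS.eq_of_col hw hw' h
    · intro k h1 h2
      rcases eq_or_lt_of_le h1 with rfl | h1
      · exact ⟨v, hv, hc⟩
      · obtain ⟨w, hw, e⟩ := hS.exists_col (k := k) h1 h2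
        exact ⟨w, Finset.mem_of_mem_erase hw, e⟩
  · intro hS
    refine IsSeg.of_forall ?_ ?_ ?_ ?_
    · intro w hw
      rw [Finset.mem_erase] at hw
      have h1 := hS.le_col hw.2
      have h2 : D.col w ≠ m := fun e => hw.1 (hS.eq_of_col hw.2 hv (e.trans hc.symm))
      omega
    · intro w hw w' hw' h
      exact hS.eq_of_col (Finset.mem_of_mem_erase hw) (Finset.mem_of_mem_erase hw') h
    · intro k h1 h2
      obtain ⟨w, hw, e⟩ := hS.exists_col (k := k) (by omega) h2
      refine ⟨w, Finset.mem_erase.2 ⟨?_, hw⟩, e⟩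
      rintro rfl; omega
    · refine Finset.mem_erase.2 ⟨?_, hS.2⟩
      rintro rfl; omega

/-- Both terms of the product and the commutator below come from removing the variable of colour
`k` from a segment; it interacts only with the variable of colour `k + 1`. -/
theorem site_succ_mul_tau {z : V} (hz : D.col z = D.top) {k : ℕ} (hk : k < D.top) :
    D.site z (k + 1) * D.tau k = D.deg k (D.site z k) - D.deg (k + 1) (D.site z k) := by
  ext x S
  rw [tau, Shuffle.mul_single_apply, Shuffle.sub_apply, deg, deg, Shuffle.weightMul_apply,
    Shuffle.weightMul_apply, ← sub_mul]
  by_cases hS : D.IsSeg z k S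
  · obtain ⟨v, hv, hvk⟩ := hS.exists_col le_rfl hk.le
    obtain ⟨w, hw, hwk⟩ := hS.exists_col (k := k + 1) (by omega) hk
    rw [hS.sum_col hv _ hvk, hS.sum_col hw _ hwk, Finset.sum_eq_single v]
    · rw [site_of_isSeg ((isSeg_erase hz hk hv hvk).2 hS), site_of_isSeg hS,
        Finset.prod_eq_single w, D.kernel_down (by omega)]
      · intro u hu hne
        rw [Finset.mem_erase] at hu
        have h1 : D.col u ≠ k := fun e => hu.1 (hS.eq_of_col hu.2 hv (e.trans hvk.symm))
        have h2 : D.col u ≠ k + 1 := fun e => hne (hS.eq_of_col hu.2 hw (e.trans hwk.symm))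
        have h3 := hS.le_col hu.2
        exact D.kernel_far (by omega) (by omega) (by omega) x
      · intro h
        refine absurd (Finset.mem_erase.2 ⟨?_, hw⟩) h
        rintro rfl; omega
    · intro u hu hne
      rw [Finset.mem_filter] at hu
      exact absurd (hS.eq_of_col hu.1 hv (hu.2.trans hvk.symm)) hne
    · intro h; exact absurd (Finset.mem_filter.2 ⟨hv, hvk⟩) h
  · rw [site_of_not_isSeg hS, mul_zero]
    refine Finset.sum_eq_zero fun v hv => ?_
    rw [Finset.mem_filter] at hv
    rw [site_of_not_isSeg, mul_zero]
    rwa [isSeg_erase hz hk hv.1 hv.2]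

theorem site_succ_comm_tau {z : V} (hz : D.col z = D.top) {k : ℕ} (hk : k < D.top) :
    D.site z (k + 1) * D.tau k - D.tau k * D.site z (k + 1) = D.h • D.site z k := by
  ext x S
  rw [Shuffle.sub_apply, tau, Shuffle.mul_single_apply, Shuffle.single_mul_apply,
    ← Finset.sum_sub_distrib, Shuffle.smul_apply]
  by_cases hS : D.IsSeg z k S
  · obtain ⟨v, hv, hvk⟩ := hS.exists_col le_rfl hk.le
    obtain ⟨w, hw, hwk⟩ := hS.exists_col (k := k + 1) (by omega) hk
    rw [Finset.sum_eq_single v]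
    · have h0 : w ∉ S.erase v → False := by
        intro h
        refine absurd (Finset.mem_erase.2 ⟨?_, hw⟩) h
        rintro rfl; omega
      have hfar : ∀ u ∈ S.erase v, u ≠ w → D.kernel x u v = 1 ∧ D.kernel x v u = 1 := by
        intro u hu hne
        rw [Finset.mem_erase] at hu
        have h1 : D.col u ≠ k := fun e => hu.1 (hS.eq_of_col hu.2 hv (e.trans hvk.symm))
        have h2 : D.col u ≠ k + 1 := fun e => hne (hS.eq_of_col hu.2 hw (e.trans hwk.symm))
        have h3 := hS.le_col hu.2
        exact ⟨D.kernel_far (by omega) (by omega) (by omega) x,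
          D.kernel_far (by omega) (by omega) (by omega) x⟩
      rw [site_of_isSeg ((isSeg_erase hz hk hv hvk).2 hS), site_of_isSeg hS,
        Finset.prod_eq_single w (fun u hu hne => (hfar u hu hne).1) (fun h => (h0 h).elim),
        Finset.prod_eq_single w (fun u hu hne => (hfar u hu hne).2) (fun h => (h0 h).elim),
        D.kernel_down (by omega), D.kernel_up (by omega)]
      ring
    · intro u hu hne
      rw [Finset.mem_filter] at hu
      exact absurd (hS.eq_of_col hu.1 hv (hu.2.trans hvk.symm)) hne
    · intro h; exact absurd (Finset.mem_filter.2 ⟨hv, hvk⟩) h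
  · rw [site_of_not_isSeg hS, mul_zero]
    refine Finset.sum_eq_zero fun v hv => ?_
    rw [Finset.mem_filter] at hv
    rw [site_of_not_isSeg, mul_zero, mul_zero, sub_zero]
    rwa [isSeg_erase hz hk hv.1 hv.2]

theorem site_commute_tau_of_lt {z : V} {m k : ℕ} (hkm : k + 1 < m) :
    D.site z m * D.tau k = D.tau k * D.site z m := by
  ext x S
  rw [tau, Shuffle.mul_single_apply, Shuffle.single_mul_apply]
  refine Finset.sum_congr rfl fun v hv => ?_
  rw [Finset.mem_filter] at hv
  by_cases hS : D.IsSeg z m (S.erase v)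
  · congr 1
    refine Finset.prod_congr rfl fun u hu => ?_
    have := hS.le_col hu
    rw [D.kernel_far (by omega) (by omega) (by omega), D.kernel_far (by omega) (by omega) (by omega)]
  · rw [site_of_not_isSeg hS, mul_zero, mul_zero]

/-- If a segment has one of two variables of the same colour, exchanging it for the other one
gives a segment. -/
theorem IsSeg.swap {z : V} (hz : D.col z = D.top) {m k : ℕ} (hk : k < D.top) {S : Finset V}
    {v w : V} (hS : D.IsSeg z m (S.erase v)) (hv : v ∈ S) (hw : w ∈ S.erase v) (hvk : D.col v = k)
    (hwk : D.col w = k) : D.IsSeg z m (S.erase w) := by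
  have key : ∀ u ∈ S.erase w, u = v ∨ (u ∈ S.erase v ∧ D.col u ≠ k) := fun u hu => by
    rw [Finset.mem_erase] at hu
    by_cases h : u = v
    · exact Or.inl h
    · have hu' : u ∈ S.erase v := Finset.mem_erase.2 ⟨h, hu.2⟩
      exact Or.inr ⟨hu', fun e => hu.1 (hS.eq_of_col hu' hw (e.trans hwk.symm))⟩
  have hmk := hS.le_col hw
  have hne : v ≠ w := fun e => by rw [e] at hw; simp at hw
  refine IsSeg.of_forall ?_ ?_ ?_ ?_
  · intro u hu
    rcases key u hu with rfl | hu
    · omega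
    · exact hS.le_col hu.1
  · intro u hu u' hu' h
    rcases key u hu with rfl | hu <;> rcases key u' hu' with rfl | hu'
    · rfl
    · exact absurd (h.symm.trans hvk) hu'.2
    · exact absurd (h.trans hvk) hu.2
    · exact hS.eq_of_col hu.1 hu'.1 h
  · intro l h1 h2
    by_cases hl : l = k
    · exact ⟨v, Finset.mem_erase.2 ⟨hne, hv⟩, hvk.trans hl.symm⟩
    · obtain ⟨u, hu, e⟩ := hS.exists_col h1 h2
      refine ⟨u, Finset.mem_erase.2 ⟨?_, Finset.mem_of_mem_erase hu⟩, e⟩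
      rintro rfl; omega
  · refine Finset.mem_erase.2 ⟨?_, Finset.mem_of_mem_erase hS.2⟩
    rintro rfl; omega

/-- A simple root vector of a colour that already occurs in the site commutes with it. The extra
variable `v` competes with the variable `w` of the same colour in the segment, and the sum over the
two choices is symmetric by an identity between rational functions of the values of `v`, `w` and of
the variables of the two neighbouring colours. -/
theorem site_commute_tau_of_le {z : V} (hz : D.col z = D.top) {m k : ℕ} (hk : k < D.top)
    (hmk : m ≤ k)
    (hinj : ∀ x u w, D.col u = D.col w → D.col u < D.top → u ≠ w → D.val x u ≠ D.val x w) :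
    D.site z m * D.tau k = D.tau k * D.site z m := by
  ext x S
  rw [tau, Shuffle.mul_single_apply, Shuffle.single_mul_apply]
  by_cases hex : ∃ v ∈ S, D.col v = k ∧ D.IsSeg z m (S.erase v)
  · obtain ⟨v, hv, hvk, hS⟩ := hex
    obtain ⟨w, hw, hwk⟩ := hS.exists_col hmk hk.le
    have hS' : D.IsSeg z m (S.erase w) := hS.swap hz hk hv hw hvk hwk
    have hne : v ≠ w := fun e => by rw [e] at hw; simp at hw
    have hwS : w ∈ S := Finset.mem_of_mem_erase hw
    have hfil : (S.filter fun v => D.col v = k) = {v, w} := by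
      ext u
      simp only [Finset.mem_filter, Finset.mem_insert, Finset.mem_singleton]
      constructor
      · rintro ⟨hu, huk⟩
        by_cases h : u = v
        · exact Or.inl h
        · exact Or.inr (hS.eq_of_col (Finset.mem_erase.2 ⟨h, hu⟩) hw (huk.trans hwk.symm))
      · rintro (rfl | rfl)
        · exact ⟨hv, hvk⟩
        · exact ⟨hwS, hwk⟩
    obtain ⟨c, hc, hck⟩ := hS.exists_col (k := k + 1) (by omega) hk
    set R := (S.erase v).erase w with hR
    have hR' : (S.erase w).erase v = R := by rw [hR, Finset.erase_right_comm]
    have hv' : v ∈ S.erase w := Finset.mem_erase.2 ⟨hne, hv⟩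
    have hcR : c ∈ R := Finset.mem_erase.2 ⟨by rintro rfl; omega, hc⟩
    -- the product of the kernel over the remaining variables sees only the neighbouring colours
    have hprod : ∀ g : V → ℂ, (∀ u ∈ R, D.col u ≠ k + 1 → D.col u + 1 ≠ k → g u = 1) →
        ∏ u ∈ R, g u = g c * ∏ u ∈ R with D.col u + 1 = k, g u := by
      intro g hg
      rw [Finset.prod_filter, ← Finset.mul_prod_erase R g hcR,
        ← Finset.mul_prod_erase R _ hcR, if_neg (by omega), one_mul]
      congr 1
      refine Finset.prod_congr rfl fun u hu => ?_
      rw [Finset.mem_erase] at hu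
      split_ifs with h
      · rfl
      · refine hg u hu.2 (fun e => hu.1 ?_) h
        exact hS.eq_of_col (Finset.mem_of_mem_erase hu.2) hc (e.trans hck.symm)
    have hfar : ∀ u ∈ R, ∀ y, D.col y = k → D.col u ≠ k + 1 → D.col u + 1 ≠ k →
        D.kernel x u y = 1 ∧ D.kernel x y u = 1 := by
      intro u hu y hy h1 h2
      have h3 : D.col u ≠ k := fun e => by
        have := hS.eq_of_col (Finset.mem_of_mem_erase hu) hw (e.trans hwk.symm)
        rw [this] at hu; simp [hR] at hu
      exact ⟨D.kernel_far (by omega) (by omega) (by omega) x,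
        D.kernel_far (by omega) (by omega) (by omega) x⟩
    have hD : D.val x v - D.val x w ≠ 0 :=
      sub_ne_zero.2 (hinj x v w (hvk.trans hwk.symm) (by omega) hne)
    have hD' : D.val x w - D.val x v ≠ 0 := by rw [← neg_sub]; exact neg_ne_zero.2 hD
    rw [hfil, Finset.sum_pair hne, Finset.sum_pair hne, site_of_isSeg hS, site_of_isSeg hS',
      ← Finset.mul_prod_erase _ _ hw, ← Finset.mul_prod_erase _ _ hw,
      ← Finset.mul_prod_erase _ _ hv', ← Finset.mul_prod_erase _ _ hv', hR', ← hR,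
      hprod _ (fun u hu h1 h2 => (hfar u hu v hvk h1 h2).1),
      hprod _ (fun u hu h1 h2 => (hfar u hu v hvk h1 h2).2),
      hprod _ (fun u hu h1 h2 => (hfar u hu w hwk h1 h2).1),
      hprod _ (fun u hu h1 h2 => (hfar u hu w hwk h1 h2).2),
      D.kernel_same (hwk.trans hvk.symm) (by omega), D.kernel_same (hvk.trans hwk.symm) (by omega),
      D.kernel_down (u := c) (w := v) (by omega), D.kernel_down (u := c) (w := w) (by omega),
      D.kernel_up (u := v) (w := c) (by omega), D.kernel_up (u := w) (w := c) (by omega)]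
    rcases eq_or_lt_of_le hmk with rfl | hlt
    · have hemp : (R.filter fun u => D.col u + 1 = m) = ∅ := by
        refine Finset.filter_eq_empty_iff.2 fun u hu e => ?_
        have := hS.le_col (Finset.mem_of_mem_erase hu)
        omega
      simp only [hemp, Finset.prod_empty]
      field_simp
      ring
    · obtain ⟨d, hd, hdk⟩ := hS.exists_col (k := k - 1) (by omega) (by omega)
      have hsing : (R.filter fun u => D.col u + 1 = k) = {d} := by
        ext u
        simp only [Finset.mem_filter, Finset.mem_singleton]
        constructor
        · rintro ⟨hu, e⟩
          exact hS.eq_of_col (Finset.mem_of_mem_erase hu) hd (by omega)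
        · rintro rfl
          exact ⟨Finset.mem_erase.2 ⟨by rintro rfl; omega, hd⟩, by omega⟩
      simp only [hsing, Finset.prod_singleton]
      rw [D.kernel_up (u := d) (w := v) (by omega), D.kernel_up (u := d) (w := w) (by omega),
        D.kernel_down (u := v) (w := d) (by omega), D.kernel_down (u := w) (w := d) (by omega)]
      field_simp
      ring
  · push Not at hex
    rw [Finset.sum_eq_zero, Finset.sum_eq_zero]
    all_goals
      intro v hv
      rw [Finset.mem_filter] at hv
      rw [site_of_not_isSeg (hex v hv.1 hv.2), mul_zero]

end ColoredVars

namespace ColoredVars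

variable {X V : Type*} {D : ColoredVars X V} [DecidableEq V]

/-! ### Root vectors, and the degree of a word of site vectors -/

variable (D) in
/-- The root vector spanning the colours `i, …, i + d`: an iterated commutator of simple root
vectors, normalized by a division by `h` at each step. -/
def root : ℕ → ℕ → Shuffle D.kernel
  | i, 0 => D.tau i
  | i, d + 1 => D.h⁻¹ • (root (i + 1) d * D.tau i - D.tau i * root (i + 1) d)

theorem smul_root_succ (hh : D.h ≠ 0) (i d : ℕ) :
    D.h • D.root i (d + 1) = D.root (i + 1) d * D.tau i - D.tau i * D.root (i + 1) d := by
  rw [root, smul_smul, mul_inv_cancel₀ hh, one_smul]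

variable (D) in
/-- Distinct variables of the same colour below `top` have distinct values, so that the kernel has
no vanishing denominators. -/
def Separated : Prop :=
  ∀ x u w, D.col u = D.col w → D.col u < D.top → u ≠ w → D.val x u ≠ D.val x w

theorem site_comm_tau (hsep : D.Separated) {z : V} (hz : D.col z = D.top) (m : ℕ) {k : ℕ}
    (hk : k < D.top) :
    D.site z m * D.tau k - D.tau k * D.site z m = if m = k + 1 then D.h • D.site z k else 0 := by
  split_ifs with h
  · rw [h, site_succ_comm_tau hz hk]
  · rcases Nat.lt_or_ge k m with h1 | h1
    · rw [site_commute_tau_of_lt (by omega), sub_self]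
    · rw [site_commute_tau_of_le hz hk h1 hsep, sub_self]

/-- A root vector lowers the letter `i + d + 1` of a site to `i` and commutes with the sites with
other letters. -/
theorem site_comm_root (hh : D.h ≠ 0) (hsep : D.Separated) {z : V} (hz : D.col z = D.top)
    (d : ℕ) : ∀ m i, i + d < D.top →
    D.site z m * D.root i d - D.root i d * D.site z m =
      if m = i + d + 1 then D.h • D.site z i else 0 := by
  induction d with
  | zero => intro m i hi; exact site_comm_tau hsep hz m hi
  | succ d ih =>
    intro m i hi
    refine smul_right_injective _ hh ?_
    have key : D.h • (D.site z m * D.root i (d + 1) - D.root i (d + 1) * D.site z m) =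
        ((D.site z m * D.root (i + 1) d - D.root (i + 1) d * D.site z m) * D.tau i
          - D.tau i * (D.site z m * D.root (i + 1) d - D.root (i + 1) d * D.site z m))
        - ((D.site z m * D.tau i - D.tau i * D.site z m) * D.root (i + 1) d
          - D.root (i + 1) d * (D.site z m * D.tau i - D.tau i * D.site z m)) := by
      rw [smul_sub, ← mul_smul_comm, ← smul_mul_assoc, smul_root_succ hh]
      noncomm_ring
    change D.h • _ = D.h • _
    rw [key, ih m (i + 1) (by omega), site_comm_tau hsep hz m (by omega)]
    have h1 : (if m = i + 1 then D.h • D.site z i else 0) * D.root (i + 1) d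
          - D.root (i + 1) d * (if m = i + 1 then D.h • D.site z i else 0) = 0 := by
      split_ifs
      · have := ih i (i + 1) (by omega)
        rw [if_neg (by omega)] at this
        rw [smul_mul_assoc, mul_smul_comm, ← smul_sub, this, smul_zero]
      · rw [zero_mul, mul_zero, sub_self]
    rw [h1, sub_zero]
    split_ifs with h2 h3 h3
    · rw [smul_mul_assoc, mul_smul_comm, ← smul_sub, site_succ_comm_tau hz (by omega)]
    · omega
    · omega
    · rw [zero_mul, mul_zero, sub_self, smul_zero]

theorem deg_mul (k : ℕ) (f g : Shuffle D.kernel) : D.deg k (f * g) = D.deg k f * g + f * D.deg k g :=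
  Shuffle.weightMul_mul _ f g

theorem deg_tau {k l : ℕ} (h : l ≠ k) : D.deg k (D.tau l) = 0 := by
  ext x S
  rw [deg, Shuffle.weightMul_apply, tau, Shuffle.single, Finset.mul_sum, Shuffle.zero_apply]
  refine Finset.sum_eq_zero fun v hv => ?_
  rw [Finset.mem_filter] at hv
  split_ifs with hS
  · rw [hS, Finset.sum_singleton, if_neg (by omega), zero_mul]
  · rw [mul_zero]

theorem deg_site_of_lt {z : V} {m k : ℕ} (h : k < m) : D.deg k (D.site z m) = 0 := by
  ext x S
  rw [deg, Shuffle.weightMul_apply, Shuffle.zero_apply]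
  by_cases hS : D.IsSeg z m S
  · rw [Finset.sum_eq_zero, zero_mul]
    intro v hv
    have := hS.le_col hv
    rw [if_neg (by omega)]
  · rw [site_of_not_isSeg hS, mul_zero]

theorem deg_top_site {z : V} (hz : D.col z = D.top) {m : ℕ} {ζ : ℂ} (hζ : ∀ x, D.val x z = ζ) :
    D.deg D.top (D.site z m) = ζ • D.site z m := by
  ext x S
  rw [deg, Shuffle.weightMul_apply, Shuffle.smul_apply]
  by_cases hS : D.IsSeg z m S
  · rw [hS.sum_col hS.2 _ hz, hζ]
  · rw [site_of_not_isSeg hS, mul_zero, mul_zero]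

/-- The difference of the values of the two variables of neighbouring colours `i + d`, `i + d + 1`
in a site with letter `i` is produced by a root vector. For `d = 0` this is `site_succ_mul_tau`;
the general case follows by commuting with the simple root vector of colour `i`, which the degree
derivations of other colours annihilate. -/
theorem deg_sub_deg_site (hh : D.h ≠ 0) (hsep : D.Separated) {z : V} (hz : D.col z = D.top)
    (d : ℕ) : ∀ i, i + d < D.top →
    D.deg (i + d) (D.site z i) - D.deg (i + d + 1) (D.site z i) =
      D.site z (i + d + 1) * D.root i d := by
  induction d with
  | zero => intro i hi; exact (site_succ_mul_tau hz hi).symm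
  | succ d ih =>
    intro i hi
    refine smul_right_injective _ hh ?_
    change D.h • _ = D.h • _
    have ih' := ih (i + 1) (by omega)
    rw [show i + 1 + d = i + (d + 1) by omega] at ih'
    have hc := site_comm_tau hsep hz (i + (d + 1) + 1) (k := i) (by omega)
    rw [if_neg (by omega)] at hc
    rw [smul_sub, ← map_smul, ← map_smul, ← site_succ_comm_tau hz (by omega), map_sub, map_sub,
      deg_mul, deg_mul, deg_mul, deg_mul, deg_tau (by omega), deg_tau (by omega), ← mul_smul_comm,
      smul_root_succ hh]
    have e1 : D.deg (i + (d + 1)) (D.site z (i + 1)) =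
        D.deg (i + (d + 1) + 1) (D.site z (i + 1)) +
          D.site z (i + (d + 1) + 1) * D.root (i + 1) d := by rw [← ih']; abel
    have e2 : D.tau i * D.site z (i + (d + 1) + 1) = D.site z (i + (d + 1) + 1) * D.tau i :=
      (sub_eq_zero.1 hc).symm
    rw [e1]
    have e3 : D.tau i * (D.site z (i + (d + 1) + 1) * D.root (i + 1) d) =
        D.site z (i + (d + 1) + 1) * (D.tau i * D.root (i + 1) d) := by
      rw [← mul_assoc, e2, mul_assoc]
    simp only [mul_add, add_mul, e3, mul_sub, mul_zero, zero_mul, mul_assoc]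
    abel

variable (D) in
/-- The derivation which multiplies by the sum of the variables of colour `i` minus the sum of the
variables of colour `i - 1` (there is no second sum for `i = 0`). This is how `κ q_i ∂/∂q_i` acts
on the terms of the Jackson integral. -/
def cartanDeg (i : ℕ) : Shuffle D.kernel →ₗ[ℂ] Shuffle D.kernel :=
  D.deg i - if i = 0 then 0 else D.deg (i - 1)

variable (D) in
/-- The term by which the letter `i` of a site is raised to `j > i` in the Cartan degree: the site
with letter `j` times the root vector of the colours `i, …, j - 1`. It vanishes if the letter of
the site is not `i`. -/
def siteMove (i j : ℕ) (z : V) (m : ℕ) : Shuffle D.kernel :=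
  if m = i then D.site z j * D.root i (j - i - 1) else 0

theorem cartanDeg_mul (i : ℕ) (f g : Shuffle D.kernel) :
    D.cartanDeg i (f * g) = D.cartanDeg i f * g + f * D.cartanDeg i g := by
  unfold cartanDeg
  split_ifs
  · simp [deg_mul]
  · simp only [LinearMap.sub_apply, deg_mul, sub_mul, mul_sub]; abel

theorem cartanDeg_one (i : ℕ) : D.cartanDeg i 1 = 0 := by
  unfold cartanDeg
  split_ifs <;> simp [deg, Shuffle.weightMul_one]

/-- The Cartan degree of a site with letter `m`. For `m = i` the value of the variable of colour
`i` is the telescoping sum of the value `ζ` of the last variable and of the differences of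
neighbouring values, for `m < i` a single difference remains, and for `m > i` nothing. -/
theorem cartanDeg_site (hh : D.h ≠ 0) (hsep : D.Separated) {z : V} (hz : D.col z = D.top)
    {ζ : ℂ} (hζ : ∀ x, D.val x z = ζ) {i m : ℕ} (hi : i ≤ D.top) :
    D.cartanDeg i (D.site z m) = (if m = i then ζ else 0) • D.site z m
      + ∑ j ∈ Finset.Ioc i D.top, D.siteMove i j z m - ∑ l ∈ Finset.range i, D.siteMove l i z m := by
  rcases lt_trichotomy m i with hlt | rfl | hgt
  · have h1 : ∑ j ∈ Finset.Ioc i D.top, D.siteMove i j z m = 0 :=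
      Finset.sum_eq_zero fun j _ => if_neg (by omega)
    have h2 : ∑ l ∈ Finset.range i, D.siteMove l i z m = D.siteMove m i z m :=
      Finset.sum_eq_single m (fun l _ hl => if_neg (Ne.symm hl))
        (fun h => absurd (Finset.mem_range.2 hlt) h)
    have h3 := deg_sub_deg_site hh hsep hz (i - m - 1) m (by omega)
    rw [show m + (i - m - 1) = i - 1 by omega, show i - 1 + 1 = i by omega] at h3
    rw [h1, h2, siteMove, if_pos rfl, if_neg (by omega), zero_smul, zero_add, zero_sub, ← h3,
      cartanDeg, if_neg (by omega), LinearMap.sub_apply, neg_sub]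
  · have h2 : ∑ l ∈ Finset.range m, D.siteMove l m z m = 0 :=
      Finset.sum_eq_zero fun l hl => if_neg (by rw [Finset.mem_range] at hl; omega)
    have h1 : ∀ N, m + N ≤ D.top → ∑ j ∈ Finset.Ioc m (m + N), D.siteMove m j z m =
        D.deg m (D.site z m) - D.deg (m + N) (D.site z m) := by
      intro N
      induction N with
      | zero => intro _; simp
      | succ N ih =>
        intro hN
        rw [← add_assoc, Finset.sum_Ioc_succ_top (by omega), ih (by omega), siteMove, if_pos rfl,
          show m + N + 1 - m - 1 = N by omega, ← deg_sub_deg_site hh hsep hz N m (by omega)]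
        abel
    have h3 := h1 (D.top - m) (by omega)
    rw [show m + (D.top - m) = D.top by omega, deg_top_site hz hζ] at h3
    have h4 : (if m = 0 then (0 : Shuffle D.kernel →ₗ[ℂ] Shuffle D.kernel) else D.deg (m - 1))
        (D.site z m) = 0 := by
      split_ifs
      · rfl
      · exact deg_site_of_lt (by omega)
    rw [h2, h3, if_pos rfl, cartanDeg, LinearMap.sub_apply, h4]
    abel
  · have h1 : ∑ j ∈ Finset.Ioc i D.top, D.siteMove i j z m = 0 :=
      Finset.sum_eq_zero fun j _ => if_neg (by omega)
    have h2 : ∑ l ∈ Finset.range i, D.siteMove l i z m = 0 :=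
      Finset.sum_eq_zero fun l hl => if_neg (by rw [Finset.mem_range] at hl; omega)
    have h4 : (if i = 0 then (0 : Shuffle D.kernel →ₗ[ℂ] Shuffle D.kernel) else D.deg (i - 1))
        (D.site z m) = 0 := by
      split_ifs
      · rfl
      · exact deg_site_of_lt (by omega)
    rw [h1, h2, if_neg (by omega), cartanDeg, LinearMap.sub_apply, h4, deg_site_of_lt hgt]
    simp

variable {ι : Type*}

variable (D) in
/-- The product of the site vectors of `z a` with letters `p a`, where `a` runs over `L`. -/
def word (z : ι → V) (L : List ι) (p : ι → ℕ) : Shuffle D.kernel :=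
  (L.map fun a => D.site (z a) (p a)).prod

@[simp] theorem word_nil (z : ι → V) (p : ι → ℕ) : D.word z [] p = 1 := rfl

theorem word_cons (z : ι → V) (a : ι) (L : List ι) (p : ι → ℕ) :
    D.word z (a :: L) p = D.site (z a) (p a) * D.word z L p := by simp [word]

variable [LinearOrder ι]

theorem word_update_of_notMem (z : ι → V) {a : ι} {L : List ι} (ha : a ∉ L) (p : ι → ℕ) (m : ℕ) :
    D.word z L (Function.update p a m) = D.word z L p := by
  unfold word
  congr 1
  refine List.map_congr_left fun b hb => ?_
  rw [Function.update_of_ne]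
  rintro rfl; exact ha hb

/-- Commuting a root vector past a word replaces, in turn, each letter `i + d + 1` by `i`. -/
theorem word_comm_root (hh : D.h ≠ 0) (hsep : D.Separated) (z : ι → V)
    (hz : ∀ a, D.col (z a) = D.top) {i d : ℕ} (hi : i + d < D.top) (p : ι → ℕ) (L : List ι)
    (hL : L.Nodup) :
    D.word z L p * D.root i d - D.root i d * D.word z L p =
      D.h • ∑ b ∈ L.toFinset, if p b = i + d + 1 then D.word z L (Function.update p b i) else 0 := by
  induction L with
  | nil => simp
  | cons a L ih =>
    rw [List.nodup_cons] at hL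
    have hsum : (∑ b ∈ L.toFinset, if p b = i + d + 1 then
          D.word z (a :: L) (Function.update p b i) else 0) =
        D.site (z a) (p a) * ∑ b ∈ L.toFinset, if p b = i + d + 1 then
          D.word z L (Function.update p b i) else 0 := by
      rw [Finset.mul_sum]
      refine Finset.sum_congr rfl fun b hb => ?_
      have hab : a ≠ b := by rintro rfl; exact hL.1 (List.mem_toFinset.1 hb)
      rw [word_cons, Function.update_of_ne hab, mul_ite, mul_zero]
    have hcomm := site_comm_root hh hsep (hz a) d (p a) i hi
    have key : D.word z (a :: L) p * D.root i d - D.root i d * D.word z (a :: L) p =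
        D.site (z a) (p a) * (D.word z L p * D.root i d - D.root i d * D.word z L p) +
        (D.site (z a) (p a) * D.root i d - D.root i d * D.site (z a) (p a)) * D.word z L p := by
      rw [word_cons]; noncomm_ring
    rw [key, ih hL.2, hcomm, List.toFinset_cons,
      Finset.sum_insert (fun h => hL.1 (List.mem_toFinset.1 h)), hsum, word_cons,
      Function.update_self, word_update_of_notMem z hL.1, smul_add, mul_smul_comm, add_comm,
      ite_mul, zero_mul, smul_mul_assoc, smul_ite, smul_zero]

variable (D) in
/-- The sum over the places of the word of the products in which the site at that place is
replaced by its `siteMove`. -/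
def wordMove (i j : ℕ) (z : ι → V) (p : ι → ℕ) : List ι → Shuffle D.kernel
  | [] => 0
  | a :: L => D.siteMove i j (z a) (p a) * D.word z L p + D.site (z a) (p a) * wordMove i j z p L

theorem cartanDeg_word (hh : D.h ≠ 0) (hsep : D.Separated) (z : ι → V)
    (hz : ∀ a, D.col (z a) = D.top) {ζ : ι → ℂ} (hζ : ∀ a x, D.val x (z a) = ζ a) {i : ℕ}
    (hi : i ≤ D.top) (p : ι → ℕ) (L : List ι) (hL : L.Nodup) :
    D.cartanDeg i (D.word z L p) =
      (∑ a ∈ L.toFinset, if p a = i then ζ a else 0) • D.word z L p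
      + ∑ j ∈ Finset.Ioc i D.top, D.wordMove i j z p L
      - ∑ l ∈ Finset.range i, D.wordMove l i z p L := by
  induction L with
  | nil => simp [wordMove, cartanDeg_one]
  | cons a L ih =>
    rw [List.nodup_cons] at hL
    rw [word_cons, cartanDeg_mul, ih hL.2, cartanDeg_site hh hsep (hz a) (hζ a) hi,
      List.toFinset_cons, Finset.sum_insert (fun h => hL.1 (List.mem_toFinset.1 h))]
    simp only [wordMove, Finset.sum_add_distrib, ← Finset.mul_sum, ← Finset.sum_mul, mul_add,
      mul_sub, add_mul, sub_mul, add_smul, smul_mul_assoc, mul_smul_comm]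
    abel

/-- The root vectors which the moves create inside the word are brought to its right end; passing
the sites to the right of the place `a` produces the correction terms with `a < b`. -/
theorem wordMove_eq (hh : D.h ≠ 0) (hsep : D.Separated) (z : ι → V)
    (hz : ∀ a, D.col (z a) = D.top) {i j : ℕ} (hij : i < j) (hj : j ≤ D.top) (p : ι → ℕ)
    (L : List ι) (hL : L.Pairwise (· < ·)) :
    D.wordMove i j z p L =
      ∑ a ∈ L.toFinset, (if p a = i then
        D.word z L (Function.update p a j) * D.root i (j - i - 1)
        - D.h • ∑ b ∈ L.toFinset, (if a < b ∧ p b = j then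
            D.word z L (Function.update (Function.update p a j) b i) else 0) else 0) := by
  induction L with
  | nil => simp [wordMove]
  | cons a L ih =>
    have hL' := hL
    rw [List.pairwise_cons] at hL
    have haL : a ∉ L := fun h => lt_irrefl _ (hL.1 a h)
    have haL' : a ∉ L.toFinset := fun h => haL (List.mem_toFinset.1 h)
    have hcomm := word_comm_root hh hsep z hz (i := i) (d := j - i - 1) (by omega) p L
      (hL.2.imp ne_of_lt)
    rw [show i + (j - i - 1) + 1 = j by omega] at hcomm
    have hcomm' : D.root i (j - i - 1) * D.word z L p = D.word z L p * D.root i (j - i - 1) -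
        D.h • ∑ b ∈ L.toFinset, if p b = j then D.word z L (Function.update p b i) else 0 := by
      rw [← hcomm]; abel
    rw [wordMove, ih hL.2, List.toFinset_cons, Finset.sum_insert haL']
    congr 1
    · unfold siteMove
      split_ifs with h
      · rw [mul_assoc, hcomm', mul_sub, word_cons, Function.update_self,
          word_update_of_notMem z haL, mul_assoc, mul_smul_comm, Finset.mul_sum,
          Finset.sum_insert haL', if_neg (fun h => lt_irrefl _ h.1), zero_add]
        congr 2
        refine Finset.sum_congr rfl fun b hb => ?_
        have hab := hL.1 b (List.mem_toFinset.1 hb)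
        simp only [hab, true_and, mul_ite, mul_zero]
        rw [word_cons, Function.update_of_ne hab.ne, Function.update_self,
          Function.update_comm hab.ne, word_update_of_notMem z haL]
      · rw [zero_mul]
    · rw [Finset.mul_sum]
      refine Finset.sum_congr rfl fun c hc => ?_
      have hac := hL.1 c (List.mem_toFinset.1 hc)
      rw [mul_ite, mul_zero]
      congr 1
      rw [mul_sub, word_cons, Function.update_of_ne hac.ne, mul_assoc, mul_smul_comm,
        Finset.mul_sum, Finset.sum_insert haL', if_neg (fun h => lt_asymm h.1 hac), zero_add]
      congr 2
      refine Finset.sum_congr rfl fun b hb => ?_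
      have hab := hL.1 b (List.mem_toFinset.1 hb)
      rw [mul_ite, mul_zero, word_cons, Function.update_of_ne hab.ne, Function.update_of_ne hac.ne]

end ColoredVars

open Filter Topology

/-! ### Geometric summation and termwise differentiation -/

theorem summable_prod_apply {ι α : Type*} [Fintype ι] {g : α → ℝ} (hg0 : ∀ a, 0 ≤ g a)
    (hg : Summable g) : Summable fun r : ι → α => ∏ x, g (r x) := by
  classical
  refine summable_of_sum_le (c := ∏ _x : ι, ∑' a, g a)
    (fun r => Finset.prod_nonneg fun x _ => hg0 _) fun s => ?_
  calc ∑ r ∈ s, ∏ x, g (r x)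
      ≤ ∑ r ∈ Fintype.piFinset fun x : ι => s.image fun r => r x, ∏ x, g (r x) := by
        refine Finset.sum_le_sum_of_subset_of_nonneg (fun r hr => ?_)
          fun r _ _ => Finset.prod_nonneg fun x _ => hg0 _
        exact Fintype.mem_piFinset.2 fun x => Finset.mem_image_of_mem _ hr
    _ = ∏ x : ι, ∑ a ∈ s.image fun r => r x, g a := by
        rw [Finset.prod_univ_sum]
    _ ≤ ∏ _x : ι, ∑' a, g a :=
        Finset.prod_le_prod (fun x _ => Finset.sum_nonneg fun a _ => hg0 a)
          fun x _ => hg.sum_le_tsum _ fun a _ => hg0 a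

theorem summable_geometric_mul_pow_int {ρ : ℝ} (h0 : 0 ≤ ρ) (h1 : ρ < 1) (d : ℕ) :
    Summable fun m : ℤ => (1 + ‖m‖) ^ d * ρ ^ m.natAbs := by
  have hnat : Summable fun n : ℕ => (1 + (n : ℝ)) ^ d * ρ ^ n := by
    rcases h0.eq_or_lt with rfl | h0
    · refine summable_of_ne_finset_zero (s := {0}) fun n hn => ?_
      rw [zero_pow (by simpa using hn), mul_zero]
    · have h2 := (summable_nat_add_iff 1).2
        (summable_pow_mul_geometric_of_norm_lt_one d (r := ρ) (by rwa [Real.norm_of_nonneg h0.le]))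
      refine (h2.mul_left ρ⁻¹).congr fun n => ?_
      push_cast
      field_simp
      ring
  refine Summable.of_nat_of_neg ?_ ?_
  · refine hnat.congr fun n => ?_
    simp
  · refine hnat.congr fun n => ?_
    simp

theorem summable_geometric_mul_pow {ι : Type*} [Fintype ι] {ρ : ℝ} (h0 : 0 ≤ ρ) (h1 : ρ < 1)
    (d : ℕ) : Summable fun r : ι → ℤ => (1 + ‖r‖) ^ d * ∏ x, ρ ^ (r x).natAbs := by
  refine Summable.of_nonneg_of_le (fun r => by positivity) (fun r => ?_)
    (summable_prod_apply (ι := ι) (fun m : ℤ => by positivity)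
      (summable_geometric_mul_pow_int h0 h1 d))
  rw [Finset.prod_mul_distrib, Finset.prod_pow]
  have hone : ∀ x, (1 : ℝ) ≤ 1 + ‖r x‖ := fun x => by linarith [norm_nonneg (r x)]
  have h2 : 1 + ‖r‖ ≤ ∏ x, (1 + ‖r x‖) := by
    have h3 : ∀ s : Finset ι, (1 : ℝ) ≤ ∏ x ∈ s, (1 + ‖r x‖) := fun s =>
      (Finset.prod_const_one (s := s) (M := ℝ)).symm.trans_le
        (Finset.prod_le_prod (fun _ _ => zero_le_one) fun x _ => hone x)
    have h4 : ‖r‖ ≤ ∏ x, (1 + ‖r x‖) - 1 := by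
      refine (pi_norm_le_iff_of_nonneg (by linarith [h3 Finset.univ])).2 fun x => ?_
      have : 1 + ‖r x‖ ≤ ∏ x, (1 + ‖r x‖) := by
        classical
        rw [← Finset.mul_prod_erase _ _ (Finset.mem_univ x)]
        exact le_mul_of_one_le_right (by positivity) (h3 _)
      linarith
    linarith
  gcongr

/-- Termwise differentiation of a locally dominated series of holomorphic functions; the
derivatives are dominated by the Cauchy estimate. -/
theorem hasFDerivAt_tsum_of_norm_le {ι E : Type*} [NormedAddCommGroup E] [NormedSpace ℂ E]
    {f : ι → E → ℂ} {p : E} {u : ι → ℝ} (hu : Summable u)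
    (hf : ∀ᶠ q in 𝓝 p, ∀ r, DifferentiableAt ℂ (f r) q)
    (hb : ∀ᶠ q in 𝓝 p, ∀ r, ‖f r q‖ ≤ u r) :
    (Summable fun r => fderiv ℂ (f r) p) ∧
      HasFDerivAt (fun q => ∑' r, f r q) (∑' r, fderiv ℂ (f r) p) p := by
  obtain ⟨δ, hδ, hball⟩ := Metric.eventually_nhds_iff_ball.1 (hf.and hb)
  have hδ2 : 0 < δ / 2 := by positivity
  have hbound : ∀ r, ∀ q ∈ Metric.ball p (δ / 2), ‖fderiv ℂ (f r) q‖ ≤ 2 * u r / (δ / 2) := by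
    intro r q hq
    have hsub : Metric.ball q (δ / 2) ⊆ Metric.ball p δ :=
      Metric.ball_subset_ball' (by rw [Metric.mem_ball] at hq; linarith)
    refine Complex.norm_fderiv_le_div_of_mapsTo_ball ?_ ?_ hδ2
    · exact fun y hy => ((hball y (hsub hy)).1 r).differentiableWithinAt
    · intro y hy
      rw [Metric.mem_closedBall, dist_eq_norm]
      have h1 := (hball y (hsub hy)).2 r
      have h2 := (hball q (hsub (Metric.mem_ball_self hδ2))).2 r
      exact (norm_sub_le _ _).trans (by linarith)
  have hu' : Summable fun r => 2 * u r / (δ / 2) := (hu.mul_left 2).div_const _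
  refine ⟨Summable.of_norm_bounded hu' fun r => hbound r p (Metric.mem_ball_self hδ2), ?_⟩
  refine hasFDerivAt_tsum_of_isPreconnected hu' Metric.isOpen_ball
    (convex_ball p (δ / 2)).isPreconnected (fun r q hq => ?_) hbound
    (Metric.mem_ball_self hδ2) (Summable.of_norm_bounded hu fun r => ?_) (Metric.mem_ball_self hδ2)
  · exact ((hball q (Metric.ball_subset_ball (by linarith) hq)).1 r).hasFDerivAt
  · exact (hball p (Metric.mem_ball_self hδ)).2 r

/-! ### Families of polynomial growth -/

/-- A family of functions indexed by lattice vectors `r` which is bounded along the filter `l` by a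
polynomial in `‖r‖`, uniformly in the argument. -/
def Tempered {ι P : Type*} [Fintype ι] (l : Filter P) (F : (ι → ℤ) → P → ℂ) : Prop :=
  ∃ (K : ℝ) (d : ℕ), ∀ᶠ p in l, ∀ r, ‖F r p‖ ≤ K * (1 + ‖r‖) ^ d

namespace Tempered

variable {ι P : Type*} [Fintype ι] {l : Filter P}

theorem add {F G : (ι → ℤ) → P → ℂ} (hF : Tempered l F) (hG : Tempered l G) :
    Tempered l fun r p => F r p + G r p := by
  obtain ⟨K, d, h⟩ := hF
  obtain ⟨K', d', h'⟩ := hG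
  refine ⟨|K| + |K'|, d + d', ?_⟩
  filter_upwards [h, h'] with p hp hp' r
  have h1 : (1 : ℝ) ≤ 1 + ‖r‖ := by linarith [norm_nonneg r]
  refine (norm_add_le _ _).trans ?_
  rw [add_mul]
  refine add_le_add ((hp r).trans ?_) ((hp' r).trans ?_)
  · exact mul_le_mul (le_abs_self K) (pow_le_pow_right₀ h1 (Nat.le_add_right _ _)) (by positivity)
      (abs_nonneg _)
  · exact mul_le_mul (le_abs_self K') (pow_le_pow_right₀ h1 (Nat.le_add_left _ _)) (by positivity)
      (abs_nonneg _)

theorem mul {F G : (ι → ℤ) → P → ℂ} (hF : Tempered l F) (hG : Tempered l G) :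
    Tempered l fun r p => F r p * G r p := by
  obtain ⟨K, d, h⟩ := hF
  obtain ⟨K', d', h'⟩ := hG
  refine ⟨|K| * |K'|, d + d', ?_⟩
  filter_upwards [h, h'] with p hp hp' r
  rw [norm_mul, pow_add]
  calc ‖F r p‖ * ‖G r p‖ ≤ (|K| * (1 + ‖r‖) ^ d) * (|K'| * (1 + ‖r‖) ^ d') := by
        refine mul_le_mul ((hp r).trans ?_) ((hp' r).trans ?_) (norm_nonneg _) (by positivity)
        · gcongr; exact le_abs_self K
        · gcongr; exact le_abs_self K'
    _ = _ := by ring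

theorem of_bounded {F : (ι → ℤ) → P → ℂ} (K : ℝ) (h : ∀ᶠ p in l, ∀ r, ‖F r p‖ ≤ K) :
    Tempered l F := ⟨K, 0, by simpa using h⟩

theorem const (c : ℂ) : Tempered l fun (_ : ι → ℤ) (_ : P) => c :=
  of_bounded ‖c‖ (Eventually.of_forall fun _ _ => le_rfl)

theorem neg {F : (ι → ℤ) → P → ℂ} (hF : Tempered l F) : Tempered l fun r p => -F r p := by
  simpa using (const (l := l) (ι := ι) (-1)).mul hF

theorem sub {F G : (ι → ℤ) → P → ℂ} (hF : Tempered l F) (hG : Tempered l G) :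
    Tempered l fun r p => F r p - G r p := by
  simpa only [sub_eq_add_neg] using hF.add hG.neg

theorem sum {α : Type*} (s : Finset α) {F : α → (ι → ℤ) → P → ℂ}
    (h : ∀ a ∈ s, Tempered l (F a)) : Tempered l fun r p => ∑ a ∈ s, F a r p := by
  classical
  induction s using Finset.induction_on with
  | empty => simpa using const 0
  | insert a s ha ih =>
    simp only [Finset.sum_insert ha]
    exact (h a (Finset.mem_insert_self a s)).add (ih fun b hb => h b (Finset.mem_insert_of_mem hb))

theorem prod {α : Type*} (s : Finset α) {F : α → (ι → ℤ) → P → ℂ}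
    (h : ∀ a ∈ s, Tempered l (F a)) : Tempered l fun r p => ∏ a ∈ s, F a r p := by
  classical
  induction s using Finset.induction_on with
  | empty => simpa using const 1
  | insert a s ha ih =>
    simp only [Finset.prod_insert ha]
    exact (h a (Finset.mem_insert_self a s)).mul (ih fun b hb => h b (Finset.mem_insert_of_mem hb))

theorem of_continuousAt [TopologicalSpace P] {p : P} {a : P → ℂ} (ha : ContinuousAt a p) :
    Tempered (𝓝 p) fun (_ : ι → ℤ) q => a q := by
  refine of_bounded (‖a p‖ + 1) ?_
  filter_upwards [ha.norm.eventually (gt_mem_nhds (lt_add_one _))] with q hq _ using hq.le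

/-- A polynomial bound in an integer `N r` which grows at most linearly with `r`. -/
theorem of_int {N : (ι → ℤ) → ℤ} {c : ℝ} (hN : ∀ r, ‖N r‖ ≤ c * ‖r‖) {F : ℤ → P → ℂ} {K : ℝ} {d : ℕ}
    (h : ∀ᶠ p in l, ∀ m, ‖F m p‖ ≤ K * (1 + ‖m‖) ^ d) : Tempered l fun r p => F (N r) p := by
  refine ⟨|K| * (1 + |c|) ^ d, d, ?_⟩
  filter_upwards [h] with p hp r
  refine (hp _).trans ?_
  rw [mul_assoc, ← mul_pow]
  have h1 : ‖N r‖ ≤ |c| * ‖r‖ :=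
    (hN r).trans (mul_le_mul_of_nonneg_right (le_abs_self c) (norm_nonneg r))
  have h2 : 1 + ‖N r‖ ≤ (1 + |c|) * (1 + ‖r‖) := by
    nlinarith [norm_nonneg r, abs_nonneg c]
  gcongr
  exact le_abs_self K

theorem int {N : (ι → ℤ) → ℤ} {c : ℝ} (hN : ∀ r, ‖N r‖ ≤ c * ‖r‖) :
    Tempered l fun r (_ : P) => (N r : ℂ) := by
  refine of_int (F := fun m _ => (m : ℂ)) (K := 1) (d := 1) hN (Eventually.of_forall fun p m => ?_)
  rw [Complex.norm_intCast, pow_one, one_mul, ← Int.norm_eq_abs]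
  linarith

end Tempered

/-- Near a point off the integers, the distance to an integer `-m` is bounded below by a multiple
of `1 + |m|`. -/
theorem eventually_le_norm_add_int {u₀ : ℂ} (hu : ∀ m : ℤ, u₀ ≠ m) :
    ∃ c : ℝ, 0 < c ∧ ∀ᶠ u : ℂ in 𝓝 u₀, ∀ m : ℤ, c * (1 + ‖m‖) ≤ ‖u + m‖ := by
  have hclosed : IsClosed (Set.range ((↑) : ℤ → ℂ)) := Complex.isClosed_range_intCast
  have hmem : u₀ ∈ (Set.range ((↑) : ℤ → ℂ))ᶜ := by
    rintro ⟨m, hm⟩; exact hu m hm.symm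
  obtain ⟨ε, hε, hball⟩ := Metric.isOpen_iff.1 hclosed.isOpen_compl u₀ hmem
  set R := ‖u₀‖ + ε with hR
  have hR0 : 0 ≤ R := by positivity
  refine ⟨(ε / 2) / (1 + R + ε / 2), by positivity, ?_⟩
  filter_upwards [Metric.ball_mem_nhds u₀ (half_pos hε)] with u hu m
  rw [Metric.mem_ball, dist_eq_norm] at hu
  have h1 : ε / 2 ≤ ‖u + m‖ := by
    by_contra hlt
    push Not at hlt
    have : ((-m : ℤ) : ℂ) ∈ Metric.ball u₀ ε := by
      rw [Metric.mem_ball, dist_eq_norm]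
      have e : (((-m : ℤ) : ℂ) - u₀) = (u - u₀) - (u + m) := by push_cast; ring
      rw [e]
      exact (norm_sub_le _ _).trans_lt (by linarith)
    exact hball this ⟨-m, rfl⟩
  have h2 : ‖m‖ ≤ ‖u + m‖ + R := by
    have e : ((m : ℤ) : ℂ) = (u + m) - (u - u₀) - u₀ := by ring
    have h3 : ‖(m : ℂ)‖ ≤ ‖u + m‖ + ‖u - u₀‖ + ‖u₀‖ := by
      conv_lhs => rw [e]
      exact (norm_sub_le _ _).trans (add_le_add_left (norm_sub_le _ _) _)
    rw [Complex.norm_intCast, ← Int.norm_eq_abs] at h3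
    linarith
  rw [div_mul_eq_mul_div, div_le_iff₀ (by positivity)]
  nlinarith

/-- A solution of a first-order recursion grows polynomially if the ratio of the coefficients is
`1 + O(1 / j)`. -/
theorem norm_le_of_recursion {b α β : ℕ → ℂ} {B c : ℝ} {A : ℕ} (hc : 0 < c) (hA : B ≤ A * c)
    (hrec : ∀ j, b (j + 1) * α j = b j * β j) (hαβ : ∀ j, ‖β j‖ ≤ ‖α j‖ + B)
    (hα : ∀ j : ℕ, c * (1 + j) ≤ ‖α j‖) (j : ℕ) : ‖b j‖ ≤ ‖b 0‖ * (1 + j) ^ A := by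
  induction j with
  | zero => simp
  | succ j ih =>
    have hpos : 0 < ‖α j‖ := lt_of_lt_of_le (by positivity) (hα j)
    have h1 : ‖b (j + 1)‖ * ‖α j‖ = ‖b j‖ * ‖β j‖ := by rw [← norm_mul, hrec, norm_mul]
    have h2 : ‖β j‖ * (1 + j) ≤ ‖α j‖ * (1 + j + A) := by
      have h3 := hαβ j
      have h4 := hα j
      have h5 : B * (1 + j) ≤ A * ‖α j‖ := by
        calc B * (1 + j) ≤ A * c * (1 + j) := by gcongr
          _ = A * (c * (1 + j)) := by ring
          _ ≤ A * ‖α j‖ := by gcongr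
      nlinarith
    have h6 : (1 + (j : ℝ) + A) * (1 + j) ^ A ≤ (1 + j) * (1 + (j + 1)) ^ A := by
      have h7 := one_add_mul_le_pow (a := 1 / (1 + (j : ℝ))) (by
        have : (0 : ℝ) ≤ 1 / (1 + (j : ℝ)) := by positivity
        linarith) A
      have h8 : (1 + 1 / (1 + (j : ℝ))) ^ A * (1 + j) ^ A = (1 + (j + 1)) ^ A := by
        rw [← mul_pow]; congr 1; field_simp; ring
      rw [← h8]
      calc (1 + (j : ℝ) + A) * (1 + j) ^ A
          = (1 + j) * ((1 + A * (1 / (1 + (j : ℝ)))) * (1 + j) ^ A) := by field_simp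
        _ ≤ _ := by gcongr
    have h9 : ‖b (j + 1)‖ * ‖α j‖ * (1 + j) ≤ ‖b 0‖ * (1 + (j + 1)) ^ A * ‖α j‖ * (1 + j) := by
      calc ‖b (j + 1)‖ * ‖α j‖ * (1 + j) = ‖b j‖ * (‖β j‖ * (1 + j)) := by rw [h1]; ring
        _ ≤ (‖b 0‖ * (1 + j) ^ A) * (‖α j‖ * (1 + j + A)) := by gcongr
        _ = ‖b 0‖ * ‖α j‖ * ((1 + j + A) * (1 + j) ^ A) := by ring
        _ ≤ ‖b 0‖ * ‖α j‖ * ((1 + j) * (1 + (j + 1)) ^ A) := by gcongr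
        _ = _ := by ring
    have h10 : (0 : ℝ) < 1 + j := by positivity
    push_cast
    exact le_of_mul_le_mul_right (le_of_mul_le_mul_right h9 h10) hpos

theorem norm_le_of_recursion_int {b α β : ℤ → ℂ} {B c : ℝ} {A : ℕ} (hc : 0 < c) (hA : B ≤ A * c)
    (hrec : ∀ m, b (m + 1) * α m = b m * β m) (hαβ : ∀ m, ‖β m‖ ≤ ‖α m‖ + B)
    (hβα : ∀ m, ‖α m‖ ≤ ‖β m‖ + B) (hα : ∀ j : ℕ, c * (1 + j) ≤ ‖α j‖)
    (hβ : ∀ j : ℕ, c * (1 + j) ≤ ‖β (-(j + 1))‖) (m : ℤ) : ‖b m‖ ≤ ‖b 0‖ * (1 + ‖m‖) ^ A := by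
  obtain ⟨j, rfl | rfl⟩ := m.eq_nat_or_neg
  · have := norm_le_of_recursion (b := fun j : ℕ => b j) (α := fun j : ℕ => α j)
      (β := fun j : ℕ => β j) hc hA (fun j => by have := hrec j; push_cast; exact this)
      (fun j => hαβ j) hα j
    simpa using this
  · have := norm_le_of_recursion (b := fun j : ℕ => b (-j)) (α := fun j : ℕ => β (-(j + 1)))
      (β := fun j : ℕ => α (-(j + 1))) hc hA
      (fun j => by have := hrec (-(j + 1)); push_cast; rw [← this]; congr 2; ring)
      (fun j => hβα _) hβ j
    simpa using this

/-! ### The function `φ`: functional equation, residues and growth on the lattice -/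

section

/-- `x` is not an integer multiple of `κ`. -/
def OffLattice (κ x : ℂ) : Prop := ∀ m : ℤ, x ≠ m * κ

namespace OffLattice

variable {κ x : ℂ}

theorem neg (hx : OffLattice κ x) : OffLattice κ (-x) := fun m h =>
  hx (-m) (by rw [← neg_neg x, h]; push_cast; ring)

theorem add_int (hx : OffLattice κ x) (m : ℤ) : OffLattice κ (x + m * κ) := fun k h =>
  hx (k - m) (by push_cast; rw [sub_mul, ← h]; ring)

theorem ne_zero (hx : OffLattice κ x) : x ≠ 0 := by simpa using hx 0

theorem div_ne (hκ : κ ≠ 0) (hx : OffLattice κ x) (m : ℤ) : x / κ ≠ m := fun h =>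
  hx m (by rw [← h, div_mul_cancel₀ _ hκ])

end OffLattice

variable {κ : ℂ}

theorem phi_add (hκ : κ ≠ 0) {h x : ℂ} (hx : x ≠ 0) (hx' : h - x - κ ≠ 0) :
    phi κ h (x + κ) * (h - x - κ) = x * phi κ h x := by
  have h1 : Complex.Gamma ((x + κ) / κ) = x / κ * Complex.Gamma (x / κ) := by
    rw [← Complex.Gamma_add_one _ (div_ne_zero hx hκ), add_div, div_self hκ]
  have h2 : Complex.Gamma ((h - x) / κ) =
      (h - x - κ) / κ * Complex.Gamma ((h - (x + κ)) / κ) := by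
    rw [← sub_sub, ← Complex.Gamma_add_one _ (div_ne_zero hx' hκ)]
    congr 1
    field_simp
    ring
  rw [phi, phi, h1, h2]
  field_simp

theorem phi_ne_zero (hκ : κ ≠ 0) {h x : ℂ} (hx : OffLattice κ x) (hx' : OffLattice κ (h - x)) :
    phi κ h x ≠ 0 :=
  mul_ne_zero (Complex.Gamma_ne_zero fun m => by simpa using hx.div_ne hκ (-m))
    (Complex.Gamma_ne_zero fun m => by simpa using hx'.div_ne hκ (-m))

theorem differentiableAt_phi {E : Type*} [NormedAddCommGroup E] [NormedSpace ℂ E] (hκ : κ ≠ 0)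
    {h x : E → ℂ} {p : E} (hh : DifferentiableAt ℂ h p) (hx : DifferentiableAt ℂ x p)
    (h1 : ∀ m : ℕ, x p ≠ -m * κ) (h2 : ∀ m : ℕ, h p - x p ≠ -m * κ) :
    DifferentiableAt ℂ (fun q => phi κ (h q) (x q)) p := by
  have e3 : DifferentiableAt ℂ (fun q => x q / κ) p := by
    simpa only [div_eq_mul_inv] using hx.mul_const κ⁻¹
  have e4 : DifferentiableAt ℂ (fun q => (h q - x q) / κ) p := by
    simpa only [div_eq_mul_inv] using (hh.fun_sub hx).mul_const κ⁻¹
  have e1 : DifferentiableAt ℂ (fun q => Complex.Gamma (x q / κ)) p :=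
    (Complex.differentiableAt_Gamma _ fun m e =>
      h1 m (by rw [← e, div_mul_cancel₀ _ hκ])).fun_comp' p e3
  have e2 : DifferentiableAt ℂ (fun q => Complex.Gamma ((h q - x q) / κ)) p :=
    (Complex.differentiableAt_Gamma _ fun m e =>
      h2 m (by rw [← e, div_mul_cancel₀ _ hκ])).fun_comp' p e4
  exact e1.mul e2

/-- The residue of `φ` at `-m κ` for an integer `m` and `h ∉ κ ℤ` (see `tendsto_resPhi`): the
first Gamma factor has a simple pole if `m ≥ 0` and is regular if `m < 0`. At `h ∈ κ ℤ_{> 0}` the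
second Gamma factor acquires poles at some of the points with `m < 0`, but the expression remains
holomorphic in `h`. This is the source of the extension to the larger domain. -/
def resPhi (κ h : ℂ) (m : ℤ) : ℂ :=
  if 0 ≤ m then κ * (-1) ^ m.toNat / (m.toNat.factorial : ℂ) * Complex.Gamma (h / κ + m.toNat) else 0

theorem resPhi_natCast (h : ℂ) (n : ℕ) :
    resPhi κ h n = κ * (-1) ^ n / (n.factorial : ℂ) * Complex.Gamma (h / κ + n) := by
  simp [resPhi]

theorem resPhi_of_neg (h : ℂ) {m : ℤ} (hm : m < 0) : resPhi κ h m = 0 := if_neg (by omega)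

theorem resPhi_succ (hκ : κ ≠ 0) {h : ℂ} (hh : ∀ m : ℤ, m ≤ 0 → h ≠ m * κ) (m : ℤ) :
    resPhi κ h (m + 1) * (-(m + 1) * κ) = resPhi κ h m * (h + m * κ) := by
  rcases lt_trichotomy m (-1) with hm | rfl | hm
  · rw [resPhi_of_neg _ (by omega), resPhi_of_neg _ (by omega), zero_mul, zero_mul]
  · rw [resPhi_of_neg (m := -1) _ (by omega)]; simp
  · lift m to ℕ using by omega
    have hs : h / κ + m ≠ 0 := by
      intro e
      refine hh (-m) (by omega) ?_
      rw [← eq_neg_iff_add_eq_zero, div_eq_iff hκ] at e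
      rw [e]; push_cast; ring
    have hfac : ((m.factorial : ℕ) : ℂ) ≠ 0 := by exact_mod_cast m.factorial_ne_zero
    have hm1 : (m : ℂ) + 1 ≠ 0 := by exact_mod_cast m.succ_ne_zero
    have e1 : resPhi κ h ((m : ℤ) + 1) = κ * (-1) ^ (m + 1) / ((m + 1).factorial : ℂ) *
        ((h / κ + m) * Complex.Gamma (h / κ + m)) := by
      rw [← Complex.Gamma_add_one _ hs]
      have := resPhi_natCast (κ := κ) h (m + 1)
      push_cast at this ⊢
      rw [this, add_assoc]
    rw [e1, resPhi_natCast, Nat.factorial_succ]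
    push_cast
    field_simp
    ring

section Growth

variable {P : Type*} [TopologicalSpace P] {p : P} {w h : P → ℂ}

theorem eventually_le_norm_div_add_int (hκ : κ ≠ 0) (hw : ContinuousAt w p)
    (hw0 : OffLattice κ (w p)) :
    ∃ c : ℝ, 0 < c ∧ ∀ᶠ q in 𝓝 p, ∀ m : ℤ, c * (1 + ‖m‖) ≤ ‖w q / κ + m‖ := by
  obtain ⟨c, hc, hev⟩ := eventually_le_norm_add_int (hw0.div_ne hκ)
  exact ⟨c, hc, (hw.div_const κ).eventually hev⟩

/-- The estimates on the coefficients of the recursion `phi_rec` for `φ(w + m κ)` which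
`norm_le_of_recursion_int` needs, locally uniformly in the parameters. -/
theorem exists_phi_bounds (hκ : κ ≠ 0) (hw : ContinuousAt w p) (hh : ContinuousAt h p)
    (hw0 : OffLattice κ (w p)) (hhw : OffLattice κ (h p - w p)) :
    ∃ (c B : ℝ), 0 < c ∧ 0 ≤ B ∧ ∀ᶠ q in 𝓝 p, ∀ m : ℤ,
      c * (1 + ‖m‖) ≤ ‖w q / κ + m‖ ∧ c * (1 + ‖m + 1‖) ≤ ‖(h q - w q) / κ - (m + 1)‖ ∧
      ‖w q / κ + m‖ ≤ ‖(h q - w q) / κ - (m + 1)‖ + B ∧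
      ‖(h q - w q) / κ - (m + 1)‖ ≤ ‖w q / κ + m‖ + B := by
  obtain ⟨c₁, hc₁, h1⟩ := eventually_le_norm_div_add_int hκ hw hw0
  obtain ⟨c₂, hc₂, h2⟩ := eventually_le_norm_div_add_int hκ (hh.sub hw) hhw
  have h3 : ContinuousAt (fun q => ‖h q / κ - 1‖) p := ((hh.div_const κ).sub continuousAt_const).norm
  refine ⟨min c₁ c₂, ‖h p / κ - 1‖ + 1, lt_min hc₁ hc₂, by positivity, ?_⟩
  filter_upwards [h1, h2, h3.eventually (gt_mem_nhds (lt_add_one _))] with q hq1 hq2 hq3 m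
  have e : w q / κ + m = -((h q - w q) / κ - (m + 1)) + (h q / κ - 1) := by ring
  refine ⟨le_trans (by gcongr; exact min_le_left _ _) (hq1 m), ?_, ?_, ?_⟩
  · have := hq2 (-(m + 1))
    rw [norm_neg] at this
    push_cast at this
    rw [← sub_eq_add_neg] at this
    exact le_trans (by gcongr; exact min_le_right _ _) this
  · rw [e]
    refine (norm_add_le _ _).trans ?_
    rw [norm_neg]
    gcongr
  · have e' : (h q - w q) / κ - (m + 1) = -(w q / κ + m) + (h q / κ - 1) := by rw [e]; ring
    rw [e']
    refine (norm_add_le _ _).trans ?_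
    rw [norm_neg]
    gcongr

theorem phi_rec (hκ : κ ≠ 0) {h w : ℂ} {m : ℤ} (h1 : w / κ + m ≠ 0)
    (h2 : (h - w) / κ - (m + 1) ≠ 0) :
    phi κ h (w + (m + 1 : ℤ) * κ) * ((h - w) / κ - (m + 1)) =
      phi κ h (w + m * κ) * (w / κ + m) := by
  have e1 : w + m * κ = κ * (w / κ + m) := by field_simp
  have e2 : h - (w + m * κ) - κ = κ * ((h - w) / κ - (m + 1)) := by field_simp; ring
  have := phi_add hκ (h := h) (x := w + m * κ) (by rw [e1]; exact mul_ne_zero hκ h1)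
    (by rw [e2]; exact mul_ne_zero hκ h2)
  rw [e2, mul_left_comm, show w + m * κ + κ = w + (m + 1 : ℤ) * κ by push_cast; ring] at this
  refine mul_left_cancel₀ hκ ?_
  rw [this]
  nth_rw 1 [e1]
  ring

theorem exists_norm_phi_le (hκ : κ ≠ 0) (hw : ContinuousAt w p) (hh : ContinuousAt h p)
    (hcont : ContinuousAt (fun q => phi κ (h q) (w q)) p)
    (hw0 : OffLattice κ (w p)) (hhw : OffLattice κ (h p - w p)) :
    ∃ (K : ℝ) (d : ℕ), ∀ᶠ q in 𝓝 p, ∀ m : ℤ,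
      ‖phi κ (h q) (w q + m * κ)‖ ≤ K * (1 + ‖m‖) ^ d := by
  obtain ⟨c, B, hc, -, hev⟩ := exists_phi_bounds hκ hw hh hw0 hhw
  obtain ⟨A, hA⟩ := exists_nat_ge (B / c)
  refine ⟨‖phi κ (h p) (w p)‖ + 1, A, ?_⟩
  filter_upwards [hev, hcont.norm.eventually (gt_mem_nhds (lt_add_one _))] with q hq hq0 m
  have := norm_le_of_recursion_int (b := fun m => phi κ (h q) (w q + m * κ)) hc
    ((div_le_iff₀ hc).1 hA)
    (fun m => phi_rec hκ (norm_pos_iff.1 (lt_of_lt_of_le (by positivity) (hq m).1))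
      (norm_pos_iff.1 (lt_of_lt_of_le (by positivity) (hq m).2.1)))
    (fun m => (hq m).2.2.1) (fun m => (hq m).2.2.2)
    (fun j => ((hq j).2.1).trans' (by gcongr; rw [Int.norm_eq_abs]; push_cast; exact (le_abs_self _).trans' (by linarith)))
    (fun j => by
      have := (hq (-(j + 1))).1
      push_cast at this ⊢
      exact this.trans' (by gcongr; rw [Int.norm_eq_abs]; push_cast; rw [abs_neg]; exact (le_abs_self _).trans' (by linarith))) m
  refine this.trans ?_
  gcongr
  simpa using hq0.le

theorem exists_norm_inv_phi_le (hκ : κ ≠ 0) (hw : ContinuousAt w p) (hh : ContinuousAt h p)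
    (hcont : ContinuousAt (fun q => phi κ (h q) (w q)) p)
    (hw0 : OffLattice κ (w p)) (hhw : OffLattice κ (h p - w p)) :
    ∃ (K : ℝ) (d : ℕ), ∀ᶠ q in 𝓝 p, ∀ m : ℤ,
      ‖1 / ((w q + m * κ - h q) * phi κ (h q) (w q + m * κ))‖ ≤ K * (1 + ‖m‖) ^ d := by
  obtain ⟨c, B, hc, -, hev⟩ := exists_phi_bounds hκ hw hh hw0 hhw
  obtain ⟨A, hA⟩ := exists_nat_ge (B / c)
  have hcont' := hcont.inv₀ (phi_ne_zero hκ hw0 hhw)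
  have hcκ : 0 < c * ‖κ‖ := mul_pos hc (norm_pos_iff.2 hκ)
  refine ⟨(c * ‖κ‖)⁻¹ * (‖(phi κ (h p) (w p))⁻¹‖ + 1), A + 1, ?_⟩
  filter_upwards [hev, hcont'.norm.eventually (gt_mem_nhds (lt_add_one _))] with q hq hq0 m
  have hα : ∀ m : ℤ, (h q - w q) / κ - (m + 1) ≠ 0 := fun m =>
    norm_pos_iff.1 (lt_of_lt_of_le (by positivity) (hq m).2.1)
  have hβ : ∀ m : ℤ, w q / κ + m ≠ 0 := fun m =>
    norm_pos_iff.1 (lt_of_lt_of_le (by positivity) (hq m).1)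
  have h1 := norm_le_of_recursion_int (b := fun m => (phi κ (h q) (w q + m * κ))⁻¹)
    (α := fun m => w q / κ + m) (β := fun m => (h q - w q) / κ - (m + 1)) hc
    ((div_le_iff₀ hc).1 hA)
    (fun m => by
      have h2 := phi_rec hκ (hβ m) (hα m)
      -- with `0⁻¹ = 0`, the inverted recursion also holds where `φ` vanishes
      rcases eq_or_ne (phi κ (h q) (w q + m * κ)) 0 with h0 | h0
      · rw [h0, zero_mul] at h2
        have h3 := (mul_eq_zero.1 h2).resolve_right (hα m)
        rw [h0, h3, inv_zero, zero_mul, zero_mul]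
      · have h3 : phi κ (h q) (w q + (m + 1 : ℤ) * κ) ≠ 0 := by
          intro h3
          rw [h3, zero_mul] at h2
          exact (mul_ne_zero h0 (hβ m)) h2.symm
        rw [inv_mul_eq_iff_eq_mul₀ h3, mul_left_comm, h2, inv_mul_cancel_left₀ h0])
    (fun m => (hq m).2.2.2) (fun m => (hq m).2.2.1)
    (fun j => (hq j).1.trans' (by simp))
    (fun j => by
      have := (hq (-(j + 1))).2.1
      rw [show -((j : ℤ) + 1) + 1 = -j by ring] at this
      push_cast at this ⊢
      exact this.trans' (by simp)) m
  have h2 : c * ‖κ‖ ≤ ‖w q + m * κ - h q‖ := by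
    have h3 := (hq (m - 1)).2.1
    have e : w q + m * κ - h q = -(κ * ((h q - w q) / κ - ((m - 1 : ℤ) + 1))) := by
      push_cast; field_simp; ring
    rw [e, norm_neg, norm_mul, mul_comm]
    refine mul_le_mul_of_nonneg_left (h3.trans' ?_) (norm_nonneg _)
    exact le_mul_of_one_le_right hc.le (by linarith [norm_nonneg (m - 1 + 1)])
  rw [one_div, mul_inv, norm_mul, norm_inv]
  have h3 : (1 : ℝ) ≤ 1 + ‖m‖ := by linarith [norm_nonneg m]
  simp only [Int.cast_zero, zero_mul, add_zero] at h1
  rw [mul_assoc]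
  refine mul_le_mul (inv_anti₀ hcκ h2) (h1.trans ?_) (norm_nonneg _) (by positivity)
  exact mul_le_mul hq0.le (pow_le_pow_right₀ h3 A.le_succ) (by positivity) (by positivity)

theorem exists_norm_resPhi_le (hκ : κ ≠ 0) (hh : ContinuousAt h p)
    (hh0 : ∀ᶠ q in 𝓝 p, ∀ m : ℤ, m ≤ 0 → h q ≠ m * κ)
    (hcont : ContinuousAt (fun q => resPhi κ (h q) 0) p) :
    ∃ (K : ℝ) (d : ℕ), ∀ᶠ q in 𝓝 p, ∀ m : ℤ, ‖resPhi κ (h q) m‖ ≤ K * (1 + ‖m‖) ^ d := by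
  have h3 : ContinuousAt (fun q => ‖h q / κ - 1‖) p := ((hh.div_const κ).sub continuousAt_const).norm
  obtain ⟨A, hA⟩ := exists_nat_ge (‖h p / κ - 1‖ + 1)
  refine ⟨‖resPhi κ (h p) 0‖ + 1, A, ?_⟩
  filter_upwards [hh0, hcont.norm.eventually (gt_mem_nhds (lt_add_one _)),
    h3.eventually (gt_mem_nhds (lt_add_one _))] with q hq hq0 hq3 m
  rcases lt_or_ge m 0 with hm | hm
  · rw [resPhi_of_neg _ hm, norm_zero]; positivity
  · lift m to ℕ using hm
    have hα : ∀ j : ℕ, ‖(-((j : ℂ) + 1))‖ = j + 1 := fun j => by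
      rw [norm_neg]; exact_mod_cast Complex.norm_natCast (j + 1)
    have := norm_le_of_recursion (b := fun j : ℕ => resPhi κ (h q) j) (c := 1) (A := A)
      (B := ‖h p / κ - 1‖ + 1)
      (α := fun j => -((j : ℂ) + 1)) (β := fun j => h q / κ + j) one_pos (by simpa using hA)
      (fun j => by
        have := resPhi_succ hκ hq j
        refine mul_right_cancel₀ hκ ?_
        push_cast at this ⊢
        rw [mul_assoc, this]
        field_simp)
      (fun j => by
        have e : h q / κ + j = -(-((j : ℂ) + 1)) + (h q / κ - 1) := by ring
        rw [e]
        refine (norm_add_le _ _).trans ?_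
        rw [norm_neg]
        gcongr)
      (fun j => by rw [hα]; linarith) m
    refine this.trans ?_
    have hn : ‖(m : ℤ)‖ = m := by simp
    rw [hn]
    gcongr
    simpa using hq0.le

end Growth

end

/-! ### The coefficients of the master function at the lattice points -/

section

variable {M : ℕ} {lam : Fin (M + 1) → ℕ} {κ : ℂ}

/-- The labels of all variables `t^{(k)}_a`, `k = 1, …, N`, including the `t^{(N)}_a = z_a`. -/
abbrev Vars (lam : Fin (M + 1) → ℕ) : Type := (k : Fin (M + 1)) × Fin (psum lam k)

/-- The lattice vector `r` extended by zero to the variables `z_a`. -/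
def shift (r : TVar lam → ℤ) (k : Fin (M + 1)) : Fin (psum lam k) → ℤ :=
  Fin.lastCases (motive := fun k => Fin (psum lam k) → ℤ) (fun _ => 0) (fun i a => r ⟨i, a⟩) k

@[simp] theorem shift_last (r : TVar lam → ℤ) (a : Fin (psum lam (Fin.last M))) :
    shift r (Fin.last M) a = 0 := by simp [shift]

@[simp] theorem shift_castSucc (r : TVar lam → ℤ) (i : Fin M) (a : Fin (psum lam i.castSucc)) :
    shift r i.castSucc a = r ⟨i, a⟩ := by simp [shift]

@[simp] theorem tz_last (T : TVar lam → ℂ) (z : Fin (size lam) → ℂ)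
    (a : Fin (psum lam (Fin.last M))) : tz T z (Fin.last M) a = z (Fin.cast (psum_last lam) a) := by
  simp [tz]

@[simp] theorem tz_castSucc (T : TVar lam → ℂ) (z : Fin (size lam) → ℂ) (i : Fin M)
    (a : Fin (psum lam i.castSucc)) : tz T z i.castSucc a = T ⟨i, a⟩ := by simp [tz]

theorem pos_last (J : Parts lam) (a : Fin (psum lam (Fin.last M))) :
    pos J (Fin.last M) a = Fin.cast (psum_last lam) a := by
  have := Finset.orderEmbOfFin_unique (card_blockUnion J (Fin.last M))
    (f := Fin.cast (psum_last lam)) (fun x => by simp [blockUnion, Fin.le_last])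
    (fun x y h => by simpa using h)
  exact (congrFun this a).symm

/-- The index `a` of the `z_a` to which a variable is equal at the point `Σ_J`. -/
def label (J : Parts lam) (v : Vars lam) : Fin (size lam) := pos J v.1 v.2

/-- The point `Σ_J + r κ`. -/
def latticePoint (κ : ℂ) (J : Parts lam) (z : Fin (size lam) → ℂ) (r : TVar lam → ℤ) :
    TVar lam → ℂ := fun x => cycle J z x + r x * κ

/-- The coloured variables with their values at the points `Σ_J + r κ`, as functions of `r`. -/
def latticeVars (κ : ℂ) (J : Parts lam) (z : Fin (size lam) → ℂ) (h : ℂ) :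
    ColoredVars (TVar lam → ℤ) (Vars lam) where
  col v := v.1
  top := M
  val r v := z (label J v) + shift r v.1 v.2 * κ
  h := h

theorem tz_latticePoint (J : Parts lam) (z : Fin (size lam) → ℂ) (h : ℂ) (r : TVar lam → ℤ)
    (k : Fin (M + 1)) (a : Fin (psum lam k)) :
    tz (latticePoint κ J z r) z k a = (latticeVars κ J z h).val r ⟨k, a⟩ := by
  induction k using Fin.lastCases with
  | last => simp [latticeVars, label, pos_last]
  | cast i => simp [latticeVars, label, latticePoint, cycle]

theorem label_injective_of_col (J : Parts lam) {u w : Vars lam} (h : (u.1 : ℕ) = w.1)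
    (hne : u ≠ w) : label J u ≠ label J w := by
  obtain ⟨k, a⟩ := u
  obtain ⟨k', b⟩ := w
  obtain rfl : k = k' := Fin.ext h
  intro e
  exact hne (congrArg (Sigma.mk k) ((pos J k).injective e))

/-- The conditions on `z` and `h` in the definition of `bigDomain`. -/
structure Generic (κ : ℂ) {n : ℕ} (z : Fin n → ℂ) (h : ℂ) : Prop where
  h_ne : ∀ m : ℤ, m ≤ 0 → h ≠ m * κ
  diff : ∀ a b, a ≠ b → OffLattice κ (z a - z b)
  diff_add : ∀ a b, a ≠ b → OffLattice κ (z a - z b + h)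

theorem Generic.sub_diff {n : ℕ} {z : Fin n → ℂ} {h : ℂ} (hg : Generic κ z h) {a b : Fin n}
    (hab : a ≠ b) : OffLattice κ (h - (z a - z b)) := by
  have := hg.diff_add b a hab.symm
  rwa [show h - (z a - z b) = z b - z a + h by ring]

theorem Generic.h_ne_zero {n : ℕ} {z : Fin n → ℂ} {h : ℂ} (hg : Generic κ z h) : h ≠ 0 := by
  simpa using hg.h_ne 0 le_rfl

open Classical in
/-- The value of `φ` at `w + m κ`, or, if `b` holds, the residue coefficient at `m κ`. It is used
with `b` equivalent to `w = 0`, and then satisfies the functional equation of `φ` in either case,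
see `hop_add`. -/
def hop (κ h : ℂ) (b : Prop) (w : ℂ) (m : ℤ) : ℂ := if b then resPhi κ h (-m) else phi κ h (w + m * κ)

theorem hop_add (hκ : κ ≠ 0) {h : ℂ} (hh : ∀ m : ℤ, m ≤ 0 → h ≠ m * κ) {b : Prop} {w : ℂ}
    (h1 : b → w = 0) (h2 : ¬ b → OffLattice κ w ∧ OffLattice κ (h - w)) (m : ℤ) :
    hop κ h b w (m + 1) * (h - (w + m * κ) - κ) = (w + m * κ) * hop κ h b w m := by
  unfold hop
  split_ifs with hb
  · rw [h1 hb]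
    have := resPhi_succ hκ hh (-(m + 1))
    rw [show -(m + 1) + 1 = -m by ring] at this
    push_cast at this
    linear_combination -this
  · have hx := (h2 hb).1.add_int m
    have hx' := (h2 hb).2.add_int (-(m + 1))
    push_cast at hx'
    have := phi_add hκ (h := h) hx.ne_zero
      (by convert hx'.ne_zero using 1; ring)
    rw [← this]
    congr 2
    push_cast; ring

/-- The factor of the master function for the pair of variables `u`, `w`, at the point
`Σ_J + r κ`. For variables of neighbouring colours with the same label, `φ` has a pole there and is
replaced by its residue, see `hop`. -/
def pairCoef (κ : ℂ) (J : Parts lam) (z : Fin (size lam) → ℂ) (h : ℂ) (r : TVar lam → ℤ)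
    (u w : Vars lam) : ℂ :=
  if (u.1 : ℕ) = w.1 then
    if u ≠ w ∧ (u.1 : ℕ) < M then
      1 / ((z (label J u) - z (label J w) + (shift r u.1 u.2 - shift r w.1 w.2 : ℤ) * κ - h) *
        phi κ h (z (label J u) - z (label J w) + (shift r u.1 u.2 - shift r w.1 w.2 : ℤ) * κ))
    else 1
  else if (w.1 : ℕ) = u.1 + 1 then
    hop κ h (label J u = label J w) (z (label J u) - z (label J w))
      (shift r u.1 u.2 - shift r w.1 w.2)
  else 1

/-- The exponential factors of the master function. -/
def expPart (lam : Fin (M + 1) → ℕ) (κ : ℂ) (T : TVar lam → ℂ) (z : Fin (size lam) → ℂ)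
    (l : Fin (M + 1) → ℂ) : ℂ :=
  Complex.exp ((Real.pi * Complex.I * ((size lam : ℂ) - lam (Fin.last M)) + l (Fin.last M)) *
      ((∑ a, z a) / κ)) *
    ∏ i : Fin M, Complex.exp
      ((Real.pi * Complex.I * ((lam i.succ : ℂ) - lam i.castSucc) + (l i.castSucc - l i.succ)) *
        ((∑ j, tz T z i.castSucc j) / κ))

/-- The iterated residue of the master function at `Σ_J + r κ`, for `h ∉ κ ℤ`; as a formula it is
meaningful also for `h ∈ κ ℤ_{> 0}`. -/
def masterCoef (κ : ℂ) (J : Parts lam) (z : Fin (size lam) → ℂ) (h : ℂ) (l : Fin (M + 1) → ℂ)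
    (r : TVar lam → ℤ) : ℂ :=
  expPart lam κ (latticePoint κ J z r) z l * ∏ u : Vars lam, ∏ w : Vars lam, pairCoef κ J z h r u w

theorem shift_add_single (r : TVar lam → ℤ) (x : TVar lam) (w : Vars lam) :
    shift (r + Pi.single x 1) w.1 w.2 =
      shift r w.1 w.2 + if w = ⟨x.1.castSucc, x.2⟩ then 1 else 0 := by
  obtain ⟨k, c⟩ := w
  obtain ⟨i, a⟩ := x
  induction k using Fin.lastCases with
  | last =>
    rw [if_neg]
    · simp
    · intro e
      exact (Fin.castSucc_lt_last i).ne' (congrArg Sigma.fst e)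
  | cast j =>
    have hiff : ((⟨j.castSucc, c⟩ : Vars lam) = ⟨i.castSucc, a⟩) ↔ ((⟨j, c⟩ : TVar lam) = ⟨i, a⟩) := by
      constructor
      · intro e
        obtain rfl : j = i := Fin.castSucc_injective _ (congrArg Sigma.fst e)
        simpa using e
      · intro e
        obtain rfl : j = i := congrArg Sigma.fst e
        simpa using e
    simp only [shift_castSucc, Pi.add_apply, Pi.single_apply, hiff]

section Step

variable (hκ : κ ≠ 0) {J : Parts lam} {z : Fin (size lam) → ℂ} {h : ℂ} (hg : Generic κ z h)
include hκ hg

/-- The effect on the factors of one pair of raising the coordinate `r x` by one: up to the kernel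
factors and a sign they do not change, by the functional equation of `φ`. -/
theorem pairCoef_shift (r : TVar lam → ℤ) (x : TVar lam) {u v : Vars lam}
    (hv : v = ⟨x.1.castSucc, x.2⟩) (huv : u ≠ v) :
    pairCoef κ J z h (r + Pi.single x 1) v u * pairCoef κ J z h (r + Pi.single x 1) u v *
        (latticeVars κ J z h).kernel (r + Pi.single x 1) v u =
      (if (u.1 : ℕ) = v.1 + 1 ∨ (v.1 : ℕ) = u.1 + 1 then -1 else 1) *
      (pairCoef κ J z h r v u * pairCoef κ J z h r u v * (latticeVars κ J z h).kernel r u v) := by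
  have hvM : (v.1 : ℕ) < M := by rw [hv]; exact x.1.isLt
  have hsv : shift (r + Pi.single x 1) v.1 v.2 = shift r v.1 v.2 + 1 := by
    rw [shift_add_single, if_pos hv]
  have hsu : shift (r + Pi.single x 1) u.1 u.2 = shift r u.1 u.2 := by
    rw [shift_add_single, if_neg (by rwa [← hv]), add_zero]
  have hvalv : (latticeVars κ J z h).val (r + Pi.single x 1) v =
      (latticeVars κ J z h).val r v + κ := by
    simp only [latticeVars, hsv]; push_cast; ring
  have hvalu : (latticeVars κ J z h).val (r + Pi.single x 1) u =
      (latticeVars κ J z h).val r u := by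
    simp only [latticeVars, hsu]
  have hcol : ∀ y, (latticeVars κ J z h).col y = y.1 := fun _ => rfl
  have htop : (latticeVars κ J z h).top = M := rfl
  have hh : (latticeVars κ J z h).h = h := rfl
  have hval : ∀ y, (latticeVars κ J z h).val r y = z (label J y) + shift r y.1 y.2 * κ :=
    fun _ => rfl
  have hop' : ∀ a b : Fin (size lam), ∀ m : ℤ,
      hop κ h (a = b) (z a - z b) (m + 1) * (h - (z a - z b + m * κ) - κ) =
        (z a - z b + m * κ) * hop κ h (a = b) (z a - z b) m := fun a b m =>
    hop_add hκ hg.h_ne (fun e => by rw [e, sub_self])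
      (fun e => ⟨hg.diff a b e, hg.sub_diff e⟩) m
  rcases eq_or_ne (u.1 : ℕ) v.1 with h0 | h0
  · have hl : label J v ≠ label J u := label_injective_of_col J h0.symm huv.symm
    rw [if_neg (by omega), one_mul,
      ColoredVars.kernel_same _ (by rw [hcol, hcol, h0]) (by rw [hcol, htop]; exact hvM),
      ColoredVars.kernel_same _ (by rw [hcol, hcol, h0]) (by rw [hcol, htop, h0]; exact hvM)]
    simp only [pairCoef, if_pos h0, if_pos h0.symm, hvalu, hvalv, hval, hsv, hsu, hh,
      if_pos (And.intro huv (h0.trans_lt hvM)), if_pos (And.intro huv.symm hvM)]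
    set w := z (label J v) - z (label J u) with hw
    have hw' : z (label J u) - z (label J v) = -w := by rw [hw]; ring
    set m := shift r v.1 v.2 - shift r u.1 u.2 with hm
    have hm1 : shift r v.1 v.2 + 1 - shift r u.1 u.2 = m + 1 := by rw [hm]; ring
    have hm2 : shift r u.1 u.2 - (shift r v.1 v.2 + 1) = -(m + 1) := by rw [hm]; ring
    have hm3 : shift r u.1 u.2 - shift r v.1 v.2 = -m := by rw [hm]; ring
    rw [hm1, hm2, hm3, hw']
    set y := w + m * κ with hy
    have g1 : OffLattice κ y := (hg.diff _ _ hl).add_int m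
    have g2 : OffLattice κ (h - y) := by
      have := (hg.sub_diff hl).add_int (-m)
      convert this using 1
      rw [hy, hw]; push_cast; ring
    have g3 : OffLattice κ (h + y) := by
      have := (hg.diff_add _ _ hl).add_int m
      convert this using 1
      rw [hy, hw]; ring
    have e1 : w + ((m + 1 : ℤ) : ℂ) * κ = y + κ := by rw [hy]; push_cast; ring
    have e2 : -w + ((-(m + 1) : ℤ) : ℂ) * κ = -y - κ := by rw [hy]; push_cast; ring
    have e3 : -w + ((-m : ℤ) : ℂ) * κ = -y := by rw [hy]; push_cast; ring
    have e4 : z (label J u) + (shift r u.1 u.2 : ℂ) * κ -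
        (z (label J v) + (shift r v.1 v.2 : ℂ) * κ + κ) = -y - κ := by
      rw [hy, hw, hm]; push_cast; ring
    have e5 : z (label J v) + (shift r v.1 v.2 : ℂ) * κ -
        (z (label J u) + (shift r u.1 u.2 : ℂ) * κ) = y := by
      rw [hy, hw, hm]; push_cast; ring
    rw [e1, e2, e3, e4, e5]
    have n1 : y ≠ 0 := g1.ne_zero
    have n2 : h - y - κ ≠ 0 := by
      have := (g2.add_int (-1)).ne_zero
      convert this using 1; push_cast; ring
    have n3 : -y - κ ≠ 0 := by
      have := (g1.add_int 1).neg.ne_zero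
      convert this using 1; push_cast; ring
    have n4 : h + y ≠ 0 := g3.ne_zero
    have n4' : h + y + κ ≠ 0 := by
      have := (g3.add_int 1).ne_zero
      convert this using 1; push_cast; ring
    have n5 : h - y ≠ 0 := g2.ne_zero
    have p1 : phi κ h y ≠ 0 := phi_ne_zero hκ g1 g2
    have p2 : phi κ h (-y) ≠ 0 := phi_ne_zero hκ g1.neg (by rwa [sub_neg_eq_add])
    have q1 := phi_add hκ n1 n2
    have q2 := phi_add hκ n3 (h := h) (by rw [show h - (-y - κ) - κ = h + y by ring]; exact n4)
    rw [sub_add_cancel, show h - (-y - κ) - κ = h + y by ring] at q2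
    have p3 : phi κ h (y + κ) = y * phi κ h y / (h - y - κ) := by
      rw [eq_div_iff n2, q1]
    have p4 : phi κ h (-y - κ) = phi κ h (-y) * (h + y) / (-y - κ) := by
      rw [eq_div_iff n3, q2, mul_comm]
    rw [p3, p4]
    have n6 : y + κ - h ≠ 0 := by
      rw [show y + κ - h = -(h - y - κ) by ring]; exact neg_ne_zero.2 n2
    have n7 : -y - κ - h ≠ 0 := by
      rw [show -y - κ - h = -(h + y + κ) by ring]; exact neg_ne_zero.2 n4'
    have n8 : y - h ≠ 0 := by
      rw [show y - h = -(h - y) by ring]; exact neg_ne_zero.2 n5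
    have n9 : -y - h ≠ 0 := by
      rw [show -y - h = -(h + y) by ring]; exact neg_ne_zero.2 n4
    rw [show y + κ - h = -(h - y - κ) by ring, show -y - h = -(h + y) by ring]
    field_simp
  · rcases eq_or_ne (u.1 : ℕ) (v.1 + 1) with h1 | h1
    · rw [if_pos (Or.inl h1), ColoredVars.kernel_up _ (by rw [hcol, hcol, h1]),
        ColoredVars.kernel_down _ (by rw [hcol, hcol, h1])]
      simp only [pairCoef, if_neg h0, if_neg h0.symm, if_pos h1, hvalu, hvalv, hval, hsv, hsu, hh,
        if_neg (show ¬ (v.1 : ℕ) = u.1 + 1 by omega)]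
      have := hop' (label J v) (label J u) (shift r v.1 v.2 - shift r u.1 u.2)
      rw [show shift r v.1 v.2 + 1 - shift r u.1 u.2 = shift r v.1 v.2 - shift r u.1 u.2 + 1 by ring]
      push_cast at this ⊢
      linear_combination -this
    · rcases eq_or_ne (v.1 : ℕ) (u.1 + 1) with h2 | h2
      · rw [if_pos (Or.inr h2), ColoredVars.kernel_down _ (by rw [hcol, hcol, h2]),
          ColoredVars.kernel_up _ (by rw [hcol, hcol, h2])]
        simp only [pairCoef, if_neg h0, if_neg h0.symm, if_pos h2, hvalu, hvalv, hval, hsv, hsu, hh,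
          if_neg h1]
        have := hop' (label J u) (label J v) (shift r u.1 u.2 - (shift r v.1 v.2 + 1))
        rw [show shift r u.1 u.2 - (shift r v.1 v.2 + 1) + 1 = shift r u.1 u.2 - shift r v.1 v.2 by
          ring] at this
        push_cast at this ⊢
        linear_combination -this
      · rw [if_neg (by omega),
          ColoredVars.kernel_far _ (by rwa [hcol, hcol]) (by rwa [hcol, hcol])
            (fun e => absurd e.symm (by rwa [hcol, hcol])),
          ColoredVars.kernel_far _ (by rwa [hcol, hcol]) (by rwa [hcol, hcol])
            (fun e => absurd e (by rwa [hcol, hcol]))]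
        simp only [pairCoef, if_neg h0, if_neg h0.symm, if_neg h1, if_neg h2, mul_one]

end Step

end

/-! ### Shifting one coordinate of the lattice point -/

section

variable {M : ℕ} {lam : Fin (M + 1) → ℕ} {κ : ℂ}

theorem prod_prod_eq_erase {V : Type*} [Fintype V] [DecidableEq V] (f : V → V → ℂ) (v : V) :
    ∏ u, ∏ w, f u w = f v v * (∏ u ∈ Finset.univ.erase v, f v u * f u v) *
      ∏ u ∈ Finset.univ.erase v, ∏ w ∈ Finset.univ.erase v, f u w := by
  have h1 : ∀ u, ∏ w, f u w = f u v * ∏ w ∈ Finset.univ.erase v, f u w := fun u =>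
    (Finset.mul_prod_erase _ _ (Finset.mem_univ v)).symm
  rw [← Finset.mul_prod_erase _ _ (Finset.mem_univ v), h1]
  simp only [h1, Finset.prod_mul_distrib]
  ring

theorem psum_succ (i : Fin M) : psum lam i.succ = psum lam i.castSucc + lam i.succ := by
  have : Finset.Iic i.succ = insert i.succ (Finset.Iic i.castSucc) := by
    ext j; simp only [Finset.mem_Iic, Finset.mem_insert, Fin.le_def, Fin.ext_iff]
    simp only [Fin.val_succ, Fin.val_castSucc]; omega
  rw [psum, this, Finset.sum_insert, psum, add_comm]
  simp

theorem psum_eq_add_sum (k : Fin (M + 1)) :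
    psum lam k = (∑ j ∈ Finset.univ.filter (fun j : Fin (M + 1) => (j : ℕ) + 1 = k), psum lam j) + lam k := by
  induction k using Fin.cases with
  | zero =>
    have h1 : (Finset.univ.filter fun j : Fin (M + 1) => (j : ℕ) + 1 = (0 : Fin (M + 1))) = ∅ := by
      ext j; simp
    have h2 : Finset.Iic (0 : Fin (M + 1)) = {0} := by ext j; simp
    rw [h1, Finset.sum_empty, psum, h2, Finset.sum_singleton, zero_add]
  | succ i =>
    have h1 : (Finset.univ.filter fun j : Fin (M + 1) => (j : ℕ) + 1 = i.succ) = {i.castSucc} := by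
      ext j; simp [Fin.ext_iff]
    rw [h1, Finset.sum_singleton, psum_succ]

/-- The signs of `pairCoef_shift` over all pairs with a given variable: there are
`psum lam (i - 1) + psum lam (i + 1) = 2 * psum lam (i - 1) + lam i + lam (i + 1)` of them. -/
theorem prod_sign (i : Fin M) (a : Fin (psum lam i.castSucc)) :
    ∏ u ∈ Finset.univ.erase (⟨i.castSucc, a⟩ : Vars lam),
      (if (u.1 : ℕ) = (i.castSucc : Fin (M + 1)) + 1 ∨ ((i.castSucc : Fin (M + 1)) : ℕ) = u.1 + 1
        then (-1 : ℂ) else 1) = (-1) ^ (lam i.succ + lam i.castSucc) := by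
  have h0 := Finset.prod_erase (Finset.univ : Finset (Vars lam)) (a := ⟨i.castSucc, a⟩)
    (f := fun u => if (u.1 : ℕ) = (i.castSucc : Fin (M + 1)) + 1 ∨
      ((i.castSucc : Fin (M + 1)) : ℕ) = u.1 + 1 then (-1 : ℂ) else 1) (if_neg (by simp))
  rw [h0, Fintype.prod_sigma]
  have h1 : ∀ k : Fin (M + 1), ∏ _a : Fin (psum lam k),
      (if (k : ℕ) = (i.castSucc : Fin (M + 1)) + 1 ∨ ((i.castSucc : Fin (M + 1)) : ℕ) = k + 1
        then (-1 : ℂ) else 1) =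
      (if k = i.succ then (-1) ^ psum lam k else 1) *
        (if (k : ℕ) + 1 = (i.castSucc : Fin (M + 1)) then (-1) ^ psum lam k else 1) := by
    intro k
    rw [Finset.prod_const, Finset.card_univ, Fintype.card_fin]
    have e : k = i.succ ↔ (k : ℕ) = (i.castSucc : Fin (M + 1)) + 1 := by
      rw [Fin.ext_iff]; simp
    by_cases c1 : k = i.succ
    · rw [if_pos (Or.inl (e.1 c1)), if_pos c1, if_neg (by rw [e] at c1; omega), mul_one]
    · by_cases c2 : (k : ℕ) + 1 = (i.castSucc : Fin (M + 1))
      · rw [if_pos (Or.inr c2.symm), if_neg c1, if_pos c2, one_mul]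
      · rw [if_neg (by rw [e] at c1; omega), if_neg c1, if_neg c2, one_pow, one_mul]
  simp only [h1]
  rw [Finset.prod_mul_distrib, Finset.prod_ite_eq' _ i.succ, if_pos (Finset.mem_univ _),
    ← Finset.prod_filter, Finset.prod_pow_eq_pow_sum, psum_succ, psum_eq_add_sum i.castSucc,
    ← pow_add]
  set s := ∑ j ∈ Finset.univ.filter (fun j : Fin (M + 1) => (j : ℕ) + 1 = (i.castSucc : Fin (M + 1))),
    psum lam j
  rw [show s + lam i.castSucc + lam i.succ + s = (lam i.succ + lam i.castSucc) + 2 * s by ring,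
    pow_add, pow_mul]
  simp

theorem expPart_shift (hκ : κ ≠ 0) (J : Parts lam) (z : Fin (size lam) → ℂ) (l : Fin (M + 1) → ℂ)
    (r : TVar lam → ℤ) (x : TVar lam) :
    expPart lam κ (latticePoint κ J z (r + Pi.single x 1)) z l =
      Complex.exp (Real.pi * Complex.I * ((lam x.1.succ : ℂ) - lam x.1.castSucc) +
        (l x.1.castSucc - l x.1.succ)) * expPart lam κ (latticePoint κ J z r) z l := by
  have hpt : ∀ y, latticePoint κ J z (r + Pi.single x 1) y =
      latticePoint κ J z r y + if y = x then κ else 0 := by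
    intro y
    simp only [latticePoint, Pi.add_apply, Pi.single_apply]
    split_ifs <;> push_cast <;> ring
  unfold expPart
  rw [mul_left_comm]
  congr 1
  rw [← Finset.mul_prod_erase _ _ (Finset.mem_univ x.1),
    ← Finset.mul_prod_erase _ (fun i => Complex.exp
      ((Real.pi * Complex.I * ((lam i.succ : ℂ) - lam i.castSucc) + (l i.castSucc - l i.succ)) *
        ((∑ j, tz (latticePoint κ J z r) z i.castSucc j) / κ))) (Finset.mem_univ x.1), ← mul_assoc,
    ← Complex.exp_add]
  congr 1
  · congr 1
    have : ∑ j, tz (latticePoint κ J z (r + Pi.single x 1)) z x.1.castSucc j =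
        ∑ j, tz (latticePoint κ J z r) z x.1.castSucc j + κ := by
      simp only [tz_castSucc, hpt, Finset.sum_add_distrib]
      congr 1
      rw [Finset.sum_eq_single x.2]
      · rw [if_pos rfl]
      · intro b _ hb
        rw [if_neg]
        intro e
        apply hb
        obtain ⟨i, a⟩ := x
        simpa using e
      · simp
    rw [this, add_div, div_self hκ]
    ring
  · refine Finset.prod_congr rfl fun i hi => ?_
    have hne : i ≠ x.1 := (Finset.mem_erase.1 hi).1
    have hs : ∑ j, tz (latticePoint κ J z (r + Pi.single x 1)) z i.castSucc j =
        ∑ j, tz (latticePoint κ J z r) z i.castSucc j := by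
      refine Finset.sum_congr rfl fun j _ => ?_
      rw [tz_castSucc, tz_castSucc, hpt, if_neg, add_zero]
      rintro rfl
      exact hne rfl
    rw [hs]

theorem exp_pi_mul_sub (a b : ℕ) :
    Complex.exp (Real.pi * Complex.I * ((a : ℂ) - b)) = (-1) ^ (a + b) := by
  rw [mul_sub, Complex.exp_sub, mul_comm _ (a : ℂ), mul_comm _ (b : ℂ), Complex.exp_nat_mul,
    Complex.exp_nat_mul, Complex.exp_pi_mul_I, pow_add]
  rcases neg_one_pow_eq_or ℂ b with h | h <;> rw [h] <;> simp [div_neg]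

/-- Raising the coordinate `r x` by one turns the product of the kernels in one order into the
product in the opposite order, and multiplies by a ratio of the `q`'s. The signs in the master
function cancel those of `prod_sign`. -/
theorem masterCoef_shift (hκ : κ ≠ 0) {J : Parts lam} {z : Fin (size lam) → ℂ} {h : ℂ}
    (hg : Generic κ z h) {l q : Fin (M + 1) → ℂ} (hl : ∀ i, Complex.exp (l i) = q i)
    (r : TVar lam → ℤ) (x : TVar lam) :
    masterCoef κ J z h l (r + Pi.single x 1) *
        ∏ u ∈ Finset.univ.erase (⟨x.1.castSucc, x.2⟩ : Vars lam),
          (latticeVars κ J z h).kernel (r + Pi.single x 1) ⟨x.1.castSucc, x.2⟩ u =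
      q x.1.castSucc / q x.1.succ * (masterCoef κ J z h l r *
        ∏ u ∈ Finset.univ.erase (⟨x.1.castSucc, x.2⟩ : Vars lam),
          (latticeVars κ J z h).kernel r u ⟨x.1.castSucc, x.2⟩) := by
  have hq : ∀ i, q i ≠ 0 := fun i => by rw [← hl]; exact Complex.exp_ne_zero _
  set v : Vars lam := ⟨x.1.castSucc, x.2⟩ with hv
  unfold masterCoef
  rw [prod_prod_eq_erase _ v, prod_prod_eq_erase (pairCoef κ J z h r) v, expPart_shift hκ,
    Complex.exp_add, Complex.exp_sub, hl, hl, exp_pi_mul_sub]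
  have hvv : ∀ r, pairCoef κ J z h r v v = 1 := fun r => by simp [pairCoef]
  have hrest : ∏ u ∈ Finset.univ.erase v, ∏ w ∈ Finset.univ.erase v,
      pairCoef κ J z h (r + Pi.single x 1) u w =
      ∏ u ∈ Finset.univ.erase v, ∏ w ∈ Finset.univ.erase v, pairCoef κ J z h r u w := by
    refine Finset.prod_congr rfl fun u hu => Finset.prod_congr rfl fun w hw => ?_
    simp only [pairCoef, shift_add_single]
    rw [if_neg (Finset.mem_erase.1 hu).1, if_neg (Finset.mem_erase.1 hw).1, add_zero, add_zero]
  have hpair : (∏ u ∈ Finset.univ.erase v,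
        pairCoef κ J z h (r + Pi.single x 1) v u * pairCoef κ J z h (r + Pi.single x 1) u v) *
      ∏ u ∈ Finset.univ.erase v, (latticeVars κ J z h).kernel (r + Pi.single x 1) v u =
      (-1) ^ (lam x.1.succ + lam x.1.castSucc) *
      ((∏ u ∈ Finset.univ.erase v, pairCoef κ J z h r v u * pairCoef κ J z h r u v) *
      ∏ u ∈ Finset.univ.erase v, (latticeVars κ J z h).kernel r u v) := by
    rw [← Finset.prod_mul_distrib, ← Finset.prod_mul_distrib, ← prod_sign x.1 x.2,
      ← Finset.prod_mul_distrib]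
    exact Finset.prod_congr rfl fun u hu =>
      pairCoef_shift hκ hg r x hv (Finset.mem_erase.1 hu).1
  rw [hvv, hvv, hrest]
  have hsq : ((-1 : ℂ) ^ (lam x.1.succ + lam x.1.castSucc)) *
      (-1) ^ (lam x.1.succ + lam x.1.castSucc) = 1 := by
    rw [← mul_pow]; simp
  generalize (∏ u ∈ Finset.univ.erase v, ∏ w ∈ Finset.univ.erase v, pairCoef κ J z h r u w) = R
  generalize expPart lam κ (latticePoint κ J z r) z l = E
  calc _ = (-1) ^ (lam x.1.succ + lam x.1.castSucc) * (q x.1.castSucc / q x.1.succ) * E * R *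
        ((∏ u ∈ Finset.univ.erase v,
        pairCoef κ J z h (r + Pi.single x 1) v u * pairCoef κ J z h (r + Pi.single x 1) u v) *
      ∏ u ∈ Finset.univ.erase v, (latticeVars κ J z h).kernel (r + Pi.single x 1) v u) := by ring
    _ = _ := by
      rw [hpair]
      linear_combination (q x.1.castSucc / q x.1.succ) * E * R * ((∏ u ∈ Finset.univ.erase v, pairCoef κ J z h r v u * pairCoef κ J z h r u v) *
      ∏ u ∈ Finset.univ.erase v, (latticeVars κ J z h).kernel r u v) * hsq

end

/-! ### Holomorphic dependence on parameters and geometric convergence -/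

section

variable {M : ℕ} {lam : Fin (M + 1) → ℕ} {κ : ℂ}

theorem isClosed_intCast_image (s : Set ℤ) : IsClosed (((↑) : ℤ → ℂ) '' s) := by
  have h : IsClosedEmbedding ((↑) : ℤ → ℂ) := by
    have h1 : IsClosedEmbedding ((↑) : ℝ → ℂ) := Complex.isometry_ofReal.isClosedEmbedding
    have := h1.comp Int.isClosedEmbedding_coe_real
    exact this
  exact h.isClosedMap s (isClosed_discrete s)

theorem isOpen_setOf_ne_int_mul (hκ : κ ≠ 0) (s : Set ℤ) :
    IsOpen {x : ℂ | ∀ m ∈ s, x ≠ m * κ} := by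
  have h1 := ((isClosed_intCast_image s).preimage (continuous_id.div_const κ)).isOpen_compl
  convert h1 using 1
  ext x
  simp only [Set.mem_ofPred_eq, Set.mem_compl_iff, Set.mem_preimage, Set.mem_image, id, not_exists,
    not_and]
  refine forall₂_congr fun m _ => ?_
  rw [not_iff_not, eq_div_iff hκ, eq_comm]

theorem isOpen_offLattice (hκ : κ ≠ 0) : IsOpen {x : ℂ | OffLattice κ x} := by
  simpa [OffLattice] using isOpen_setOf_ne_int_mul hκ Set.univ

theorem isOpen_generic (hκ : κ ≠ 0) (n : ℕ) :
    IsOpen {p : (Fin n → ℂ) × ℂ | Generic κ p.1 p.2} := by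
  have h1 : {p : (Fin n → ℂ) × ℂ | Generic κ p.1 p.2} =
      {p | ∀ m ∈ Set.Iic (0 : ℤ), p.2 ≠ m * κ} ∩ ⋂ a, ⋂ b, ⋂ _ : a ≠ b,
        {p | OffLattice κ (p.1 a - p.1 b)} ∩ {p | OffLattice κ (p.1 a - p.1 b + p.2)} := by
    ext p
    simp only [Set.mem_ofPred_eq, Set.mem_inter_iff, Set.mem_iInter, Set.mem_Iic]
    exact ⟨fun h => ⟨h.1, fun a b hab => ⟨h.2 a b hab, h.3 a b hab⟩⟩,
      fun h => ⟨h.1, fun a b hab => (h.2 a b hab).1, fun a b hab => (h.2 a b hab).2⟩⟩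
  rw [h1]
  refine ((isOpen_setOf_ne_int_mul hκ _).preimage continuous_snd).inter
    (isOpen_iInter_of_finite fun a => isOpen_iInter_of_finite fun b =>
      isOpen_iInter_of_finite fun _ => ?_)
  have c1 : Continuous fun p : (Fin n → ℂ) × ℂ => p.1 a - p.1 b := by fun_prop
  have c2 : Continuous fun p : (Fin n → ℂ) × ℂ => p.1 a - p.1 b + p.2 := by fun_prop
  exact ((isOpen_offLattice hκ).preimage c1).inter ((isOpen_offLattice hκ).preimage c2)

theorem norm_shift_le (r : TVar lam → ℤ) (k : Fin (M + 1)) (a : Fin (psum lam k)) :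
    ‖shift r k a‖ ≤ ‖r‖ := by
  induction k using Fin.lastCases with
  | last => simp
  | cast i => rw [shift_castSucc]; exact norm_le_pi_norm r _

theorem norm_shift_sub_le (r : TVar lam → ℤ) (u w : Vars lam) :
    ‖shift r u.1 u.2 - shift r w.1 w.2‖ ≤ 2 * ‖r‖ := by
  refine (norm_sub_le _ _).trans ?_
  linarith [norm_shift_le r u.1 u.2, norm_shift_le r w.1 w.2]

/-- Each `t^{(k)}_a` has a variable of the next colour with the same label, since the sets
`J_1 ∪ … ∪ J_k` increase with `k`. -/
theorem exists_pos_succ_eq (J : Parts lam) (i : Fin M) (a : Fin (psum lam i.castSucc)) :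
    ∃ c, pos J i.succ c = pos J i.castSucc a := by
  have h1 : pos J i.castSucc a ∈ blockUnion J i.castSucc := Finset.orderEmbOfFin_mem _ _ _
  have h2 : pos J i.castSucc a ∈ blockUnion J i.succ := by
    simp only [blockUnion, Finset.mem_filter, Finset.mem_univ, true_and] at h1 ⊢
    exact h1.trans (Fin.castSucc_lt_succ).le
  have h3 : pos J i.castSucc a ∈ Set.range (pos J i.succ) := by
    rw [pos, Finset.range_orderEmbOfFin]; exact h2
  exact h3

/-- The residues vanish unless all coordinates of `r` are nonpositive: along each chain of
variables with a common label, the shift can only decrease from a colour to the previous one, and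
it is zero for the last colour. -/
theorem shift_nonpos_of_prod_ne_zero {J : Parts lam} {z : Fin (size lam) → ℂ} {h : ℂ}
    {r : TVar lam → ℤ} (hne : ∏ u : Vars lam, ∏ w : Vars lam, pairCoef κ J z h r u w ≠ 0)
    (k : Fin (M + 1)) : ∀ a : Fin (psum lam k), shift r k a ≤ 0 := by
  induction k using Fin.reverseInduction with
  | last => intro a; simp
  | cast i ih =>
    intro a
    obtain ⟨c, hc⟩ := exists_pos_succ_eq J i a
    refine le_trans ?_ (ih c)
    have h1 := Finset.prod_ne_zero_iff.1 (Finset.prod_ne_zero_iff.1 hne ⟨i.castSucc, a⟩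
      (Finset.mem_univ _)) ⟨i.succ, c⟩ (Finset.mem_univ _)
    by_contra hlt
    push Not at hlt
    refine h1 ?_
    rw [pairCoef, if_neg (by simp), if_pos (by simp), hop, if_pos (show label J ⟨i.castSucc, a⟩ = label J ⟨i.succ, c⟩ from hc.symm)]
    exact resPhi_of_neg _ (by simpa using hlt)

theorem differentiableAt_resPhi {E : Type*} [NormedAddCommGroup E] [NormedSpace ℂ E] (hκ : κ ≠ 0)
    {h : E → ℂ} {p : E} (hh : DifferentiableAt ℂ h p) (h0 : ∀ m : ℤ, m ≤ 0 → h p ≠ m * κ) (m : ℤ) :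
    DifferentiableAt ℂ (fun q => resPhi κ (h q) m) p := by
  unfold resPhi
  split_ifs with hm
  · have e3 : DifferentiableAt ℂ (fun q => h q / κ + (m.toNat : ℂ)) p := by
      simpa only [div_eq_mul_inv] using (hh.mul_const κ⁻¹).add_const (m.toNat : ℂ)
    refine DifferentiableAt.const_mul ?_ _
    refine (Complex.differentiableAt_Gamma _ fun k e => ?_).fun_comp' p e3
    refine h0 (-(k + m.toNat)) (by omega) ?_
    rw [← eq_sub_iff_add_eq, div_eq_iff hκ] at e
    rw [e]; push_cast; ring
  · exact differentiableAt_const _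

section Params

variable {E : Type*} [NormedAddCommGroup E] [NormedSpace ℂ E] {p : E}
  {z : E → Fin (size lam) → ℂ} {h : E → ℂ} {l : E → Fin (M + 1) → ℂ}

theorem differentiableAt_prod {α : Type*} {s : Finset α} {f : α → E → ℂ}
    (hf : ∀ a ∈ s, DifferentiableAt ℂ (f a) p) : DifferentiableAt ℂ (fun q => ∏ a ∈ s, f a q) p := by
  classical
  induction s using Finset.induction_on with
  | empty => simp
  | insert a s ha ih =>
    simp only [Finset.prod_insert ha]
    exact (hf a (Finset.mem_insert_self a s)).mul
      (ih fun b hb => hf b (Finset.mem_insert_of_mem hb))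

theorem differentiableAt_pairCoef (hκ : κ ≠ 0) (J : Parts lam) (hz : DifferentiableAt ℂ z p)
    (hh : DifferentiableAt ℂ h p) (hg : Generic κ (z p) (h p)) (r : TVar lam → ℤ) (u w : Vars lam) :
    DifferentiableAt ℂ (fun q => pairCoef κ J (z q) (h q) r u w) p := by
  have hza : ∀ a, DifferentiableAt ℂ (fun q => z q a) p := fun a => differentiableAt_pi.1 hz a
  unfold pairCoef
  split_ifs with h1 h2 h3
  · have hne := label_injective_of_col J h1 h2.1
    have g1 := (hg.diff _ _ hne).add_int (shift r u.1 u.2 - shift r w.1 w.2)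
    have g2 := (hg.sub_diff hne).add_int (-(shift r u.1 u.2 - shift r w.1 w.2))
    have g2' : OffLattice κ (h p - (z p (label J u) - z p (label J w) +
        (shift r u.1 u.2 - shift r w.1 w.2 : ℤ) * κ)) := by
      convert g2 using 1; push_cast; ring
    have hx : DifferentiableAt ℂ (fun q => z q (label J u) - z q (label J w) +
        (shift r u.1 u.2 - shift r w.1 w.2 : ℤ) * κ) p := ((hza _).sub (hza _)).add_const _
    have hphi := differentiableAt_phi hκ hh hx (fun m => by simpa using g1 (-m))
      (fun m => by simpa using g2' (-m))
    simp only [one_div]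
    refine DifferentiableAt.fun_inv ((hx.sub hh).mul hphi) (mul_ne_zero ?_ (phi_ne_zero hκ g1 g2'))
    have := g2'.neg.ne_zero
    rwa [neg_sub] at this
  · exact differentiableAt_const _
  · unfold hop
    split_ifs with h4
    · exact differentiableAt_resPhi hκ hh hg.h_ne _
    · have g1 := (hg.diff _ _ h4).add_int (shift r u.1 u.2 - shift r w.1 w.2)
      have g2 := (hg.sub_diff h4).add_int (-(shift r u.1 u.2 - shift r w.1 w.2))
      have g2' : OffLattice κ (h p - (z p (label J u) - z p (label J w) +
          (shift r u.1 u.2 - shift r w.1 w.2 : ℤ) * κ)) := by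
        convert g2 using 1; push_cast; ring
      have hx : DifferentiableAt ℂ (fun q => z q (label J u) - z q (label J w) +
          (shift r u.1 u.2 - shift r w.1 w.2 : ℤ) * κ) p := ((hza _).sub (hza _)).add_const _
      exact differentiableAt_phi hκ hh hx (fun m => by simpa using g1 (-m))
        (fun m => by simpa using g2' (-m))
  · exact differentiableAt_const _

theorem tempered_pairCoef (hκ : κ ≠ 0) (J : Parts lam) (hz : DifferentiableAt ℂ z p)
    (hh : DifferentiableAt ℂ h p) (hg : Generic κ (z p) (h p)) (u w : Vars lam) :
    Tempered (𝓝 p) fun r q => pairCoef κ J (z q) (h q) r u w := by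
  have hza : ∀ a, DifferentiableAt ℂ (fun q => z q a) p := fun a => differentiableAt_pi.1 hz a
  have hphi : ∀ {a b}, a ≠ b → ContinuousAt (fun q => phi κ (h q) (z q a - z q b)) p :=
    fun {a b} hab => (differentiableAt_phi hκ hh ((hza _).fun_sub (hza _))
      (fun m => by simpa using hg.diff _ _ hab (-m))
      (fun m => by simpa using hg.sub_diff hab (-m))).continuousAt
  unfold pairCoef
  split_ifs with h1 h2 h3
  · have hne := label_injective_of_col J h1 h2.1
    obtain ⟨K, d, hev⟩ := exists_norm_inv_phi_le hκ ((hza (label J u)).fun_sub (hza (label J w))).continuousAt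
      hh.continuousAt (hphi hne) (hg.diff _ _ hne) (hg.sub_diff hne)
    exact Tempered.of_int (fun r => norm_shift_sub_le r u w) hev
  · exact Tempered.const 1
  · unfold hop
    split_ifs with h4
    · obtain ⟨K, d, hev⟩ := exists_norm_resPhi_le hκ hh.continuousAt
        (hh.continuousAt.eventually (by
          have := (isOpen_setOf_ne_int_mul hκ (Set.Iic (0 : ℤ))).mem_nhds
            (x := h p) (fun m hm => hg.h_ne m hm)
          exact this))
        (differentiableAt_resPhi hκ hh hg.h_ne 0).continuousAt
      refine Tempered.of_int (c := 2) (N := fun r => -(shift r u.1 u.2 - shift r w.1 w.2))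
        (F := fun m q => resPhi κ (h q) m) (fun r => ?_) hev
      rw [norm_neg]; exact norm_shift_sub_le r u w
    · obtain ⟨K, d, hev⟩ := exists_norm_phi_le hκ ((hza (label J u)).fun_sub (hza (label J w))).continuousAt
        hh.continuousAt (hphi h4) (hg.diff _ _ h4) (hg.sub_diff h4)
      exact Tempered.of_int (fun r => norm_shift_sub_le r u w) hev
  · exact Tempered.const 1

theorem expPart_latticePoint (hκ : κ ≠ 0) (J : Parts lam) (z : Fin (size lam) → ℂ)
    (l : Fin (M + 1) → ℂ) (r : TVar lam → ℤ) :
    expPart lam κ (latticePoint κ J z r) z l = expPart lam κ (cycle J z) z l *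
      ∏ x : TVar lam, Complex.exp (Real.pi * Complex.I *
        ((lam x.1.succ : ℂ) - lam x.1.castSucc) + (l x.1.castSucc - l x.1.succ)) ^ r x := by
  unfold expPart
  rw [Fintype.prod_sigma, mul_assoc (Complex.exp _), ← Finset.prod_mul_distrib]
  congr 1
  refine Finset.prod_congr rfl fun i _ => ?_
  simp only [← Complex.exp_int_mul, ← Complex.exp_sum, ← Complex.exp_add, tz_castSucc, latticePoint]
  rw [Finset.sum_add_distrib, ← Finset.sum_mul, ← Finset.sum_mul, add_div,
    mul_div_cancel_right₀ _ hκ]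
  congr 1
  ring

theorem differentiableAt_tz {T : E → TVar lam → ℂ} (hT : DifferentiableAt ℂ T p)
    (hz : DifferentiableAt ℂ z p) (k : Fin (M + 1)) (a : Fin (psum lam k)) :
    DifferentiableAt ℂ (fun q => tz (T q) (z q) k a) p := by
  induction k using Fin.lastCases with
  | last => simp only [tz_last]; exact differentiableAt_pi.1 hz _
  | cast i => simp only [tz_castSucc]; exact differentiableAt_pi.1 hT _

theorem differentiableAt_latticePoint (J : Parts lam) (hz : DifferentiableAt ℂ z p)
    (r : TVar lam → ℤ) : DifferentiableAt ℂ (fun q => latticePoint κ J (z q) r) p :=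
  differentiableAt_pi.2 fun _ => (differentiableAt_pi.1 hz _).add_const _

theorem differentiableAt_expPart {T : E → TVar lam → ℂ} (hT : DifferentiableAt ℂ T p)
    (hz : DifferentiableAt ℂ z p) (hl : DifferentiableAt ℂ l p) :
    DifferentiableAt ℂ (fun q => expPart lam κ (T q) (z q) (l q)) p := by
  have hla : ∀ a, DifferentiableAt ℂ (fun q => l q a) p := fun a => differentiableAt_pi.1 hl a
  have hza : ∀ a, DifferentiableAt ℂ (fun q => z q a) p := fun a => differentiableAt_pi.1 hz a
  unfold expPart
  simp only [div_eq_mul_inv]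
  refine DifferentiableAt.mul (DifferentiableAt.cexp ?_)
    (differentiableAt_prod fun i _ => DifferentiableAt.cexp ?_)
  · exact ((hla _).const_add _).mul
      ((DifferentiableAt.fun_sum fun a _ => hza a).mul_const _)
  · exact (((hla _).sub (hla _)).const_add _).mul
      ((DifferentiableAt.fun_sum fun a _ => differentiableAt_tz hT hz _ _).mul_const _)

theorem differentiableAt_masterCoef (hκ : κ ≠ 0) (J : Parts lam) (hz : DifferentiableAt ℂ z p)
    (hh : DifferentiableAt ℂ h p) (hl : DifferentiableAt ℂ l p) (hg : Generic κ (z p) (h p))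
    (r : TVar lam → ℤ) : DifferentiableAt ℂ (fun q => masterCoef κ J (z q) (h q) (l q) r) p :=
  (differentiableAt_expPart (differentiableAt_latticePoint J hz r) hz hl).mul
    (differentiableAt_prod fun u _ => differentiableAt_prod fun w _ =>
      differentiableAt_pairCoef hκ J hz hh hg r u w)

/-- The pair factors and `F` grow polynomially in `r`, the exponential factors contribute powers of
the ratios `q_{k+1} / q_k`, and only nonpositive `r` occur, so that the terms are dominated by a
convergent series, locally uniformly in the parameters. -/
theorem exists_summable_bound (hκ : κ ≠ 0) (J : Parts lam) (hz : DifferentiableAt ℂ z p)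
    (hh : DifferentiableAt ℂ h p) (hl : DifferentiableAt ℂ l p) (hg : Generic κ (z p) (h p))
    (hq : ∀ i : Fin M, ‖Complex.exp (l p i.succ - l p i.castSucc)‖ < 1)
    {F : (TVar lam → ℤ) → E → ℂ} (hF : Tempered (𝓝 p) F) :
    ∃ b : (TVar lam → ℤ) → ℝ, Summable b ∧
      ∀ᶠ q in 𝓝 p, ∀ r, ‖masterCoef κ J (z q) (h q) (l q) r * F r q‖ ≤ b r := by
  have hla : ∀ a, DifferentiableAt ℂ (fun q => l q a) p := fun a => differentiableAt_pi.1 hl a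
  -- a bound for the ratios which is uniform near `p`
  obtain ⟨ρ, hρ0, hρ1, hρ⟩ : ∃ ρ : ℝ, 0 ≤ ρ ∧ ρ < 1 ∧
      ∀ i : Fin M, ‖Complex.exp (l p i.succ - l p i.castSucc)‖ < ρ := by
    have h1 : ∀ᶠ ρ : ℝ in 𝓝[<] 1, ∀ i : Fin M,
        ‖Complex.exp (l p i.succ - l p i.castSucc)‖ < ρ :=
      eventually_all.2 fun i => (eventually_gt_nhds (hq i)).filter_mono nhdsWithin_le_nhds
    have h2 : ∀ᶠ ρ : ℝ in 𝓝[<] 1, 0 < ρ :=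
      (eventually_gt_nhds one_pos).filter_mono nhdsWithin_le_nhds
    obtain ⟨ρ, ⟨h3, h4⟩, h5⟩ := ((h1.and h2).and self_mem_nhdsWithin).exists
    exact ⟨ρ, h4.le, h5, h3⟩
  have hev : ∀ᶠ q in 𝓝 p, ∀ i : Fin M, ‖Complex.exp (l q i.succ - l q i.castSucc)‖ < ρ := by
    refine eventually_all.2 fun i => ?_
    have hc : ContinuousAt (fun q => ‖Complex.exp (l q i.succ - l q i.castSucc)‖) p :=
      ((hla _).sub (hla _)).cexp.continuousAt.norm
    exact hc.eventually (gt_mem_nhds (hρ i))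
  have hT : Tempered (𝓝 p) fun r q => (expPart lam κ (cycle J (z q)) (z q) (l q) *
      ∏ u : Vars lam, ∏ w : Vars lam, pairCoef κ J (z q) (h q) r u w) * F r q := by
    refine Tempered.mul (Tempered.mul (Tempered.of_continuousAt ?_) ?_) hF
    · have h0 := differentiableAt_expPart (κ := κ)
        (T := fun q => cycle J (z q)) (differentiableAt_pi.2 fun _ => differentiableAt_pi.1 hz _) hz hl
      exact h0.continuousAt
    · exact Tempered.prod _ fun u _ => Tempered.prod _ fun w _ => tempered_pairCoef hκ J hz hh hg u w
  obtain ⟨K, d, hK⟩ := hT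
  refine ⟨fun r => |K| * ((1 + ‖r‖) ^ d * ∏ x, ρ ^ (r x).natAbs),
    (summable_geometric_mul_pow hρ0 hρ1 d).mul_left _, ?_⟩
  filter_upwards [hev, hK] with q hq1 hq2 r
  by_cases hne : ∏ u : Vars lam, ∏ w : Vars lam, pairCoef κ J (z q) (h q) r u w = 0
  · rw [masterCoef, hne, mul_zero, zero_mul, norm_zero]
    positivity
  · have hr : ∀ x, r x ≤ 0 := fun x => by
      have := shift_nonpos_of_prod_ne_zero hne x.1.castSucc x.2
      rwa [shift_castSucc] at this
    have h1 : ‖∏ x : TVar lam, Complex.exp (Real.pi * Complex.I *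
        ((lam x.1.succ : ℂ) - lam x.1.castSucc) + (l q x.1.castSucc - l q x.1.succ)) ^ r x‖ ≤
        ∏ x, ρ ^ (r x).natAbs := by
      rw [norm_prod]
      refine Finset.prod_le_prod (fun _ _ => norm_nonneg _) fun x _ => ?_
      have e1 : r x = -((r x).natAbs : ℤ) := by have := hr x; omega
      have e2 : (Complex.exp (Real.pi * Complex.I *
        ((lam x.1.succ : ℂ) - lam x.1.castSucc) + (l q x.1.castSucc - l q x.1.succ))) ^ r x =
        ((-1) ^ (lam x.1.succ + lam x.1.castSucc) *
          Complex.exp (l q x.1.succ - l q x.1.castSucc)) ^ (r x).natAbs := by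
        conv_lhs => rw [e1]
        rw [zpow_neg, zpow_natCast, ← inv_pow, Complex.exp_add, exp_pi_mul_sub, mul_inv,
          ← Complex.exp_neg, neg_sub]
        congr 2
        rcases neg_one_pow_eq_or ℂ (lam x.1.succ + lam x.1.castSucc) with h | h <;> rw [h] <;> norm_num
      rw [e2, norm_pow, norm_mul, norm_pow, norm_neg, norm_one, one_pow, one_mul]
      exact pow_le_pow_left₀ (norm_nonneg _) (hq1 x.1).le _
    rw [masterCoef, expPart_latticePoint hκ]
    set Pr := ∏ x : TVar lam, Complex.exp (Real.pi * Complex.I *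
        ((lam x.1.succ : ℂ) - lam x.1.castSucc) + (l q x.1.castSucc - l q x.1.succ)) ^ r x
    have h2 := hq2 r
    calc _ = ‖(expPart lam κ (cycle J (z q)) (z q) (l q) *
        ∏ u : Vars lam, ∏ w : Vars lam, pairCoef κ J (z q) (h q) r u w) * F r q‖ * ‖Pr‖ := by
          rw [← norm_mul]; congr 1; ring
      _ ≤ (|K| * (1 + ‖r‖) ^ d) * ∏ x, ρ ^ (r x).natAbs := by
          refine mul_le_mul (h2.trans ?_) h1 (norm_nonneg _) (by positivity)
          gcongr
          exact le_abs_self K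
      _ = _ := by ring

end Params

end

/-! ### Jackson sums and their twisted trace property -/

section

variable {M : ℕ} {lam : Fin (M + 1) → ℕ} {κ : ℂ}

section KernelParams

variable {E : Type*} [NormedAddCommGroup E] [NormedSpace ℂ E] {p : E}
  {z : E → Fin (size lam) → ℂ} {h : E → ℂ}

theorem val_sub_val (J : Parts lam) (z : Fin (size lam) → ℂ) (h : ℂ) (r : TVar lam → ℤ)
    (u w : Vars lam) : (latticeVars κ J z h).val r u - (latticeVars κ J z h).val r w =
      z (label J u) - z (label J w) + (shift r u.1 u.2 - shift r w.1 w.2 : ℤ) * κ := by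
  simp only [latticeVars]; push_cast; ring

theorem val_ne_val {J : Parts lam} {z : Fin (size lam) → ℂ} {h : ℂ} (hg : Generic κ z h)
    (r : TVar lam → ℤ) {u w : Vars lam} (hc : (u.1 : ℕ) = w.1) (hne : u ≠ w) :
    (latticeVars κ J z h).val r u ≠ (latticeVars κ J z h).val r w := by
  rw [← sub_ne_zero, val_sub_val]
  exact ((hg.diff _ _ (label_injective_of_col J hc hne)).add_int _).ne_zero

theorem separated_latticeVars {J : Parts lam} {z : Fin (size lam) → ℂ} {h : ℂ}
    (hg : Generic κ z h) : (latticeVars κ J z h).Separated :=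
  fun r _ _ hc _ hne => val_ne_val hg r hc hne

theorem kernel_latticeVars (J : Parts lam) (z : Fin (size lam) → ℂ) (h : ℂ) (r : TVar lam → ℤ)
    (u w : Vars lam) : (latticeVars κ J z h).kernel r u w =
      if (w.1 : ℕ) = u.1 + 1 then
        (latticeVars κ J z h).val r u - (latticeVars κ J z h).val r w - h
      else if (u.1 : ℕ) = w.1 + 1 then
        (latticeVars κ J z h).val r w - (latticeVars κ J z h).val r u
      else if (u.1 : ℕ) = w.1 ∧ (u.1 : ℕ) < M then
        ((latticeVars κ J z h).val r w - (latticeVars κ J z h).val r u - h) /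
          ((latticeVars κ J z h).val r w - (latticeVars κ J z h).val r u)
      else 1 := rfl

theorem differentiableAt_val (J : Parts lam) (hz : DifferentiableAt ℂ z p) (r : TVar lam → ℤ)
    (u : Vars lam) : DifferentiableAt ℂ (fun q => (latticeVars κ J (z q) (h q)).val r u) p :=
  (differentiableAt_pi.1 hz _).add_const _

theorem tempered_val (J : Parts lam) (hz : DifferentiableAt ℂ z p) (u : Vars lam) :
    Tempered (𝓝 p) fun r q => (latticeVars κ J (z q) (h q)).val r u :=
  (Tempered.of_continuousAt (differentiableAt_pi.1 hz _).continuousAt).add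
    ((Tempered.int (c := 1) fun r => by rw [one_mul]; exact norm_shift_le r u.1 u.2).mul
      (Tempered.const κ))

theorem differentiableAt_kernel (J : Parts lam) (hz : DifferentiableAt ℂ z p)
    (hh : DifferentiableAt ℂ h p) (hg : Generic κ (z p) (h p)) (r : TVar lam → ℤ) (u w : Vars lam) :
    DifferentiableAt ℂ (fun q => (latticeVars κ J (z q) (h q)).kernel r u w) p := by
  have hv := fun y => differentiableAt_val (κ := κ) (h := h) J hz r y
  simp only [kernel_latticeVars]
  split_ifs with h1 h2 h3
  · exact ((hv u).sub (hv w)).sub hh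
  · exact (hv w).sub (hv u)
  · rcases eq_or_ne u w with rfl | hne
    · simp
    · simp only [div_eq_mul_inv]
      exact (((hv w).sub (hv u)).sub hh).mul (((hv w).sub (hv u)).inv
        (sub_ne_zero.2 (val_ne_val hg r h3.1.symm hne.symm)))
  · exact differentiableAt_const _

theorem tempered_kernel (hκ : κ ≠ 0) (J : Parts lam) (hz : DifferentiableAt ℂ z p)
    (hh : DifferentiableAt ℂ h p) (hg : Generic κ (z p) (h p)) (u w : Vars lam) :
    Tempered (𝓝 p) fun r q => (latticeVars κ J (z q) (h q)).kernel r u w := by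
  have hv := fun y => tempered_val (κ := κ) (h := h) J hz y
  have hht : Tempered (𝓝 p) fun (_ : TVar lam → ℤ) q => h q :=
    Tempered.of_continuousAt hh.continuousAt
  simp only [kernel_latticeVars]
  split_ifs with h1 h2 h3
  · exact ((hv u).sub (hv w)).sub hht
  · exact (hv w).sub (hv u)
  · rcases eq_or_ne u w with rfl | hne
    · simpa using Tempered.const 0
    · simp only [div_eq_mul_inv]
      refine (((hv w).sub (hv u)).sub hht).mul ?_
      have hza : ∀ a, DifferentiableAt ℂ (fun q => z q a) p := fun a => differentiableAt_pi.1 hz a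
      obtain ⟨c, hc, hev⟩ := eventually_le_norm_div_add_int hκ
        ((hza (label J w)).fun_sub (hza (label J u))).continuousAt
        (hg.diff _ _ (label_injective_of_col J h3.1.symm hne.symm))
      refine Tempered.of_bounded (c * ‖κ‖)⁻¹ ?_
      filter_upwards [hev] with q hq r
      rw [norm_inv, val_sub_val]
      refine inv_anti₀ (mul_pos hc (norm_pos_iff.2 hκ)) ?_
      have := hq (shift r w.1 w.2 - shift r u.1 u.2)
      rw [← mul_div_cancel_right₀ (((shift r w.1 w.2 - shift r u.1 u.2 : ℤ) : ℂ)) hκ, ← add_div,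
        norm_div, le_div_iff₀ (norm_pos_iff.2 hκ)] at this
      refine this.trans' ?_
      gcongr
      exact le_mul_of_one_le_right hc.le (by linarith [norm_nonneg (shift r w.1 w.2 - shift r u.1 u.2)])
  · exact Tempered.const 1

end KernelParams

theorem kernel_congr (J : Parts lam) (z : Fin (size lam) → ℂ) (h : ℂ) {r r' : TVar lam → ℤ}
    {u w : Vars lam} (hu : shift r u.1 u.2 = shift r' u.1 u.2)
    (hw : shift r w.1 w.2 = shift r' w.1 w.2) :
    (latticeVars κ J z h).kernel r u w = (latticeVars κ J z h).kernel r' u w := by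
  have h1 : (latticeVars κ J z h).val r u = (latticeVars κ J z h).val r' u := by
    simp only [latticeVars, hu]
  have h2 : (latticeVars κ J z h).val r w = (latticeVars κ J z h).val r' w := by
    simp only [latticeVars, hw]
  simp only [kernel_latticeVars, h1, h2]

/-- The elements of the shuffle ring on which Jackson sums are considered: their value on a set `S`
depends only on the coordinates of `r` at the variables of `S`, and it grows polynomially. The
filter `𝓝 0` in the second condition plays no role, as the family is constant in the parameter. -/
structure Admissible {J : Parts lam} {z : Fin (size lam) → ℂ} {h : ℂ}
    (f : Shuffle (latticeVars κ J z h).kernel) : Prop where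
  loc : ∀ S r r', (∀ v ∈ S, shift r v.1 v.2 = shift r' v.1 v.2) → f r S = f r' S
  temp : ∀ S, Tempered (𝓝 (0 : ℂ)) fun r _ => f r S

namespace Admissible

variable {J : Parts lam} {z : Fin (size lam) → ℂ} {h : ℂ}
  {f g : Shuffle (latticeVars κ J z h).kernel}

theorem of_const (hf : ∀ r r', f r = f r') : Admissible f where
  loc S r r' _ := congrFun (hf r r') S
  temp S := by
    have : (fun r (_ : ℂ) => f r S) = fun _ _ => f 0 S := by
      funext r _; exact congrFun (hf r 0) S
    rw [this]
    exact Tempered.const _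

theorem tau (k : ℕ) : Admissible ((latticeVars κ J z h).tau k) := of_const fun _ _ => rfl

theorem site (y : Vars lam) (m : ℕ) : Admissible ((latticeVars κ J z h).site y m) :=
  of_const fun _ _ => rfl

theorem one : Admissible (1 : Shuffle (latticeVars κ J z h).kernel) := of_const fun _ _ => rfl

theorem sub (hf : Admissible f) (hg : Admissible g) : Admissible (f - g) where
  loc S r r' hS := by
    rw [Shuffle.sub_apply, Shuffle.sub_apply, hf.loc S r r' hS, hg.loc S r r' hS]
  temp S := (hf.temp S).sub (hg.temp S)

theorem add (hf : Admissible f) (hg : Admissible g) : Admissible (f + g) where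
  loc S r r' hS := by
    rw [Shuffle.add_apply, Shuffle.add_apply, hf.loc S r r' hS, hg.loc S r r' hS]
  temp S := (hf.temp S).add (hg.temp S)

theorem smul (c : ℂ) (hf : Admissible f) : Admissible (c • f) where
  loc S r r' hS := by rw [Shuffle.smul_apply, Shuffle.smul_apply, hf.loc S r r' hS]
  temp S := (Tempered.const c).mul (hf.temp S)

theorem zero : Admissible (0 : Shuffle (latticeVars κ J z h).kernel) := of_const fun _ _ => rfl

theorem sum {α : Type*} (s : Finset α) {F : α → Shuffle (latticeVars κ J z h).kernel}
    (hF : ∀ a ∈ s, Admissible (F a)) : Admissible (∑ a ∈ s, F a) :=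
  Finset.sum_induction F Admissible (fun _ _ => Admissible.add) Admissible.zero hF

theorem kernel_temp (hκ : κ ≠ 0) (hg : Generic κ z h) (u w : Vars lam) :
    Tempered (𝓝 (0 : ℂ)) fun r _ => (latticeVars κ J z h).kernel r u w :=
  tempered_kernel (z := fun _ : ℂ => z) (h := fun _ => h) hκ J (differentiableAt_const _)
    (differentiableAt_const _) hg u w

theorem mul (hκ : κ ≠ 0) (hgen : Generic κ z h) (hf : Admissible f) (hg : Admissible g) :
    Admissible (f * g) where
  loc S r r' hS := by
    simp only [Shuffle.mul_apply]
    refine Finset.sum_congr rfl fun A hA => ?_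
    have hAS := Finset.mem_powerset.1 hA
    rw [hf.loc A r r' fun v hv => hS v (hAS hv),
      hg.loc (S \ A) r r' fun v hv => hS v (Finset.mem_sdiff.1 hv).1]
    congr 2
    exact Finset.prod_congr rfl fun u hu => Finset.prod_congr rfl fun w hw =>
      kernel_congr J z h (hS u (hAS hu)) (hS w (Finset.mem_sdiff.1 hw).1)
  temp S := by
    simp only [Shuffle.mul_apply]
    exact Tempered.sum _ fun A _ => ((Tempered.prod _ fun u _ => Tempered.prod _ fun w _ =>
      kernel_temp hκ hgen u w).mul (hf.temp A)).mul (hg.temp _)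

theorem root (hκ : κ ≠ 0) (hgen : Generic κ z h) (d : ℕ) :
    ∀ i, Admissible ((latticeVars κ J z h).root i d) := by
  induction d with
  | zero => intro i; exact tau i
  | succ d ih =>
    intro i
    exact (((ih (i + 1)).mul hκ hgen (tau i)).sub ((tau i).mul hκ hgen (ih (i + 1)))).smul _

theorem word (hκ : κ ≠ 0) (hgen : Generic κ z h) {ι : Type*} (y : ι → Vars lam) (L : List ι)
    (p : ι → ℕ) : Admissible ((latticeVars κ J z h).word y L p) := by
  induction L with
  | nil => exact one
  | cons a L ih => rw [ColoredVars.word_cons]; exact (site _ _).mul hκ hgen ih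

end Admissible

/-- The sum over the lattice of the values of `f` on the set of all variables, weighted by the
residues of the master function. -/
def jackSum {J : Parts lam} {z : Fin (size lam) → ℂ} {h : ℂ} (l : Fin (M + 1) → ℂ)
    (f : Shuffle (latticeVars κ J z h).kernel) : ℂ :=
  ∑' r, masterCoef κ J z h l r * f r Finset.univ

section JackSum

variable {J : Parts lam} {z : Fin (size lam) → ℂ} {h : ℂ} {l : Fin (M + 1) → ℂ}
  (hκ : κ ≠ 0) (hgen : Generic κ z h)
  (hq : ∀ i : Fin M, ‖Complex.exp (l i.succ - l i.castSucc)‖ < 1)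

include hκ hgen hq

theorem summable_masterCoef_mul {F : (TVar lam → ℤ) → ℂ}
    (hF : Tempered (𝓝 (0 : ℂ)) fun r _ => F r) : Summable fun r => masterCoef κ J z h l r * F r := by
  obtain ⟨b, hb, hev⟩ := exists_summable_bound (z := fun _ : ℂ => z) (h := fun _ => h)
    (l := fun _ => l) hκ J (differentiableAt_const _) (differentiableAt_const _)
    (differentiableAt_const _) hgen hq hF
  exact Summable.of_norm_bounded hb hev.self_of_nhds

theorem jackSum_add {f g : Shuffle (latticeVars κ J z h).kernel} (hf : Admissible f)
    (hg : Admissible g) : jackSum l (f + g) = jackSum l f + jackSum l g := by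
  simp only [jackSum, Shuffle.add_apply, mul_add]
  exact (summable_masterCoef_mul hκ hgen hq (hf.temp _)).tsum_add
    (summable_masterCoef_mul hκ hgen hq (hg.temp _))

theorem jackSum_sub {f g : Shuffle (latticeVars κ J z h).kernel} (hf : Admissible f)
    (hg : Admissible g) : jackSum l (f - g) = jackSum l f - jackSum l g := by
  simp only [jackSum, Shuffle.sub_apply, mul_sub]
  exact (summable_masterCoef_mul hκ hgen hq (hf.temp _)).tsum_sub
    (summable_masterCoef_mul hκ hgen hq (hg.temp _))

omit hκ hgen hq in
theorem jackSum_smul (c : ℂ) (f : Shuffle (latticeVars κ J z h).kernel) :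
    jackSum l (c • f) = c * jackSum l f := by
  simp only [jackSum, Shuffle.smul_apply, mul_left_comm _ c, tsum_mul_left]

omit hκ hgen hq in
@[simp] theorem jackSum_zero : jackSum l (0 : Shuffle (latticeVars κ J z h).kernel) = 0 := by
  simp [jackSum]

theorem jackSum_sum {α : Type*} (s : Finset α) {F : α → Shuffle (latticeVars κ J z h).kernel}
    (hF : ∀ a ∈ s, Admissible (F a)) : jackSum l (∑ a ∈ s, F a) = ∑ a ∈ s, jackSum l (F a) := by
  classical
  induction s using Finset.induction_on with
  | empty => simp
  | insert a s ha ih =>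
    have hs : ∀ b ∈ s, Admissible (F b) := fun b hb => hF b (Finset.mem_insert_of_mem hb)
    rw [Finset.sum_insert ha, Finset.sum_insert ha, jackSum_add hκ hgen hq
      (hF a (Finset.mem_insert_self a s)) (Admissible.sum s hs), ih hs]

variable {y : ℕ → ℂ} (hy : ∀ i : Fin (M + 1), y i = Complex.exp (l i))
include hy

/-- Multiplication by a simple root vector on the right is exchanged for multiplication on the left
by the shift of the coordinate of the split-off variable. The rest of the term does not depend on
this coordinate. -/
theorem jackSum_mul_tau {f : Shuffle (latticeVars κ J z h).kernel} (hf : Admissible f) {k : ℕ}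
    (hk : k < M) :
    jackSum l (f * (latticeVars κ J z h).tau k) =
      y (k + 1) / y k * jackSum l ((latticeVars κ J z h).tau k * f) := by
  have hy0 : ∀ i : Fin (M + 1), y i ≠ 0 := fun i => by rw [hy]; exact Complex.exp_ne_zero _
  have ht1 : ∀ v : Vars lam, Tempered (𝓝 (0 : ℂ)) fun r _ =>
      (∏ u ∈ Finset.univ.erase v, (latticeVars κ J z h).kernel r u v) *
        f r (Finset.univ.erase v) := fun v =>
    (Tempered.prod _ fun u _ => Admissible.kernel_temp hκ hgen u v).mul (hf.temp _)
  have ht2 : ∀ v : Vars lam, Tempered (𝓝 (0 : ℂ)) fun r _ =>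
      (∏ u ∈ Finset.univ.erase v, (latticeVars κ J z h).kernel r v u) *
        f r (Finset.univ.erase v) := fun v =>
    (Tempered.prod _ fun u _ => Admissible.kernel_temp hκ hgen v u).mul (hf.temp _)
  simp only [jackSum, ColoredVars.tau, Shuffle.mul_single_apply, Shuffle.single_mul_apply,
    Finset.mul_sum]
  rw [Summable.tsum_finsetSum fun v _ => summable_masterCoef_mul hκ hgen hq (ht1 v),
    Summable.tsum_finsetSum fun v _ => summable_masterCoef_mul hκ hgen hq (ht2 v), Finset.mul_sum]
  refine Finset.sum_congr rfl fun v hv => ?_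
  rw [Finset.mem_filter] at hv
  obtain ⟨i, a⟩ := v
  obtain ⟨j, rfl⟩ : ∃ j : Fin M, j.castSucc = i := ⟨⟨k, hk⟩, Fin.ext hv.2.symm⟩
  have hjk : (j : ℕ) = k := hv.2
  have hyj : y k = y (j.castSucc : Fin (M + 1)) := by rw [← hjk]; rfl
  have hyj' : y (k + 1) = y (j.succ : Fin (M + 1)) := by rw [← hjk]; rfl
  rw [hyj, hyj', ← tsum_mul_left]
  -- in the sum on the left, `r + Pi.single ⟨j, a⟩ 1` is substituted for `r`
  refine Eq.trans ?_ ((Equiv.addRight (Pi.single (⟨j, a⟩ : TVar lam) (1 : ℤ))).tsum_eq _)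
  refine tsum_congr fun r => ?_
  have hstep := masterCoef_shift (J := J) hκ hgen (l := l) (q := fun i => y i) (fun i => (hy i).symm) r ⟨j, a⟩
  have hloc : f (r + Pi.single ⟨j, a⟩ 1) (Finset.univ.erase (⟨j.castSucc, a⟩ : Vars lam)) =
      f r (Finset.univ.erase (⟨j.castSucc, a⟩ : Vars lam)) :=
    hf.loc _ _ _ fun w hw => by
      rw [shift_add_single, if_neg (Finset.mem_erase.1 hw).1, add_zero]
  simp only [Equiv.coe_addRight]
  rw [hloc]
  simp only at hstep
  have h1 := hy0 j.castSucc
  have h2 := hy0 j.succ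
  calc _ = (y (j.succ : Fin (M + 1)) / y (j.castSucc : Fin (M + 1))) *
        ((y (j.castSucc : Fin (M + 1)) / y (j.succ : Fin (M + 1))) * (masterCoef κ J z h l r *
        ∏ u ∈ Finset.univ.erase (⟨j.castSucc, a⟩ : Vars lam),
          (latticeVars κ J z h).kernel r u ⟨j.castSucc, a⟩)) *
          f r (Finset.univ.erase (⟨j.castSucc, a⟩ : Vars lam)) := by field_simp
    _ = _ := by rw [← hstep]; ring

theorem jackSum_mul_root (d : ℕ) : ∀ (i : ℕ), i + d < M →
    ∀ {f : Shuffle (latticeVars κ J z h).kernel}, Admissible f →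
    jackSum l (f * (latticeVars κ J z h).root i d) =
      y (i + d + 1) / y i * jackSum l ((latticeVars κ J z h).root i d * f) := by
  induction d with
  | zero => intro i hi f hf; exact jackSum_mul_tau hκ hgen hq hy hf hi
  | succ d ih =>
    intro i hi f hf
    have hh : (latticeVars κ J z h).h ≠ 0 := hgen.h_ne_zero
    have hR := Admissible.root (J := J) hκ hgen d (i + 1)
    have ht := Admissible.tau (κ := κ) (J := J) (z := z) (h := h) i
    set R := (latticeVars κ J z h).root (i + 1) d with hRdef
    set t := (latticeVars κ J z h).tau i with htdef
    have e1 : f * (latticeVars κ J z h).root i (d + 1) =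
        (latticeVars κ J z h).h⁻¹ • (f * R * t - f * t * R) := by
      rw [ColoredVars.root, mul_smul_comm, mul_sub, mul_assoc, mul_assoc]
    have e2 : (latticeVars κ J z h).root i (d + 1) * f =
        (latticeVars κ J z h).h⁻¹ • (R * (t * f) - t * (R * f)) := by
      rw [ColoredVars.root, smul_mul_assoc, sub_mul, mul_assoc, mul_assoc]
    have a1 := hf.mul hκ hgen hR
    have a2 := hf.mul hκ hgen ht
    have a3 := ht.mul hκ hgen hf
    have a4 := hR.mul hκ hgen hf
    have hyi : y (i + 1) ≠ 0 := by
      have := hy ⟨i + 1, by omega⟩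
      simp only at this
      rw [this]; exact Complex.exp_ne_zero _
    have i1 : i < M := by omega
    have b1 : jackSum l (f * R * t) =
        y (i + 1) / y i * (y (i + 1 + d + 1) / y (i + 1) * jackSum l (R * (t * f))) := by
      rw [jackSum_mul_tau hκ hgen hq hy a1 i1, ← mul_assoc, ih (i + 1) (by omega) a3]
    have b2 : jackSum l (f * t * R) =
        y (i + 1 + d + 1) / y (i + 1) * (y (i + 1) / y i * jackSum l (t * (R * f))) := by
      rw [ih (i + 1) (by omega) a2, ← mul_assoc, jackSum_mul_tau hκ hgen hq hy a4 i1]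
    rw [e1, e2, jackSum_smul, jackSum_smul, jackSum_sub hκ hgen hq (a1.mul hκ hgen ht)
      (a2.mul hκ hgen hR), jackSum_sub hκ hgen hq (hR.mul hκ hgen a3) (ht.mul hκ hgen a4), b1, b2,
      show i + (d + 1) + 1 = i + 1 + d + 1 by ring]
    field_simp

end JackSum

end

/-! ### The Jackson sum of the Cartan degree of a word -/

section

variable {M : ℕ} {lam : Fin (M + 1) → ℕ} {κ : ℂ}

/-- The variable `z_a`. -/
def zVar (a : Fin (size lam)) : Vars lam := ⟨Fin.last M, Fin.cast (psum_last lam).symm a⟩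

theorem label_zVar (J : Parts lam) (a : Fin (size lam)) : label J (zVar a) = a := by
  exact (pos_last J (Fin.cast (psum_last lam).symm a)).trans rfl

theorem val_zVar (J : Parts lam) (z : Fin (size lam) → ℂ) (h : ℂ) (r : TVar lam → ℤ)
    (a : Fin (size lam)) : (latticeVars κ J z h).val r (zVar a) = z a := by
  change z (label J (zVar a)) + (shift r (Fin.last M) (Fin.cast (psum_last lam).symm a) : ℤ) * κ = z a
  rw [label_zVar, shift_last]; simp

/-- The product of the site vectors of `z_1, …, z_n` with letters `p`. -/
def siteWord (κ : ℂ) (J : Parts lam) (z : Fin (size lam) → ℂ) (h : ℂ) (p : Fin (size lam) → ℕ) :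
    Shuffle (latticeVars κ J z h).kernel :=
  (latticeVars κ J z h).word zVar (List.finRange (size lam)) p

section JackSum

variable {J : Parts lam} {z : Fin (size lam) → ℂ} {h : ℂ} {l : Fin (M + 1) → ℂ}
  (hκ : κ ≠ 0) (hgen : Generic κ z h)
  (hq : ∀ i : Fin M, ‖Complex.exp (l i.succ - l i.castSucc)‖ < 1)
  {y : ℕ → ℂ} (hy : ∀ i : Fin (M + 1), y i = Complex.exp (l i))

include hq hy in
theorem norm_lt_norm_of_lt {i j : ℕ} (hij : i < j) (hj : j ≤ M) : ‖y j‖ < ‖y i‖ := by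
  have hstep : ∀ k, k < M → ‖y (k + 1)‖ < ‖y k‖ := by
    intro k hk
    have h1 := hq ⟨k, hk⟩
    have h2 : y (k + 1) = Complex.exp (l (Fin.succ ⟨k, hk⟩)) := hy (Fin.succ ⟨k, hk⟩)
    have h3 : y k = Complex.exp (l (Fin.castSucc ⟨k, hk⟩)) := hy (Fin.castSucc ⟨k, hk⟩)
    rw [Complex.exp_sub, ← h2, ← h3, norm_div, div_lt_one] at h1
    · exact h1
    · rw [h3]; exact norm_pos_iff.2 (Complex.exp_ne_zero _)
  induction j, hij using Nat.le_induction with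
  | base => exact hstep i (by omega)
  | succ j hij ih => exact (hstep j (by omega)).trans (ih (by omega))

include hκ hgen

theorem admissible_siteWord (p : Fin (size lam) → ℕ) : Admissible (siteWord κ J z h p) :=
  Admissible.word hκ hgen _ _ _

include hq hy

/-- The trace property and the commutation relation `word_comm_root` give two relations between the
Jackson sums of a word times a root vector in either order; they are solved here. -/
theorem jackSum_siteWord_mul_root {i j : ℕ} (hij : i < j) (hj : j ≤ M) (p : Fin (size lam) → ℕ) :
    jackSum l (siteWord κ J z h p * (latticeVars κ J z h).root i (j - i - 1)) =
      -(h * (y j / (y i - y j))) *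
        ∑ b, if p b = j then jackSum l (siteWord κ J z h (Function.update p b i)) else 0 := by
  have hlt := norm_lt_norm_of_lt hq hy hij hj
  have hyi : y i ≠ 0 := norm_pos_iff.1 ((norm_nonneg _).trans_lt hlt)
  have hne : y i - y j ≠ 0 := by
    rw [sub_ne_zero]; rintro e; rw [e] at hlt; exact lt_irrefl _ hlt
  have hW := admissible_siteWord (J := J) hκ hgen
  have hR := Admissible.root (J := J) hκ hgen (j - i - 1) i
  have hcomm := congrArg (jackSum l) (ColoredVars.word_comm_root (D := latticeVars κ J z h)
    hgen.h_ne_zero (separated_latticeVars hgen) zVar (fun _ => rfl) (i := i) (d := j - i - 1)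
    (show i + (j - i - 1) < M by omega) p (List.finRange (size lam)) (List.nodup_finRange _))
  have htr := jackSum_mul_root (J := J) hκ hgen hq hy (j - i - 1) i (by omega) (hW p)
  rw [show i + (j - i - 1) + 1 = j by omega] at hcomm htr
  change jackSum l (siteWord κ J z h p * _ - _ * siteWord κ J z h p) = _ at hcomm
  rw [jackSum_sub hκ hgen hq ((hW p).mul hκ hgen hR) (hR.mul hκ hgen (hW p)), jackSum_smul,
    jackSum_sum hκ hgen hq] at hcomm
  · have hs : (∑ b ∈ (List.finRange (size lam)).toFinset, jackSum l (if p b = j then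
        (latticeVars κ J z h).word zVar (List.finRange (size lam)) (Function.update p b i) else 0)) =
        ∑ b, if p b = j then jackSum l (siteWord κ J z h (Function.update p b i)) else 0 := by
      rw [List.toFinset_finRange]
      refine Finset.sum_congr rfl fun b _ => ?_
      split_ifs
      · rfl
      · exact jackSum_zero
    rw [hs] at hcomm
    change _ = h * _ at hcomm
    rw [eq_comm, ← sub_eq_zero]
    -- the two relations can be solved because `y i ≠ y j`
    have h3 : jackSum l ((latticeVars κ J z h).root i (j - i - 1) * siteWord κ J z h p) =
        y i / (y i - y j) * -(h * ∑ b, if p b = j then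
          jackSum l (siteWord κ J z h (Function.update p b i)) else 0) := by
      rw [← hcomm, htr]
      field_simp
      ring
    rw [htr, h3]
    field_simp
    ring
  · intro b _
    split_ifs
    · exact hW _
    · exact Admissible.zero

theorem jackSum_wordMove {i j : ℕ} (hij : i < j) (hj : j ≤ M) (p : Fin (size lam) → ℕ) :
    Admissible ((latticeVars κ J z h).wordMove i j zVar p (List.finRange (size lam))) ∧
    jackSum l ((latticeVars κ J z h).wordMove i j zVar p (List.finRange (size lam))) =
      -h * ∑ a, if p a = i then
        (y j / (y i - y j) * (∑ b, if Function.update p a j b = j then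
          jackSum l (siteWord κ J z h (Function.update (Function.update p a j) b i)) else 0)
        + ∑ b, if a < b ∧ p b = j then
          jackSum l (siteWord κ J z h (Function.update (Function.update p a j) b i)) else 0) else 0 := by
  have hW := admissible_siteWord (J := J) hκ hgen
  have hR := Admissible.root (J := J) hκ hgen (j - i - 1) i
  have heq := ColoredVars.wordMove_eq (D := latticeVars κ J z h) hgen.h_ne_zero
    (separated_latticeVars hgen) zVar (fun _ => rfl) hij (show j ≤ M from hj) p
    (List.finRange (size lam)) (List.pairwise_lt_finRange _)
  rw [List.toFinset_finRange] at heq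
  have hA2 : ∀ a b, Admissible (if a < b ∧ p b = j then (latticeVars κ J z h).word zVar
      (List.finRange (size lam)) (Function.update (Function.update p a j) b i) else 0) := by
    intro a b
    split_ifs
    · exact hW _
    · exact Admissible.zero
  have hA1 : ∀ a, Admissible ((latticeVars κ J z h).word zVar
      (List.finRange (size lam)) (Function.update p a j) * (latticeVars κ J z h).root i (j - i - 1)
        - (latticeVars κ J z h).h • ∑ b, (if a < b ∧ p b = j then (latticeVars κ J z h).word zVar
      (List.finRange (size lam)) (Function.update (Function.update p a j) b i) else 0)) := fun a =>
    ((hW _).mul hκ hgen hR).sub ((Admissible.sum _ fun b _ => hA2 a b).smul _)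
  have hA : ∀ a, Admissible (if p a = i then (latticeVars κ J z h).word zVar
      (List.finRange (size lam)) (Function.update p a j) * (latticeVars κ J z h).root i (j - i - 1)
        - (latticeVars κ J z h).h • ∑ b, (if a < b ∧ p b = j then (latticeVars κ J z h).word zVar
      (List.finRange (size lam)) (Function.update (Function.update p a j) b i) else 0) else 0) := by
    intro a
    split_ifs
    · exact hA1 a
    · exact Admissible.zero
  refine ⟨?_, ?_⟩
  · rw [heq]
    exact Admissible.sum _ fun a _ => hA a
  · rw [heq, jackSum_sum hκ hgen hq _ fun a _ => hA a, Finset.mul_sum]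
    refine Finset.sum_congr rfl fun a _ => ?_
    split_ifs with h1
    · have hW' : ∀ p', Admissible ((latticeVars κ J z h).word zVar (List.finRange (size lam)) p') :=
        hW
      rw [jackSum_sub hκ hgen hq ((hW' (Function.update p a j)).mul hκ hgen hR)
        ((Admissible.sum _ fun b _ => hA2 a b).smul _), jackSum_smul,
        jackSum_sum hκ hgen hq _ fun b _ => hA2 a b]
      have h2 := jackSum_siteWord_mul_root (J := J) hκ hgen hq hy hij hj (Function.update p a j)
      rw [siteWord] at h2
      rw [h2]
      have h3 : ∀ b, jackSum l (if a < b ∧ p b = j then (latticeVars κ J z h).word zVar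
          (List.finRange (size lam)) (Function.update (Function.update p a j) b i) else 0) =
          if a < b ∧ p b = j then
          jackSum l (siteWord κ J z h (Function.update (Function.update p a j) b i)) else 0 := by
        intro b
        split_ifs
        · rfl
        · exact jackSum_zero
      simp only [h3]
      change _ - h * _ = _
      ring
    · rw [jackSum_zero, mul_zero]

/-- The Jackson sum of the Cartan degree of a word is a linear combination of Jackson sums of
words. -/
theorem jackSum_cartanDeg {i : ℕ} (hi : i ≤ M) (p : Fin (size lam) → ℕ) :
    jackSum l ((latticeVars κ J z h).cartanDeg i (siteWord κ J z h p)) =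
      (∑ a, if p a = i then z a else 0) * jackSum l (siteWord κ J z h p)
      - h * (∑ j ∈ Finset.Ioc i M, ∑ a, if p a = i then
        (y j / (y i - y j) * (∑ b, if Function.update p a j b = j then
          jackSum l (siteWord κ J z h (Function.update (Function.update p a j) b i)) else 0)
        + ∑ b, if a < b ∧ p b = j then
          jackSum l (siteWord κ J z h (Function.update (Function.update p a j) b i)) else 0) else 0)
      + h * (∑ j ∈ Finset.range i, ∑ a, if p a = j then
        (y i / (y j - y i) * (∑ b, if Function.update p a i b = i then
          jackSum l (siteWord κ J z h (Function.update (Function.update p a i) b j)) else 0)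
        + ∑ b, if a < b ∧ p b = i then
          jackSum l (siteWord κ J z h (Function.update (Function.update p a i) b j)) else 0) else 0) := by
  have hW := admissible_siteWord (J := J) hκ hgen
  have h1 := ColoredVars.cartanDeg_word (D := latticeVars κ J z h) hgen.h_ne_zero
    (separated_latticeVars hgen) zVar (fun _ => rfl) (ζ := z)
    (fun a r => val_zVar (κ := κ) J z h r a) (show i ≤ M from hi) p
    (List.finRange (size lam)) (List.nodup_finRange _)
  rw [List.toFinset_finRange] at h1
  have hA1 : ∀ j ∈ Finset.Ioc i M, Admissible ((latticeVars κ J z h).wordMove i j zVar p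
      (List.finRange (size lam))) := fun j hj => by
    rw [Finset.mem_Ioc] at hj
    exact (jackSum_wordMove hκ hgen hq hy hj.1 hj.2 p).1
  have hA2 : ∀ j ∈ Finset.range i, Admissible ((latticeVars κ J z h).wordMove j i zVar p
      (List.finRange (size lam))) := fun j hj => by
    rw [Finset.mem_range] at hj
    exact (jackSum_wordMove hκ hgen hq hy hj hi p).1
  have h1' : (latticeVars κ J z h).cartanDeg i (siteWord κ J z h p) =
      (∑ a, if p a = i then z a else 0) • siteWord κ J z h p +
        (∑ j ∈ Finset.Ioc i M, (latticeVars κ J z h).wordMove i j zVar p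
          (List.finRange (size lam))) -
        ∑ j ∈ Finset.range i, (latticeVars κ J z h).wordMove j i zVar p
          (List.finRange (size lam)) := h1
  rw [h1']
  rw [jackSum_sub hκ hgen hq (((hW p).smul _).add (Admissible.sum _ hA1)) (Admissible.sum _ hA2),
    jackSum_add hκ hgen hq ((hW p).smul _) (Admissible.sum _ hA1), jackSum_smul,
    jackSum_sum hκ hgen hq _ hA1, jackSum_sum hκ hgen hq _ hA2,
    Finset.sum_congr rfl fun j hj => (jackSum_wordMove hκ hgen hq hy (Finset.mem_Ioc.1 hj).1
      (Finset.mem_Ioc.1 hj).2 p).2,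
    Finset.sum_congr rfl fun j hj => (jackSum_wordMove hκ hgen hq hy (Finset.mem_range.1 hj)
      hi p).2, ← Finset.mul_sum, ← Finset.mul_sum]
  ring

end JackSum

end

/-! ### Iterated residues at simple poles -/

/-- The residue of the product of a function with at most a simple pole and a holomorphic
function. -/
theorem residue_eq_of_mul {f k g : ℂ → ℂ} {s c : ℂ} (hf : ∀ᶠ t in 𝓝[≠] s, f t = k t * g t)
    (hk : ∀ᶠ t in 𝓝[≠] s, DifferentiableAt ℂ k t)
    (hc : Tendsto (fun t => (t - s) * k t) (𝓝[≠] s) (𝓝 c))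
    (hg : ∀ᶠ t in 𝓝 s, DifferentiableAt ℂ g t) : residue f s = c * g s := by
  classical
  set K : ℂ → ℂ := fun t => (Function.update (fun t => (t - s) * k t) s c t) * g t with hK
  rw [eventually_nhdsWithin_iff] at hf hk
  obtain ⟨δ, hδ, hball⟩ := Metric.eventually_nhds_iff.1 (hf.and (hk.and hg))
  have hKd : ∀ t, dist t s < δ → t ≠ s → DifferentiableAt ℂ K t := by
    intro t ht hts
    refine DifferentiableAt.mul ?_ (hball ht).2.2
    have : (fun t => (t - s) * k t) =ᶠ[𝓝 t] Function.update (fun t => (t - s) * k t) s c := by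
      filter_upwards [isOpen_ne.mem_nhds hts] with x hx
      rw [Function.update_of_ne hx]
    exact this.differentiableAt_iff.1 ((by fun_prop : DifferentiableAt ℂ (fun t => t - s) t).mul
      ((hball ht).2.1 hts))
  have hKc : ContinuousAt K s := by
    refine ContinuousAt.mul ?_ (hball (by simpa using hδ)).2.2.continuousAt
    rw [continuousAt_update_same]
    exact hc
  have hKs : K s = c * g s := by simp [hK]
  have key : ∀ ε : ℝ, 0 < ε → ε < δ →
      (2 * Real.pi * Complex.I)⁻¹ * ∮ t in C(s, ε), f t = c * g s := by
    intro ε h0 h1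
    have hint : (∮ t in C(s, ε), f t) = ∮ t in C(s, ε), (t - s)⁻¹ • K t := by
      refine circleIntegral.integral_congr h0.le fun t ht => ?_
      have hd : dist t s = ε := ht
      have hts : t ≠ s := by rintro rfl; rw [dist_self] at hd; exact h0.ne hd
      have hne : t - s ≠ 0 := sub_ne_zero.2 hts
      rw [(hball (by rw [hd]; exact h1)).1 hts, hK]
      simp only [Function.update_of_ne hts, smul_eq_mul]
      field_simp
    rw [hint, Complex.circleIntegral_sub_inv_smul_of_differentiable_on_off_countable
      (Set.countable_singleton s) (Metric.mem_ball_self h0), smul_eq_mul, hKs]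
    · field_simp [Complex.two_pi_I_ne_zero]
    · intro t ht
      have hd : dist t s ≤ ε := ht
      by_cases hts : t = s
      · rw [hts]; exact hKc.continuousWithinAt
      · exact (hKd t (hd.trans_lt h1) hts).continuousAt.continuousWithinAt
    · rintro t ⟨ht, hts⟩
      exact hKd t ((Metric.mem_ball.1 ht).trans h1) hts
  refine Tendsto.limUnder_eq ((tendsto_const_nhds (x := c * g s)).congr' ?_)
  filter_upwards [Ioo_mem_nhdsGT hδ] with ε hε
  exact (key ε hε.1 hε.2).symm

section IterRes

variable {ι : Type} [DecidableEq ι] [Fintype ι]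

/-- The iterated residue of `∏ y, k (T y - pv T y) * G T` at `s`, where `k` has simple poles at the
differences `s y - pv s y` and `G` is holomorphic near `s`. Each `pv T y` is a constant or another
variable, which is to be taken before `y`. During the induction the variables outside `xs` stay off
the poles. -/
theorem iterRes_eq_prod {s : ι → ℂ} {F G : (ι → ℂ) → ℂ} {k : ℂ → ℂ} {pv : (ι → ℂ) → ι → ℂ}
    {c : ι → ℂ} {δ : ℝ} (hδ : 0 < δ) {L : List ι}
    (hF : ∀ T, F T = (∏ y, k (T y - pv T y)) * G T)
    (hpv : ∀ y, (∃ a, ∀ T, pv T y = a) ∨ ∃ w, ∀ T, pv T y = T w)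
    (hord : ∀ x xs, x :: xs <:+ L → x ∉ xs ∧
      ∀ T t, (∀ y ∈ xs, T y = s y) → pv (Function.update T x t) x = pv s x)
    (hG : ∀ T, (∀ y, ‖T y - s y‖ < δ) → DifferentiableAt ℂ G T)
    (hk : ∀ y w, 0 < ‖w - (s y - pv s y)‖ → ‖w - (s y - pv s y)‖ < δ → DifferentiableAt ℂ k w)
    (hc : ∀ y, Tendsto (fun t => (t - s y) * k (t - pv s y)) (𝓝[≠] s y) (𝓝 (c y))) :
    ∀ xs, xs <:+ L → ∀ T : ι → ℂ, (∀ y, y ∉ xs → 0 < ‖T y - s y‖ ∧ ‖T y - s y‖ < δ) →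
      iterRes s F xs T = (∏ y, if y ∈ xs then c y else
        k (T y - pv (fun y => if y ∈ xs then s y else T y) y)) *
          G (fun y => if y ∈ xs then s y else T y) := by
  intro xs
  induction xs with
  | nil => intro _ T _; simp [iterRes, hF]
  | cons x xs ih =>
    intro hsuf T hT
    obtain ⟨hx, hpx⟩ := hord x xs hsuf
    have ih := ih ((List.suffix_cons x xs).trans hsuf)
    set U : ι → ℂ := fun y => if y ∈ x :: xs then s y else T y with hU
    have hUx : U x = s x := by simp [hU]
    have hov : ∀ t, (fun y => if y ∈ xs then s y else Function.update T x t y) =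
        Function.update U x t := by
      intro t
      funext y
      by_cases hy : y = x
      · subst hy; simp [hx]
      · simp [hU, hy]
    have hUδ : ∀ t, ‖t - s x‖ < δ → ∀ y, ‖Function.update U x t y - s y‖ < δ := by
      intro t ht y
      by_cases hy : y = x
      · subst hy; simpa using ht
      · rw [Function.update_of_ne hy, hU]
        by_cases hy' : y ∈ x :: xs
        · simp [hy', hδ]
        · simpa [hy'] using (hT y hy').2
    have hUxs : ∀ y ∈ xs, U y = s y := fun y hy => by simp [hU, hy]
    rw [iterRes]
    set g : ℂ → ℂ := fun t => (∏ y ∈ Finset.univ.erase x, if y ∈ xs then c y else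
      k (T y - pv (Function.update U x t) y)) * G (Function.update U x t) with hg
    rw [residue_eq_of_mul (k := fun t => k (t - pv s x)) (g := g) (c := c x)]
    · rw [hg, ← Finset.mul_prod_erase Finset.univ _ (Finset.mem_univ x), if_pos (by simp), mul_assoc]
      have e : Function.update U x (s x) = U := by rw [← hUx, Function.update_eq_self]
      simp only [e]
      congr 2
      refine Finset.prod_congr rfl fun y hy => ?_
      have hy' : y ≠ x := Finset.ne_of_mem_erase hy
      simp [hy']
    · have : ∀ᶠ t in 𝓝 (s x), ‖t - s x‖ < δ := by
        filter_upwards [Metric.ball_mem_nhds (s x) hδ] with t ht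
        simpa [dist_eq_norm] using ht
      filter_upwards [nhdsWithin_le_nhds this, self_mem_nhdsWithin] with t ht hts
      have hts : t ≠ s x := hts
      rw [ih]
      · rw [hov t, hg, ← Finset.mul_prod_erase Finset.univ _ (Finset.mem_univ x), if_neg hx,
          Function.update_self, hpx U t hUxs, mul_assoc]
        congr 2
        refine Finset.prod_congr rfl fun y hy => ?_
        rw [Function.update_of_ne (Finset.ne_of_mem_erase hy)]
      · intro y hy
        by_cases hyx : y = x
        · subst hyx
          simpa [sub_eq_zero, hts] using ht
        · rw [Function.update_of_ne hyx]
          exact hT y (by simp [hyx, hy])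
    · have : ∀ᶠ t in 𝓝 (s x), ‖t - s x‖ < δ := by
        filter_upwards [Metric.ball_mem_nhds (s x) hδ] with t ht
        simpa [dist_eq_norm] using ht
      filter_upwards [nhdsWithin_le_nhds this, self_mem_nhdsWithin] with t ht hts
      have hts : t ≠ s x := hts
      have e : t - pv s x - (s x - pv s x) = t - s x := by ring
      refine (hk x (t - pv s x) ?_ ?_).fun_comp' t (by fun_prop)
      · rw [e]; simpa [sub_eq_zero] using hts
      · rwa [e]
    · exact hc x
    · have hupd : ∀ t, DifferentiableAt ℂ (fun t => Function.update U x t) t := by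
        intro t
        rw [differentiableAt_pi]
        intro y
        by_cases hy : y = x
        · subst hy; simp
        · simp [hy]
      have hGd : ∀ᶠ t in 𝓝 (s x), DifferentiableAt ℂ (fun t => G (Function.update U x t)) t := by
        filter_upwards [Metric.ball_mem_nhds (s x) hδ] with t ht
        exact (hG _ (hUδ t (by simpa [dist_eq_norm] using ht))).fun_comp' t (hupd t)
      have hkd : ∀ y ∈ Finset.univ.erase x, ∀ᶠ t in 𝓝 (s x), DifferentiableAt ℂ (fun t =>
          if y ∈ xs then c y else k (T y - pv (Function.update U x t) y)) t := by
        intro y hy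
        have hyx : y ≠ x := Finset.ne_of_mem_erase hy
        by_cases hyxs : y ∈ xs
        · simp [hyxs]
        simp only [hyxs, if_false]
        have hconst : ∀ a, (∀ t, pv (Function.update U x t) y = a) → ∀ᶠ t in 𝓝 (s x),
            DifferentiableAt ℂ (fun t => k (T y - pv (Function.update U x t) y)) t := by
          intro a ha
          simp [ha]
        rcases hpv y with ⟨a, ha⟩ | ⟨w, hw⟩
        · exact hconst a fun t => ha _
        by_cases hwx : w = x
        · subst hwx
          have hTy := hT y (by simp [hyx, hyxs])
          have hps : pv s y = s w := hw s
          simp only [hw, Function.update_self]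
          have hcont : ContinuousAt (fun t => ‖T y - t - (s y - s w)‖) (s w) := by fun_prop
          have e : T y - s w - (s y - s w) = T y - s y := by ring
          have h1 := hcont.eventually (lt_mem_nhds
            (show 0 < ‖T y - s w - (s y - s w)‖ by rw [e]; exact hTy.1))
          have h2 := hcont.eventually (gt_mem_nhds
            (show ‖T y - s w - (s y - s w)‖ < δ by rw [e]; exact hTy.2))
          filter_upwards [h1, h2] with t h1 h2
          exact (hk y (T y - t) (by rwa [hps]) (by rwa [hps])).fun_comp' t (by fun_prop)
        · exact hconst (U w) fun t => by rw [hw, Function.update_of_ne hwx]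
      filter_upwards [hGd, (Finset.eventually_all _).2 hkd] with t h1 h2
      exact (differentiableAt_prod h2).mul h1

end IterRes

theorem tendsto_resPhi_zero {κ : ℂ} (hκ : κ ≠ 0) {h : ℂ} (hh : ∀ m : ℤ, h ≠ m * κ) :
    Tendsto (fun x => x * phi κ h x) (𝓝[≠] 0) (𝓝 (resPhi κ h 0)) := by
  have h1 : Tendsto (fun x : ℂ => x / κ) (𝓝[≠] 0) (𝓝[≠] 0) := by
    refine tendsto_nhdsWithin_iff.2 ⟨?_, ?_⟩
    · have : Tendsto (fun x : ℂ => x / κ) (𝓝 0) (𝓝 (0 / κ)) := (continuous_id.div_const κ).tendsto 0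
      rw [zero_div] at this
      exact this.mono_left nhdsWithin_le_nhds
    · filter_upwards [self_mem_nhdsWithin] with x hx
      exact div_ne_zero hx hκ
  have h2 := Complex.tendsto_self_mul_Gamma_nhds_zero.comp h1
  have h3 : Tendsto (fun x : ℂ => Complex.Gamma ((h - x) / κ)) (𝓝[≠] 0)
      (𝓝 (Complex.Gamma (h / κ))) := by
    have hd : ContinuousAt Complex.Gamma ((h - 0) / κ) := by
      refine (Complex.differentiableAt_Gamma _ fun m e => ?_).continuousAt
      refine hh (-m) ?_
      rw [sub_zero, div_eq_iff hκ] at e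
      rw [e]; push_cast; rfl
    have := (hd.comp (f := fun x : ℂ => (h - x) / κ) (by fun_prop)).tendsto
    simp only [Function.comp_def, sub_zero] at this
    exact this.mono_left nhdsWithin_le_nhds
  have h4 := (h2.mul h3).const_mul κ
  have e : resPhi κ h 0 = κ * (1 * Complex.Gamma (h / κ)) := by
    rw [show (0 : ℤ) = ((0 : ℕ) : ℤ) by rfl, resPhi_natCast]; simp
  rw [e]
  refine h4.congr fun x => ?_
  simp only [phi, Function.comp_apply]
  field_simp

theorem tendsto_resPhi {κ : ℂ} (hκ : κ ≠ 0) {h : ℂ} (hh : ∀ m : ℤ, h ≠ m * κ) (m : ℤ) :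
    Tendsto (fun x => (x - m * κ) * phi κ h x) (𝓝[≠] (m * κ)) (𝓝 (resPhi κ h (-m))) := by
  -- the functional equation of `φ` carries the residue from one lattice point to the next
  have hshift : ∀ m : ℤ, Tendsto (fun x : ℂ => x + κ) (𝓝[≠] (m * κ)) (𝓝[≠] ((m + 1 : ℤ) * κ)) := by
    intro m
    refine tendsto_nhdsWithin_iff.2 ⟨?_, ?_⟩
    · have : Tendsto (fun x : ℂ => x + κ) (𝓝 (m * κ)) (𝓝 (m * κ + κ)) :=
        (continuous_id.add continuous_const).tendsto _
      rw [show ((m + 1 : ℤ) : ℂ) * κ = m * κ + κ by push_cast; ring]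
      exact this.mono_left nhdsWithin_le_nhds
    · filter_upwards [self_mem_nhdsWithin] with x hx e
      refine hx ?_
      have : x + κ = (m + 1 : ℤ) * κ := e
      push_cast at this
      rw [Set.mem_singleton_iff]; linear_combination this
  have hshift' : ∀ m : ℤ, Tendsto (fun x : ℂ => x - κ) (𝓝[≠] ((m + 1 : ℤ) * κ)) (𝓝[≠] (m * κ)) := by
    intro m
    refine tendsto_nhdsWithin_iff.2 ⟨?_, ?_⟩
    · have : Tendsto (fun x : ℂ => x - κ) (𝓝 ((m + 1 : ℤ) * κ)) (𝓝 ((m + 1 : ℤ) * κ - κ)) :=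
        (continuous_id.sub continuous_const).tendsto _
      rw [show ((m + 1 : ℤ) : ℂ) * κ - κ = m * κ by push_cast; ring] at this
      exact this.mono_left nhdsWithin_le_nhds
    · filter_upwards [self_mem_nhdsWithin] with x hx e
      refine hx ?_
      have : x - κ = m * κ := e
      push_cast
      rw [Set.mem_singleton_iff]; linear_combination this
  have hne : ∀ m : ℤ, ∀ᶠ x in 𝓝[≠] ((m : ℂ) * κ), x ≠ 0 := by
    intro m
    rcases eq_or_ne m 0 with rfl | hm
    · rw [Int.cast_zero, zero_mul]; exact self_mem_nhdsWithin
    · exact nhdsWithin_le_nhds (isOpen_ne.mem_nhds (mul_ne_zero (by exact_mod_cast hm) hκ))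
  have hne' : ∀ m : ℤ, ∀ᶠ x in 𝓝[≠] ((m : ℂ) * κ), h - x - κ ≠ 0 := by
    intro m
    have hc : ContinuousAt (fun x : ℂ => h - x - κ) (m * κ) := by fun_prop
    refine nhdsWithin_le_nhds (hc.eventually_ne fun e => hh (m + 1) ?_)
    push_cast; linear_combination e
  have hid : ∀ m : ℤ, Tendsto (fun x : ℂ => x) (𝓝[≠] ((m : ℂ) * κ)) (𝓝 (m * κ)) := fun m =>
    tendsto_id.mono_left nhdsWithin_le_nhds
  have hrec : ∀ m : ℤ, resPhi κ h (-m) * (m * κ) = resPhi κ h (-(m + 1)) * (h - m * κ - κ) := by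
    intro m
    have := resPhi_succ hκ (h := h) (fun m _ => hh m) (-(m + 1))
    rw [show -(m + 1) + 1 = -m by ring] at this
    push_cast at this
    linear_combination this
  induction m using Int.induction_on with
  | zero => simpa using tendsto_resPhi_zero hκ hh
  | succ m ih =>
    have h1 : Tendsto (fun x : ℂ => (h - x - κ)) (𝓝[≠] (((m : ℤ) : ℂ) * κ))
        (𝓝 (h - (m : ℤ) * κ - κ)) := ((hid m).const_sub h).sub_const κ
    have hz : h - ((m : ℤ) : ℂ) * κ - κ ≠ 0 := fun e => hh (m + 1) (by
      push_cast at e ⊢; linear_combination e)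
    have h2 := ((ih.mul (hid m)).div h1 hz).comp (hshift' m)
    have e : resPhi κ h (-(m : ℤ)) * ((m : ℤ) * κ) / (h - ((m : ℤ) : ℂ) * κ - κ) =
        resPhi κ h (-((m : ℤ) + 1)) := by
      rw [hrec, mul_div_cancel_right₀ _ hz]
    rw [e] at h2
    refine h2.congr' ?_
    have := (hshift' m).eventually ((hne m).and (hne' m))
    filter_upwards [this] with x hx
    have hp := phi_add hκ (h := h) hx.1 hx.2
    rw [sub_add_cancel] at hp
    simp only [Function.comp_apply, Pi.div_apply]
    rw [div_eq_iff hx.2]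
    push_cast
    linear_combination -(x - κ - (m : ℂ) * κ) * hp
  | pred m ih =>
    have hm : (((-(m : ℤ) - 1 : ℤ) : ℂ) * κ) ≠ 0 := by
      refine mul_ne_zero ?_ hκ
      exact_mod_cast (by omega : -(m : ℤ) - 1 ≠ 0)
    have hs := hshift (-(m : ℤ) - 1)
    rw [show -(m : ℤ) - 1 + 1 = -m by ring] at hs
    have h1 : Tendsto (fun x : ℂ => (h - x - κ)) (𝓝[≠] (((-(m : ℤ) - 1 : ℤ) : ℂ) * κ))
        (𝓝 (h - (-(m : ℤ) - 1 : ℤ) * κ - κ)) := ((hid _).const_sub h).sub_const κ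
    have h2 := ((ih.comp hs).mul h1).div (hid (-(m : ℤ) - 1)) hm
    have e := hrec (-(m : ℤ) - 1)
    rw [show -(-(m : ℤ) - 1 + 1) = - -(m : ℤ) by ring] at e
    rw [← e, mul_div_cancel_right₀ _ hm] at h2
    refine h2.congr' ?_
    filter_upwards [hne (-(m : ℤ) - 1), hne' (-(m : ℤ) - 1)] with x hx hx'
    have hp := phi_add hκ (h := h) hx hx'
    simp only [Function.comp_apply, Pi.div_apply]
    rw [div_eq_iff hx]
    push_cast
    linear_combination (x + κ + (m : ℂ) * κ) * hp

/-! ### The master function as a product over pairs of variables -/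

section

variable {M : ℕ} {lam : Fin (M + 1) → ℕ} {κ : ℂ}

theorem prod_prod_tridiagonal (P : Fin (M + 1) → Fin (M + 1) → ℂ)
    (hP : ∀ i j : Fin (M + 1), (i : ℕ) ≠ j → (j : ℕ) ≠ i + 1 → (i : ℕ) ≠ j + 1 → P i j = 1)
    (hlast : P (Fin.last M) (Fin.last M) = 1) :
    ∏ i, ∏ j, P i j =
      ∏ j : Fin M, P j.castSucc j.castSucc * (P j.castSucc j.succ * P j.succ j.castSucc) := by
  have hsplit : ∀ i j, P i j = (if i = j then P i j else 1) *
      ((if (j : ℕ) = i + 1 then P i j else 1) * (if (i : ℕ) = j + 1 then P i j else 1)) := by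
    intro i j
    by_cases h1 : i = j
    · subst h1; simp
    have h1' : (i : ℕ) ≠ j := fun e => h1 (Fin.ext e)
    by_cases h2 : (j : ℕ) = i + 1
    · rw [if_neg h1, if_pos h2, if_neg (by omega)]; simp
    by_cases h3 : (i : ℕ) = j + 1
    · rw [if_neg h1, if_neg h2, if_pos h3]; simp
    rw [if_neg h1, if_neg h2, if_neg h3, hP i j h1' h2 h3]; simp
  have hup : ∀ Q : Fin (M + 1) → Fin (M + 1) → ℂ,
      ∏ i : Fin (M + 1), ∏ j : Fin (M + 1), (if (j : ℕ) = i + 1 then Q i j else 1) = ∏ j : Fin M, Q j.castSucc j.succ := by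
    intro Q
    rw [Fin.prod_univ_castSucc]
    have : ∏ j : Fin (M + 1), (if (j : ℕ) = (Fin.last M : Fin (M + 1)) + 1 then
        Q (Fin.last M) j else 1) = 1 := by
      refine Finset.prod_eq_one fun j _ => if_neg ?_
      have := j.isLt
      simp; omega
    rw [this, mul_one]
    refine Finset.prod_congr rfl fun i _ => ?_
    rw [Finset.prod_eq_single i.succ]
    · simp
    · intro j _ hj
      refine if_neg fun e => hj (Fin.ext ?_)
      simpa using e
    · simp
  rw [Finset.prod_congr rfl fun i _ => Finset.prod_congr rfl fun j _ => hsplit i j]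
  simp only [Finset.prod_mul_distrib]
  rw [hup]
  rw [Finset.prod_comm (f := fun i j : Fin (M + 1) => if (i : ℕ) = j + 1 then P i j else 1),
    hup fun j i => P i j]
  congr 1
  rw [Fin.prod_univ_castSucc]
  simp [hlast]

theorem prod_vars (F : Vars lam → Vars lam → ℂ)
    (hfar : ∀ u w : Vars lam, (u.1 : ℕ) ≠ w.1 → (w.1 : ℕ) ≠ u.1 + 1 → (u.1 : ℕ) ≠ w.1 + 1 →
      F u w = 1)
    (htop : ∀ u w : Vars lam, u.1 = Fin.last M → w.1 = Fin.last M → F u w = 1) :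
    ∏ u, ∏ w, F u w = ∏ j : Fin M, ∏ a : Fin (psum lam j.castSucc),
      ((∏ b, F ⟨j.castSucc, a⟩ ⟨j.castSucc, b⟩) *
        ∏ c, F ⟨j.castSucc, a⟩ ⟨j.succ, c⟩ * F ⟨j.succ, c⟩ ⟨j.castSucc, a⟩) := by
  have h1 : ∏ u, ∏ w, F u w = ∏ i, ∏ j, ∏ a, ∏ b, F ⟨i, a⟩ ⟨j, b⟩ := by
    simp only [Fintype.prod_sigma]
    refine Finset.prod_congr rfl fun i _ => ?_
    rw [Finset.prod_comm]
  rw [h1, prod_prod_tridiagonal]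
  · refine Finset.prod_congr rfl fun j _ => ?_
    simp only [Finset.prod_mul_distrib]
    rw [Finset.prod_comm (f := fun (a : Fin (psum lam j.succ)) (b : Fin (psum lam j.castSucc)) =>
      F ⟨j.succ, a⟩ ⟨j.castSucc, b⟩)]
  · intro i j h1 h2 h3
    exact Finset.prod_eq_one fun a _ => Finset.prod_eq_one fun b _ => hfar _ _ h1 h2 h3
  · exact Finset.prod_eq_one fun a _ => Finset.prod_eq_one fun b _ => htop _ _ rfl rfl

/-- The value of a variable at the point `T`. -/
def varVal (T : TVar lam → ℂ) (z : Fin (size lam) → ℂ) (u : Vars lam) : ℂ := tz T z u.1 u.2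

/-- The factor of the master function for the pair of variables `u`, `w`. -/
def pairPhi (κ : ℂ) (T : TVar lam → ℂ) (z : Fin (size lam) → ℂ) (h : ℂ) (u w : Vars lam) : ℂ :=
  if (u.1 : ℕ) = w.1 then
    if u ≠ w ∧ (u.1 : ℕ) < M then
      1 / ((varVal T z u - varVal T z w - h) * phi κ h (varVal T z u - varVal T z w))
    else 1
  else if (w.1 : ℕ) = u.1 + 1 then phi κ h (varVal T z u - varVal T z w)
  else 1

theorem masterPhi_eq (T : TVar lam → ℂ) (z : Fin (size lam) → ℂ) (h : ℂ)
    (l : Fin (M + 1) → ℂ) :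
    masterPhi lam κ T z h l = expPart lam κ T z l * ∏ u, ∏ w, pairPhi κ T z h u w := by
  rw [prod_vars]
  · refine congrArg₂ (· * ·) rfl ?_
    refine Finset.prod_congr rfl fun j _ => Finset.prod_congr rfl fun a _ => ?_
    refine congrArg₂ (· * ·) ?_ ?_
    · rw [Finset.prod_filter]
      refine Finset.prod_congr rfl fun b _ => ?_
      simp only [pairPhi, varVal, if_true]
      by_cases hb : b = a
      · subst hb; simp
      · rw [if_pos hb, if_pos]
        refine ⟨?_, by simp⟩
        simpa [eq_comm] using hb
    · refine Finset.prod_congr rfl fun c _ => ?_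
      simp [pairPhi, varVal]
      omega
  · intro u w h1 h2 _
    rw [pairPhi, if_neg h1, if_neg h2]
  · intro u w h1 h2
    rw [pairPhi, if_pos (by rw [h1, h2]), if_neg]
    rintro ⟨-, h3⟩
    rw [h1] at h3; simp at h3

/-- The variable of the next colour with the same label. At the points `Σ_J + r κ`, the only factors
of the master function that can have a pole are the values of `φ` at the differences of a variable
and its parent. -/
def parent (J : Parts lam) (x : TVar lam) : Vars lam :=
  ⟨x.1.succ, (exists_pos_succ_eq J x.1 x.2).choose⟩

theorem label_parent (J : Parts lam) (x : TVar lam) :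
    label J (parent J x) = label J ⟨x.1.castSucc, x.2⟩ := (exists_pos_succ_eq J x.1 x.2).choose_spec

/-- `w` is the parent of `u`. -/
def IsEdge (J : Parts lam) (u w : Vars lam) : Prop :=
  (w.1 : ℕ) = u.1 + 1 ∧ label J u = label J w

theorem isEdge_castSucc_iff (J : Parts lam) (x : TVar lam) (w : Vars lam) :
    IsEdge J ⟨x.1.castSucc, x.2⟩ w ↔ w = parent J x := by
  constructor
  · rintro ⟨h1, h2⟩
    by_contra hne
    refine label_injective_of_col J (u := w) (w := parent J x) ?_ hne ?_
    · rw [h1]; simp [parent]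
    · rw [label_parent, h2]
  · rintro rfl
    exact ⟨by simp [parent], (label_parent J x).symm⟩

theorem not_isEdge_last (J : Parts lam) (a : Fin (psum lam (Fin.last M))) (w : Vars lam) :
    ¬ IsEdge J ⟨Fin.last M, a⟩ w := by
  rintro ⟨h1, -⟩
  have := w.1.isLt
  simp at h1; omega

open Classical in
theorem prod_isEdge (J : Parts lam) (A B : Vars lam → Vars lam → ℂ) :
    ∏ u : Vars lam, ∏ w : Vars lam, (if IsEdge J u w then A u w else B u w) =
      (∏ x : TVar lam, A ⟨x.1.castSucc, x.2⟩ (parent J x)) *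
        ∏ u : Vars lam, ∏ w : Vars lam, (if IsEdge J u w then 1 else B u w) := by
  have h1 : ∀ u w, (if IsEdge J u w then A u w else B u w) =
      (if IsEdge J u w then A u w else 1) * (if IsEdge J u w then 1 else B u w) := by
    intro u w
    split_ifs <;> simp
  simp_rw [h1]
  simp only [Finset.prod_mul_distrib]
  congr 1
  rw [Fintype.prod_sigma, Fintype.prod_sigma, Fin.prod_univ_castSucc]
  have h2 : ∏ a : Fin (psum lam (Fin.last M)), ∏ w : Vars lam, (if IsEdge J ⟨Fin.last M, a⟩ w then A ⟨Fin.last M, a⟩ w else 1) = 1 :=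
    Finset.prod_eq_one fun a _ => Finset.prod_eq_one fun w _ => if_neg (not_isEdge_last J a w)
  rw [h2, mul_one]
  refine Finset.prod_congr rfl fun i _ => Finset.prod_congr rfl fun a _ => ?_
  have h3 := fun w => isEdge_castSucc_iff J ⟨i, a⟩ w
  simp only at h3
  simp [h3]

open Classical in
/-- The master function without the factors `φ` of the pairs of a variable and its parent, which
carry the poles at `Σ_J + r κ`. -/
def regularPart (κ : ℂ) (J : Parts lam) (T : TVar lam → ℂ) (z : Fin (size lam) → ℂ) (h : ℂ)
    (l : Fin (M + 1) → ℂ) : ℂ :=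
  expPart lam κ T z l * ∏ u, ∏ w, if IsEdge J u w then 1 else pairPhi κ T z h u w

theorem masterPhi_eq_regularPart (J : Parts lam) (T : TVar lam → ℂ) (z : Fin (size lam) → ℂ)
    (h : ℂ) (l : Fin (M + 1) → ℂ) :
    masterPhi lam κ T z h l =
      (∏ x : TVar lam, phi κ h (T x - varVal T z (parent J x))) * regularPart κ J T z h l := by
  classical
  have h1 := prod_isEdge J (pairPhi κ T z h) (pairPhi κ T z h)
  simp only [ite_self] at h1
  rw [masterPhi_eq, h1, regularPart, mul_left_comm]
  refine congrArg₂ (· * ·) (Finset.prod_congr rfl fun x _ => ?_) rfl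
  rw [pairPhi, if_neg (by simp [parent]), if_pos (by simp [parent])]
  simp [varVal]

theorem varVal_latticePoint (J : Parts lam) (z : Fin (size lam) → ℂ) (r : TVar lam → ℤ)
    (u : Vars lam) :
    varVal (latticePoint κ J z r) z u = z (label J u) + shift r u.1 u.2 * κ :=
  tz_latticePoint J z 0 r u.1 u.2

theorem masterCoef_eq_regularPart (J : Parts lam) (z : Fin (size lam) → ℂ) (h : ℂ)
    (l : Fin (M + 1) → ℂ) (r : TVar lam → ℤ) :
    masterCoef κ J z h l r =
      (∏ x : TVar lam, resPhi κ h (-(r x - shift r (parent J x).1 (parent J x).2))) *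
        regularPart κ J (latticePoint κ J z r) z h l := by
  classical
  have h1 := prod_isEdge J (pairCoef κ J z h r) (pairCoef κ J z h r)
  simp only [ite_self] at h1
  rw [masterCoef, h1, regularPart, mul_left_comm]
  congr 1
  · refine Finset.prod_congr rfl fun x _ => ?_
    rw [pairCoef, if_neg (by simp [parent]), if_pos (by simp [parent]), hop,
      if_pos (label_parent J x).symm]
    simp
  · congr 1
    refine Finset.prod_congr rfl fun u _ => Finset.prod_congr rfl fun w _ => ?_
    split_ifs with he
    · rfl
    · have hd : varVal (latticePoint κ J z r) z u - varVal (latticePoint κ J z r) z w =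
          z (label J u) - z (label J w) + (shift r u.1 u.2 - shift r w.1 w.2 : ℤ) * κ := by
        rw [varVal_latticePoint, varVal_latticePoint]; push_cast; ring
      rw [pairCoef, pairPhi, hd]
      by_cases h1 : (u.1 : ℕ) = w.1
      · rw [if_pos h1, if_pos h1]
      · rw [if_neg h1, if_neg h1]
        by_cases h2 : (w.1 : ℕ) = u.1 + 1
        · rw [if_pos h2, if_pos h2, hop, if_neg fun e => he ⟨h2, e⟩]
        · rw [if_neg h2, if_neg h2]

end

/-! ### The weight functions as sums over orderings of the variables -/

section

variable {M : ℕ} {lam : Fin (M + 1) → ℕ} {κ : ℂ}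

/-- The coloured variables with their values at an arbitrary point `T`. -/
def pointVars (z : Fin (size lam) → ℂ) (h : ℂ) : ColoredVars (TVar lam → ℂ) (Vars lam) where
  col v := v.1
  top := M
  val T v := varVal T z v
  h := h

theorem kernel_latticeVars_eq (J : Parts lam) (z : Fin (size lam) → ℂ) (h : ℂ) (r : TVar lam → ℤ)
    (u w : Vars lam) :
    (latticeVars κ J z h).kernel r u w = (pointVars z h).kernel (latticePoint κ J z r) u w := by
  have hv : ∀ u, (pointVars z h).val (latticePoint κ J z r) u = (latticeVars κ J z h).val r u :=
    fun u => tz_latticePoint J z h r u.1 u.2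
  unfold ColoredVars.kernel
  rw [hv, hv]
  rfl

/-- The permutation of all variables which fixes the `z_a` and acts as `σ` on the others. -/
def permVars (σ : (k : Fin M) → Equiv.Perm (Fin (psum lam k.castSucc))) : Equiv.Perm (Vars lam) :=
  Equiv.sigmaCongrRight fun k => Fin.lastCases
    (motive := fun k => Equiv.Perm (Fin (psum lam k))) (Equiv.refl _) σ k

variable (σ : (k : Fin M) → Equiv.Perm (Fin (psum lam k.castSucc)))

theorem permVars_castSucc (k : Fin M) (a : Fin (psum lam k.castSucc)) :
    permVars σ ⟨k.castSucc, a⟩ = ⟨k.castSucc, σ k a⟩ := by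
  simp [permVars, Equiv.sigmaCongrRight]

theorem permVars_last (a : Fin (psum lam (Fin.last M))) :
    permVars σ ⟨Fin.last M, a⟩ = ⟨Fin.last M, a⟩ := by
  simp [permVars, Equiv.sigmaCongrRight]

theorem varVal_perm (T : TVar lam → ℂ) (z : Fin (size lam) → ℂ) (u : Vars lam) :
    varVal (fun x => T ⟨x.1, σ x.1 x.2⟩) z u = varVal T z (permVars σ u) := by
  obtain ⟨k, a⟩ := u
  induction k using Fin.lastCases with
  | last => rw [permVars_last]; simp [varVal]
  | cast i => rw [permVars_castSucc]; simp [varVal]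

theorem weightU_eq (I : Parts lam) (T : TVar lam → ℂ) (z : Fin (size lam) → ℂ) (h : ℂ) :
    weightU I T z h = ∏ u, ∏ w, if label I u < label I w then (pointVars z h).kernel T u w else 1 := by
  have hcol : ∀ y : Vars lam, (pointVars z h).col y = y.1 := fun _ => rfl
  rw [prod_vars]
  · refine Finset.prod_congr rfl fun j _ => Finset.prod_congr rfl fun a _ => ?_
    rw [mul_comm]
    refine congrArg₂ (· * ·) ?_ ?_
    · rw [Finset.prod_filter]
      refine Finset.prod_congr rfl fun b _ => ?_
      have hl : label I ⟨j.castSucc, a⟩ < label I ⟨j.castSucc, b⟩ ↔ a < b :=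
        (pos I j.castSucc).lt_iff_lt
      simp only [hl]
      rw [ColoredVars.kernel_same (pointVars z h) (u := ⟨j.castSucc, a⟩) (w := ⟨j.castSucc, b⟩) rfl
        (show (j.castSucc : ℕ) < M by simp)]
      rfl
    · rw [Finset.prod_filter, Finset.prod_filter, ← Finset.prod_mul_distrib]
      refine Finset.prod_congr rfl fun c _ => ?_
      rw [ColoredVars.kernel_up _ (by rw [hcol, hcol]; simp),
        ColoredVars.kernel_down _ (by rw [hcol, hcol]; simp), mul_comm]
      rfl
  · intro u w h1 h2 h3
    rw [ColoredVars.kernel_far _ h2 h3 fun e => absurd e h1, ite_self]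
  · intro u w h1 h2
    rw [ColoredVars.kernel_far, ite_self]
    · rw [hcol, hcol, h1, h2]; omega
    · rw [hcol, hcol, h1, h2]; omega
    · intro _; rw [hcol, h1]; exact le_rfl

/-- The symmetrization, with the permutations moved from the variables to the order in which they
are arranged. -/
theorem weightW_eq (I : Parts lam) (T : TVar lam → ℂ) (z : Fin (size lam) → ℂ) (h : ℂ) :
    weightW I T z h = ∑ σ : (k : Fin M) → Equiv.Perm (Fin (psum lam k.castSucc)),
      ∏ u, ∏ w, if label I ((permVars σ).symm u) < label I ((permVars σ).symm w) then
        (pointVars z h).kernel T u w else 1 := by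
  rw [weightW]
  refine Finset.sum_congr rfl fun σ _ => ?_
  rw [weightU_eq, eq_comm, ← Equiv.prod_comp (permVars σ)]
  refine Finset.prod_congr rfl fun u _ => ?_
  rw [← Equiv.prod_comp (permVars σ)]
  refine Finset.prod_congr rfl fun w _ => ?_
  rw [Equiv.symm_apply_apply, Equiv.symm_apply_apply, eq_comm]
  congr 1
  unfold ColoredVars.kernel
  have hv : ∀ u, (pointVars z h).val (fun x => T ⟨x.1, σ x.1 x.2⟩) u =
    (pointVars z h).val T (permVars σ u) := varVal_perm σ T z
  rw [hv, hv]
  rfl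

/-- The tensor position to which each variable is attached in the term of `W_I` with
permutation `σ`. -/
def ordering (I : Parts lam) (σ : (k : Fin M) → Equiv.Perm (Fin (psum lam k.castSucc))) :
    Vars lam → Fin (size lam) := fun u => label I ((permVars σ).symm u)

end

namespace Shuffle

variable {X V : Type*} [Fintype V] [DecidableEq V] {ω : X → V → V → ℂ}

open Classical in
/-- The value of a product on `S` is a sum over the ways `γ` to distribute `S` among the factors.
A total function `γ` is used for the distribution, with the value `d` outside `S`. -/
theorem list_prod_apply {ι : Type*} [LinearOrder ι] (d : ι) (f : ι → Shuffle ω) (x : X)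
    (L : List ι) (hL : L.Pairwise (· < ·)) (S : Finset V) :
    (L.map f).prod x S =
      ∑ γ ∈ Fintype.piFinset (fun v => if v ∈ S then L.toFinset else {d}),
        (∏ b ∈ L.toFinset, f b x (S.filter fun v => γ v = b)) *
          ∏ u ∈ S, ∏ w ∈ S, if γ u < γ w then ω x u w else 1 := by
  induction L generalizing S with
  | nil =>
    rw [List.map_nil, List.prod_nil, one_apply]
    split_ifs with hS
    · subst hS
      simp
    · obtain ⟨v, hv⟩ := Finset.nonempty_iff_ne_empty.2 hS
      rw [Finset.sum_eq_zero]
      intro γ hγ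
      have := Fintype.mem_piFinset.1 hγ v
      simp [hv] at this
  | cons a L ih =>
    rw [List.pairwise_cons] at hL
    have haL : a ∉ L.toFinset := fun h => lt_irrefl _ (hL.1 a (List.mem_toFinset.1 h))
    rw [List.map_cons, List.prod_cons, mul_apply]
    simp_rw [ih hL.2, Finset.mul_sum]
    rw [Finset.sum_sigma']
    -- a distribution among `a :: L` is the part given to `a` and a distribution of the rest
    refine Finset.sum_bij' (fun y _ v => if v ∈ y.1 then a else y.2 v)
      (fun γ _ => ⟨S.filter fun v => γ v = a, fun v => if v ∈ S ∧ γ v = a then d else γ v⟩)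
      ?_ ?_ ?_ ?_ ?_
    · rintro ⟨A, γ⟩ h
      simp only [Finset.mem_sigma, Finset.mem_powerset, Fintype.mem_piFinset, Finset.mem_sdiff] at h ⊢
      intro v
      have h2 := h.2 v
      by_cases hA : v ∈ A
      · simp [hA, h.1 hA]
      · by_cases hS : v ∈ S
        · simp only [hA, hS, if_false, if_true, not_false_eq_true, and_self, List.toFinset_cons,
            Finset.mem_insert] at h2 ⊢
          exact Or.inr h2
        · simpa [hA, hS] using h2
    · intro γ h
      simp only [Finset.mem_sigma, Finset.mem_powerset, Fintype.mem_piFinset, Finset.mem_sdiff,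
        Finset.mem_filter] at h ⊢
      refine ⟨Finset.filter_subset _ _, fun v => ?_⟩
      have h2 := h v
      by_cases hS : v ∈ S
      · by_cases hv : γ v = a
        · simp [hS, hv]
        · simpa [hS, hv] using h2
      · simpa [hS] using h2
    · rintro ⟨A, γ⟩ h
      simp only [Finset.mem_sigma, Finset.mem_powerset, Fintype.mem_piFinset, Finset.mem_sdiff] at h
      have hγ : ∀ v ∈ S, v ∉ A → γ v ≠ a := by
        intro v hS hA e
        have := h.2 v
        simp only [hS, hA, not_false_eq_true, and_self, if_true] at this
        exact haL (e ▸ this)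
      have hd : ∀ v ∈ A, γ v = d := by
        intro v hA
        simpa [hA] using h.2 v
      have e1 : (S.filter fun v => (if v ∈ A then a else γ v) = a) = A := by
        ext v
        simp only [Finset.mem_filter]
        by_cases hA : v ∈ A
        · simp [hA, h.1 hA]
        · simp only [hA, if_false, iff_false, not_and]
          exact fun hS => hγ v hS hA
      refine Sigma.ext e1 (heq_of_eq ?_)
      funext v
      by_cases hA : v ∈ A
      · simp [hA, h.1 hA, hd v hA]
      · by_cases hS : v ∈ S
        · simp [hA, hS, hγ v hS hA]
        · simp [hA, hS]
    · intro γ h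
      funext v
      simp only [Finset.mem_filter]
      split_ifs with h1
      · exact h1.2.symm
      · rfl
    · rintro ⟨A, γ⟩ h
      simp only [Finset.mem_sigma, Finset.mem_powerset, Fintype.mem_piFinset, Finset.mem_sdiff] at h
      have hL' : ∀ v ∈ S, v ∉ A → γ v ∈ L := by
        intro v hS hA
        have := h.2 v
        simpa only [hS, hA, not_false_eq_true, and_self, if_true, List.mem_toFinset] using this
      have hγ : ∀ v ∈ S, v ∉ A → γ v ≠ a := fun v hS hA e =>
        haL (List.mem_toFinset.2 (e ▸ hL' v hS hA))
      have e1 : (S.filter fun v => (if v ∈ A then a else γ v) = a) = A := by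
        ext v
        simp only [Finset.mem_filter]
        by_cases hA : v ∈ A
        · simp [hA, h.1 hA]
        · simp only [hA, if_false, iff_false, not_and]
          exact fun hS => hγ v hS hA
      have e2 : ∀ b ∈ L.toFinset, (S.filter fun v => (if v ∈ A then a else γ v) = b) =
          (S \ A).filter fun v => γ v = b := by
        intro b hb
        ext v
        simp only [Finset.mem_filter, Finset.mem_sdiff]
        by_cases hA : v ∈ A
        · have : a ≠ b := fun e => haL (e ▸ hb)
          simp [hA, this]
        · simp [hA]
      have hsplit : ∀ g : V → ℂ, ∏ u ∈ S, g u = (∏ u ∈ A, g u) * ∏ u ∈ S \ A, g u := fun g => by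
        rw [mul_comm, Finset.prod_sdiff h.1]
      have e2' : (∏ b ∈ L.toFinset, f b x (S.filter fun v => (if v ∈ A then a else γ v) = b)) =
          ∏ b ∈ L.toFinset, f b x ((S \ A).filter fun v => γ v = b) :=
        Finset.prod_congr rfl fun b hb => by rw [e2 b hb]
      simp only
      rw [List.toFinset_cons, Finset.prod_insert haL, e1, e2', hsplit]
      have e3 : (∏ u ∈ A, ∏ w ∈ S, if (if u ∈ A then a else γ u) < (if w ∈ A then a else γ w) then
          ω x u w else 1) = cross ω x A (S \ A) := by
        rw [cross]
        refine Finset.prod_congr rfl fun u hu => ?_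
        rw [hsplit, Finset.prod_eq_one fun w hw => ?_, one_mul]
        · refine Finset.prod_congr rfl fun w hw => ?_
          rw [Finset.mem_sdiff] at hw
          simp [hu, hw.2, hL.1 _ (hL' w hw.1 hw.2)]
        · simp [hu, hw]
      have e4 : (∏ u ∈ S \ A, ∏ w ∈ S, if (if u ∈ A then a else γ u) < (if w ∈ A then a else γ w) then
          ω x u w else 1) = ∏ u ∈ S \ A, ∏ w ∈ S \ A, if γ u < γ w then ω x u w else 1 := by
        refine Finset.prod_congr rfl fun u hu => ?_
        rw [Finset.mem_sdiff] at hu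
        rw [hsplit, Finset.prod_eq_one fun w hw => ?_, one_mul]
        · refine Finset.prod_congr rfl fun w hw => ?_
          rw [Finset.mem_sdiff] at hw
          simp [hu.2, hw.2]
        · have := (hL.1 _ (hL' u hu.1 hu.2)).not_gt
          simp [hu.2, hw, this]
      rw [e3, e4]
      ring

end Shuffle

/-! ### The weight functions as words of site vectors -/

section

variable {M : ℕ} {lam : Fin (M + 1) → ℕ} {κ : ℂ}

theorem psum_le_size (k : Fin (M + 1)) : psum lam k ≤ size lam :=
  Finset.sum_le_sum_of_subset (Finset.subset_univ _)

open Classical in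
theorem siteWord_univ (J : Parts lam) (z : Fin (size lam) → ℂ) (h : ℂ)
    (p : Fin (size lam) → ℕ) (r : TVar lam → ℤ) :
    siteWord κ J z h p r Finset.univ = ∑ γ : Vars lam → Fin (size lam),
      (∏ b, (latticeVars κ J z h).site (zVar b) (p b) r (Finset.univ.filter fun v => γ v = b)) *
        ∏ u, ∏ w, if γ u < γ w then (latticeVars κ J z h).kernel r u w else 1 := by
  by_cases hn : Nonempty (Fin (size lam))
  · obtain ⟨d⟩ := hn
    have := Shuffle.list_prod_apply d (fun b => (latticeVars κ J z h).site (zVar b) (p b)) r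
      (List.finRange (size lam)) (List.pairwise_lt_finRange _) Finset.univ
    rw [siteWord, ColoredVars.word, this, List.toFinset_finRange]
    simp
  · have h0 : IsEmpty (Fin (size lam)) := not_nonempty_iff.1 hn
    have h1 : IsEmpty (Vars lam) := ⟨fun v => h0.elim (Fin.castLE (psum_le_size v.1) v.2)⟩
    have h2 : List.finRange (size lam) = [] := List.eq_nil_iff_forall_not_mem.2 fun b => h0.elim b
    rw [siteWord, h2, ColoredVars.word_nil, Shuffle.one_apply, if_pos (Finset.univ_eq_empty)]
    simp

section Fibers

variable {J : Parts lam} {z : Fin (size lam) → ℂ} {h : ℂ} {γ : Vars lam → Fin (size lam)}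
  {p : Fin (size lam) → Fin (M + 1)}
  (hγ : ∀ b, (latticeVars κ J z h).IsSeg (zVar b) (p b) (Finset.univ.filter fun v => γ v = b))
include hγ

theorem injective_of_isSeg (k : Fin (M + 1)) : Function.Injective fun a => γ ⟨k, a⟩ := by
  intro a a' e
  have e : γ ⟨k, a⟩ = γ ⟨k, a'⟩ := e
  have := (hγ (γ ⟨k, a⟩)).eq_of_col (v := ⟨k, a⟩) (w := ⟨k, a'⟩) (by simp) (by simp [e]) rfl
  simpa using this

theorem le_of_isSeg (u : Vars lam) : p (γ u) ≤ u.1 :=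
  ((hγ (γ u)).le_col (v := u) (by simp)).1

theorem exists_of_isSeg {b : Fin (size lam)} {k : Fin (M + 1)} (hb : p b ≤ k) :
    ∃ a, γ ⟨k, a⟩ = b := by
  obtain ⟨⟨k', a⟩, hv, hk⟩ := (hγ b).exists_col (k := k) hb (Nat.lt_succ_iff.1 k.isLt)
  obtain rfl : k' = k := Fin.ext hk
  exact ⟨a, by simpa using hv⟩

theorem apply_zVar_of_isSeg (b : Fin (size lam)) : γ (zVar b) = b := by
  simpa using (hγ b).2

theorem card_of_isSeg (k : Fin (M + 1)) :
    (Finset.univ.filter fun b => p b ≤ k).card = psum lam k := by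
  have : (Finset.univ.filter fun b => p b ≤ k) = Finset.univ.image fun a => γ ⟨k, a⟩ := by
    ext b
    simp only [Finset.mem_filter, Finset.mem_univ, true_and, Finset.mem_image]
    exact ⟨exists_of_isSeg hγ, fun ⟨a, ha⟩ => ha ▸ le_of_isSeg hγ ⟨k, a⟩⟩
  rw [this, Finset.card_image_of_injective _ (injective_of_isSeg hγ k), Finset.card_univ,
    Fintype.card_fin]

/-- The letters of a word whose sites can be filled by all the variables have the right
multiplicities, as the variables of each colour are used up. -/
theorem mem_parts_of_isSeg (j : Fin (M + 1)) :
    (Finset.univ.filter fun a => p a = j).card = lam j := by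
  have hsum : ∀ k, ∑ i ∈ Finset.Iic k, (Finset.univ.filter fun a => p a = i).card =
      ∑ i ∈ Finset.Iic k, lam i := by
    intro k
    rw [show ∑ i ∈ Finset.Iic k, lam i = psum lam k from rfl, ← card_of_isSeg hγ k, Finset.card_eq_sum_card_fiberwise
      (s := Finset.univ.filter fun b => p b ≤ k) (f := p) (t := Finset.Iic k)
      (by intro a ha; simpa using ha)]
    refine Finset.sum_congr rfl fun i hi => ?_
    congr 1
    ext a
    simp only [Finset.mem_filter, Finset.mem_univ, true_and]
    exact ⟨fun e => ⟨by rw [e]; simpa using hi, e⟩, fun e => e.2⟩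
  induction j using WellFoundedLT.induction with
  | ind j ih =>
    have h1 := hsum j
    rw [← Finset.Iio_insert, Finset.sum_insert (by simp), Finset.sum_insert (by simp),
      Finset.sum_congr rfl fun i hi => ih i (Finset.mem_Iio.1 hi)] at h1
    exact Nat.add_right_cancel h1

omit hγ in
theorem exists_ordering_of_isSeg {I : Parts lam} (hγ : ∀ b, (latticeVars κ J z h).IsSeg (zVar b)
    (I.1 b) (Finset.univ.filter fun v => γ v = b)) : ∃ σ, ordering I σ = γ := by
  have h1 : ∀ (k : Fin M) (a : Fin (psum lam k.castSucc)), ∃ c, pos I k.castSucc c =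
      γ ⟨k.castSucc, a⟩ := by
    intro k a
    have h3 : γ ⟨k.castSucc, a⟩ ∈ Set.range (pos I k.castSucc) := by
      rw [pos, Finset.range_orderEmbOfFin]
      simp only [blockUnion, Finset.coe_filter, Finset.mem_univ, true_and]
      exact le_of_isSeg hγ ⟨k.castSucc, a⟩
    exact h3
  choose c hc using h1
  have hinj : ∀ k, Function.Injective (c k) := by
    intro k a a' e
    refine injective_of_isSeg hγ k.castSucc ?_
    simp only
    rw [← hc, ← hc, e]
  refine ⟨fun k => (Equiv.ofBijective (c k) (Finite.injective_iff_bijective.1 (hinj k))).symm, ?_⟩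
  funext ⟨k, a⟩
  induction k using Fin.lastCases with
  | last =>
    rw [ordering, (Equiv.symm_apply_eq _).2 (permVars_last _ a).symm]
    have := apply_zVar_of_isSeg hγ (Fin.cast (psum_last lam) a)
    exact (pos_last I a).trans this.symm
  | cast i =>
    rw [ordering, (Equiv.symm_apply_eq (y := ⟨i.castSucc, c i a⟩) _).2]
    · exact hc i a
    · rw [permVars_castSucc]
      congr 1
      exact (Equiv.symm_apply_apply (Equiv.ofBijective (c i) _) a).symm

end Fibers

theorem ordering_zVar (I : Parts lam) (σ) (b : Fin (size lam)) : ordering I σ (zVar b) = b := by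
  rw [ordering, zVar, (Equiv.symm_apply_eq _).2 (permVars_last _ _).symm]
  exact label_zVar I b

theorem ordering_castSucc (I : Parts lam) (σ : (k : Fin M) → Equiv.Perm (Fin (psum lam k.castSucc)))
    (k : Fin M) (a : Fin (psum lam k.castSucc)) :
    ordering I σ ⟨k.castSucc, a⟩ = pos I k.castSucc ((σ k).symm a) := by
  rw [ordering, (Equiv.symm_apply_eq (y := ⟨k.castSucc, (σ k).symm a⟩) _).2]
  · rfl
  · rw [permVars_castSucc, Equiv.apply_symm_apply]

theorem ordering_injective (I : Parts lam) : Function.Injective (ordering I) := by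
  intro σ σ' e
  funext k
  have : (σ k).symm = (σ' k).symm := by
    ext a
    have := congrFun e ⟨k.castSucc, a⟩
    rw [ordering_castSucc, ordering_castSucc] at this
    rw [(pos I k.castSucc).injective this]
  rw [← Equiv.symm_symm (σ k), this, Equiv.symm_symm]

theorem isSeg_ordering (I J : Parts lam) (z : Fin (size lam) → ℂ) (h : ℂ) (σ) (b : Fin (size lam)) :
    (latticeVars κ J z h).IsSeg (zVar b) (I.1 b)
      (Finset.univ.filter fun v => ordering I σ v = b) := by
  have hmem : ∀ u : Vars lam, ordering I σ u ∈ blockUnion I u.1 := fun u =>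
    Finset.orderEmbOfFin_mem _ _ ((permVars σ).symm u).2
  refine ColoredVars.IsSeg.of_forall ?_ ?_ ?_ ?_
  · intro v hv
    have h1 := hmem v
    simp only [Finset.mem_filter, Finset.mem_univ, true_and] at hv
    rw [hv] at h1
    simp only [blockUnion, Finset.mem_filter, Finset.mem_univ, true_and] at h1
    exact ⟨h1, Nat.lt_succ_iff.1 v.1.isLt⟩
  · intro v hv w hw e
    simp only [Finset.mem_filter, Finset.mem_univ, true_and] at hv hw
    by_contra hne
    exact label_injective_of_col I (u := (permVars σ).symm v) (w := (permVars σ).symm w) e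
      (fun e => hne ((permVars σ).symm.injective e)) (hv.trans hw.symm)
  · intro k h1 h2
    have h3 : b ∈ Set.range (pos I ⟨k, Nat.lt_succ_iff.2 h2⟩) := by
      rw [pos, Finset.range_orderEmbOfFin]
      simp only [blockUnion, Finset.coe_filter, Finset.mem_univ, true_and]
      exact Fin.le_def.2 h1
    obtain ⟨c, hc⟩ := h3
    refine ⟨permVars σ ⟨_, c⟩, ?_, rfl⟩
    simp only [Finset.mem_filter, Finset.mem_univ, true_and]
    rw [ordering, Equiv.symm_apply_apply]
    exact hc
  · simpa using ordering_zVar I σ b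

/-- At the lattice points the weight function is the value of a product of site vectors on the set
of all variables: the orderings of the variables in the terms of `W_I` are the ways to split them
into segments with the letters of `I`. -/
theorem weightW_latticePoint (I J : Parts lam) (z : Fin (size lam) → ℂ) (h : ℂ)
    (r : TVar lam → ℤ) :
    weightW I (latticePoint κ J z r) z h =
      siteWord κ J z h (fun a => (I.1 a : ℕ)) r Finset.univ := by
  classical
  rw [weightW_eq, siteWord_univ]
  refine Fintype.sum_of_injective (ordering I) (ordering_injective I) _ _ ?_ ?_
  · intro γ hγ
    have : ∃ b, ¬ (latticeVars κ J z h).IsSeg (zVar b) (I.1 b)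
        (Finset.univ.filter fun v => γ v = b) := by
      by_contra! hall
      exact hγ (exists_ordering_of_isSeg hall)
    obtain ⟨b, hb⟩ := this
    rw [Finset.prod_eq_zero (Finset.mem_univ b) (ColoredVars.site_of_not_isSeg hb r), zero_mul]
  · intro σ
    rw [Finset.prod_eq_one fun b _ => ColoredVars.site_of_isSeg (isSeg_ordering I J z h σ b) r,
      one_mul]
    refine Finset.prod_congr rfl fun u _ => Finset.prod_congr rfl fun w _ => ?_
    rw [kernel_latticeVars_eq]
    rfl

theorem siteWord_univ_eq_zero (J : Parts lam) (z : Fin (size lam) → ℂ) (h : ℂ)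
    (r : TVar lam → ℤ) {p : Fin (size lam) → Fin (M + 1)}
    (hp : ¬ ∀ j, (Finset.univ.filter fun a => p a = j).card = lam j) :
    siteWord κ J z h (fun a => (p a : ℕ)) r Finset.univ = 0 := by
  classical
  rw [siteWord_univ]
  refine Finset.sum_eq_zero fun γ _ => ?_
  have : ∃ b, ¬ (latticeVars κ J z h).IsSeg (zVar b) (p b)
      (Finset.univ.filter fun v => γ v = b) := by
    by_contra! hall
    exact hp (mem_parts_of_isSeg hall)
  obtain ⟨b, hb⟩ := this
  rw [Finset.prod_eq_zero (Finset.mem_univ b) (ColoredVars.site_of_not_isSeg hb r), zero_mul]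

end

/-! ### The residues of the integrand -/

section

variable {M : ℕ} {lam : Fin (M + 1) → ℕ} {κ : ℂ}

theorem mem_varList (x : TVar lam) : x ∈ varList lam := by
  simp only [varList, List.mem_flatMap, List.mem_map, List.mem_finRange, true_and]
  exact ⟨x.1, x.2, rfl⟩

theorem pairwise_varList : (varList lam).Pairwise fun x y => x.1 ≤ y.1 ∧ x ≠ y := by
  rw [varList, List.pairwise_flatMap]
  refine ⟨fun k _ => ?_, ?_⟩
  · rw [List.pairwise_map]
    refine (List.pairwise_lt_finRange _).imp fun {a b} hab => ⟨le_rfl, fun e => hab.ne ?_⟩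
    simpa using e
  · refine (List.pairwise_lt_finRange _).imp fun {k k'} hk x hx y hy => ?_
    simp only [List.mem_map, List.mem_finRange, true_and] at hx hy
    obtain ⟨a, rfl⟩ := hx
    obtain ⟨b, rfl⟩ := hy
    exact ⟨hk.le, fun e => hk.ne (congrArg Sigma.fst e)⟩

theorem suffix_varList {x : TVar lam} {xs : List (TVar lam)} (h : x :: xs <:+ varList lam) :
    x ∉ xs ∧ ∀ y : TVar lam, x.1 < y.1 → y ∈ xs := by
  obtain ⟨pre, hpre⟩ := h
  have hp := pairwise_varList (lam := lam)
  rw [← hpre, List.pairwise_append, List.pairwise_cons] at hp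
  refine ⟨fun hx => (hp.2.1.1 x hx).2 rfl, fun y hy => ?_⟩
  have hmem := mem_varList y
  rw [← hpre, List.mem_append, List.mem_cons] at hmem
  rcases hmem with hm | rfl | hm
  · exact absurd (hp.2.2 y hm x (by simp)).1 hy.not_ge
  · exact absurd hy (lt_irrefl _)
  · exact hm

theorem continuous_varVal (z : Fin (size lam) → ℂ) (u : Vars lam) :
    Continuous fun T => varVal T z u := by
  obtain ⟨k, a⟩ := u
  induction k using Fin.lastCases with
  | last => simpa [varVal] using continuous_const
  | cast i => simpa [varVal] using continuous_apply _

theorem differentiableAt_varVal (z : Fin (size lam) → ℂ) (u : Vars lam) (T : TVar lam → ℂ) :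
    DifferentiableAt ℂ (fun T => varVal T z u) T :=
  differentiableAt_tz differentiableAt_id (differentiableAt_const _) _ _

section

variable {J : Parts lam} {z : Fin (size lam) → ℂ} {h : ℂ} {T : TVar lam → ℂ}

theorem differentiableAt_regularPart (hκ : κ ≠ 0) (l : Fin (M + 1) → ℂ)
    (h1 : ∀ u w : Vars lam, label J u ≠ label J w → OffLattice κ (varVal T z u - varVal T z w))
    (h2 : ∀ u w : Vars lam, label J u ≠ label J w →
      OffLattice κ (h - (varVal T z u - varVal T z w))) :
    DifferentiableAt ℂ (fun T => regularPart κ J T z h l) T := by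
  unfold regularPart
  refine (differentiableAt_expPart differentiableAt_id (differentiableAt_const _)
    (differentiableAt_const _)).mul
    (differentiableAt_prod fun u _ => differentiableAt_prod fun w _ => ?_)
  have hx : DifferentiableAt ℂ (fun T => varVal T z u - varVal T z w) T :=
    (differentiableAt_varVal z u T).sub (differentiableAt_varVal z w T)
  have hphi : label J u ≠ label J w →
      DifferentiableAt ℂ (fun T => phi κ h (varVal T z u - varVal T z w)) T := fun hne =>
    differentiableAt_phi hκ (differentiableAt_const h) hx (fun m => by simpa using h1 u w hne (-m))
      (fun m => by simpa using h2 u w hne (-m))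
  unfold pairPhi
  split_ifs with he h3 h4 h5
  · exact differentiableAt_const _
  · have hne := label_injective_of_col J h3 h4.1
    simp only [one_div]
    refine DifferentiableAt.fun_inv ((hx.sub (differentiableAt_const h)).mul (hphi hne))
      (mul_ne_zero ?_ (phi_ne_zero hκ (h1 u w hne) (h2 u w hne)))
    have := (h2 u w hne).neg.ne_zero
    rwa [neg_sub] at this
  · exact differentiableAt_const _
  · exact hphi fun e => he ⟨h5, e⟩
  · exact differentiableAt_const _

theorem differentiableAt_weightW (I : Parts lam)
    (h1 : ∀ u w : Vars lam, (u.1 : ℕ) = w.1 → u ≠ w → varVal T z u ≠ varVal T z w) :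
    DifferentiableAt ℂ (fun T => weightW I T z h) T := by
  simp only [weightW_eq]
  refine DifferentiableAt.fun_sum fun σ _ => differentiableAt_prod fun u _ =>
    differentiableAt_prod fun w _ => ?_
  split_ifs with hlt
  · have hu := differentiableAt_varVal z u T
    have hw := differentiableAt_varVal z w T
    change DifferentiableAt ℂ (fun T => if (w.1 : ℕ) = u.1 + 1 then varVal T z u - varVal T z w - h
      else if (u.1 : ℕ) = w.1 + 1 then varVal T z w - varVal T z u
      else if (u.1 : ℕ) = w.1 ∧ (u.1 : ℕ) < M then
        (varVal T z w - varVal T z u - h) / (varVal T z w - varVal T z u) else 1) T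
    split_ifs with h2 h3 h4
    · exact (hu.sub hw).sub_const _
    · exact hw.sub hu
    · have hne : u ≠ w := by rintro rfl; exact lt_irrefl _ hlt
      simp only [div_eq_mul_inv]
      exact ((hw.sub hu).sub_const _).mul ((hw.sub hu).inv
        (sub_ne_zero.2 (h1 w u h4.1.symm hne.symm)))
    · exact differentiableAt_const _
  · exact differentiableAt_const _

/-- The factors `φ` of the pairs of a variable and its parent have simple poles at the lattice
point and the rest of the integrand is holomorphic there, so that the residue is the product of the
residues of these factors with the value of the rest. -/
theorem jacksonTerm_eq (hκ : κ ≠ 0) (hg : Generic κ z h) (hh : ∀ m : ℤ, h ≠ m * κ) (I : Parts lam)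
    (l : Fin (M + 1) → ℂ) (r : TVar lam → ℤ) :
    jacksonTerm κ J I z h l r =
      masterCoef κ J z h l r * weightW I (latticePoint κ J z r) z h := by
  set s := latticePoint κ J z r with hs
  have hdiff : ∀ u w : Vars lam, varVal s z u - varVal s z w =
      z (label J u) - z (label J w) + (shift r u.1 u.2 - shift r w.1 w.2 : ℤ) * κ := by
    intro u w
    rw [hs, varVal_latticePoint, varVal_latticePoint]; push_cast; ring
  have hpar : ∀ y : TVar lam, s y - varVal s z (parent J y) =
      (r y - shift r (parent J y).1 (parent J y).2 : ℤ) * κ := by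
    intro y
    have := hdiff ⟨y.1.castSucc, y.2⟩ (parent J y)
    rw [label_parent, sub_self, zero_add, shift_castSucc] at this
    rw [← this]
    simp [varVal]
  -- the regular part of the integrand is holomorphic near the lattice point
  have hG : ∀ᶠ T in 𝓝 s,
      DifferentiableAt ℂ (fun T => regularPart κ J T z h l * weightW I T z h) T := by
    have hc : ∀ u w : Vars lam, Continuous fun T => varVal T z u - varVal T z w := fun u w =>
      (continuous_varVal z u).sub (continuous_varVal z w)
    have h1 : ∀ᶠ T in 𝓝 s, ∀ u w : Vars lam, label J u ≠ label J w →
        OffLattice κ (varVal T z u - varVal T z w) := by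
      refine eventually_all.2 fun u => eventually_all.2 fun w => eventually_imp_distrib_left.2
        fun hne => ?_
      refine (hc u w).continuousAt.eventually ((isOpen_offLattice hκ).mem_nhds ?_)
      simp only [Set.mem_ofPred_eq]
      rw [hdiff]
      exact (hg.diff _ _ hne).add_int _
    have h2 : ∀ᶠ T in 𝓝 s, ∀ u w : Vars lam, label J u ≠ label J w →
        OffLattice κ (h - (varVal T z u - varVal T z w)) := by
      refine eventually_all.2 fun u => eventually_all.2 fun w => eventually_imp_distrib_left.2
        fun hne => ?_
      refine (Continuous.fun_sub (continuous_const (y := h)) (hc u w)).continuousAt.eventually ((isOpen_offLattice hκ).mem_nhds ?_)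
      simp only [Set.mem_ofPred_eq]
      rw [hdiff]
      have := (hg.sub_diff hne).add_int (-(shift r u.1 u.2 - shift r w.1 w.2))
      convert this using 1
      push_cast; ring
    filter_upwards [h1, h2] with T h1 h2
    exact (differentiableAt_regularPart hκ l h1 h2).mul (differentiableAt_weightW I fun u w hc hne =>
      sub_ne_zero.1 (h1 u w (label_injective_of_col J hc hne)).ne_zero)
  -- near its pole at the lattice point, `φ` has no other pole
  have hk : ∀ᶠ v in 𝓝 (0 : ℂ), ∀ y : TVar lam, v ≠ 0 →
      DifferentiableAt ℂ (phi κ h) (s y - varVal s z (parent J y) + v) := by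
    refine eventually_all.2 fun y => ?_
    rw [hpar]
    set m := r y - shift r (parent J y).1 (parent J y).2
    have hc : Continuous fun v : ℂ => (m : ℂ) * κ + v := by fun_prop
    have h1 : ∀ᶠ v in 𝓝 (0 : ℂ), ∀ k ∈ ({m}ᶜ : Set ℤ), (m : ℂ) * κ + v ≠ k * κ := by
      refine hc.continuousAt.eventually ((isOpen_setOf_ne_int_mul hκ ({m}ᶜ)).mem_nhds ?_)
      intro k hk e
      simp only [add_zero] at e
      exact hk (by exact_mod_cast (mul_right_cancel₀ hκ e).symm)
    have h2 : ∀ᶠ v in 𝓝 (0 : ℂ), OffLattice κ (h - (m * κ + v)) := by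
      refine (Continuous.fun_sub (continuous_const (y := h)) hc).continuousAt.eventually ((isOpen_offLattice hκ).mem_nhds ?_)
      intro k e
      simp only [add_zero] at e
      refine hh (k + m) ?_
      push_cast
      linear_combination e
    filter_upwards [h1, h2] with v h1 h2 hv
    refine differentiableAt_phi hκ (differentiableAt_const h) differentiableAt_id
      (fun k e => ?_) fun k => by simpa using h2 (-k)
    have e : (m : ℂ) * κ + v = (-(k : ℤ) : ℤ) * κ := by rw [← id_eq ((m : ℂ) * κ + v), e]; push_cast; rfl
    by_cases hkm : -(k : ℤ) = m
    · rw [hkm] at e; exact hv (by linear_combination e)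
    · exact h1 _ hkm e
  obtain ⟨δ₁, hδ₁, h1⟩ := Metric.eventually_nhds_iff.1 hG
  obtain ⟨δ₂, hδ₂, h2⟩ := Metric.eventually_nhds_iff.1 hk
  rw [jacksonTerm, resT]
  change iterRes s _ _ s = _
  rw [iterRes_eq_prod (k := phi κ h) (pv := fun T y => varVal T z (parent J y))
    (G := fun T => regularPart κ J T z h l * weightW I T z h)
    (c := fun y => resPhi κ h (-(r y - shift r (parent J y).1 (parent J y).2)))
    (lt_min hδ₁ hδ₂) (L := varList lam) ?_ ?_ ?_ ?_ ?_ ?_ (varList lam) List.suffix_rfl s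
    fun y hy => absurd (mem_varList y) hy]
  · simp only [mem_varList, if_true]
    rw [masterCoef_eq_regularPart, mul_assoc]
  · intro T
    rw [masterPhi_eq_regularPart J, mul_assoc]
  · intro y
    generalize parent J y = w
    obtain ⟨k, a⟩ := w
    induction k using Fin.lastCases with
    | last => exact Or.inl ⟨_, fun T => by simp [varVal]; rfl⟩
    | cast i => exact Or.inr ⟨⟨i, a⟩, fun T => by simp [varVal]⟩
  · intro x xs hx
    refine ⟨(suffix_varList hx).1, fun T t hT => ?_⟩
    have hpc : ((parent J x).1 : ℕ) = x.1 + 1 := by simp [parent]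
    revert hpc
    generalize parent J x = w
    obtain ⟨k, a⟩ := w
    induction k using Fin.lastCases with
    | last => intro _; simp [varVal]
    | cast i =>
      intro hpc
      have hlt : x.1 < i := Fin.lt_def.2 (by simp at hpc; omega)
      have hmem := (suffix_varList hx).2 ⟨i, a⟩ hlt
      have hne : (⟨i, a⟩ : TVar lam) ≠ x := by rintro rfl; exact lt_irrefl _ hlt
      simp only [varVal, tz_castSucc]
      rw [Function.update_of_ne hne, hT _ hmem]
  · intro T hT
    refine h1 ((dist_pi_lt_iff hδ₁).2 fun y => ?_)
    rw [dist_eq_norm]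
    exact (hT y).trans_le (min_le_left _ _)
  · intro y w hw0 hw
    have := h2 (y := w - (s y - varVal s z (parent J y)))
      (by rw [dist_zero_right]; exact hw.trans_le (min_le_right _ _)) y (norm_pos_iff.1 hw0)
    rwa [add_sub_cancel] at this
  · intro y
    have hlim := tendsto_resPhi hκ hh (r y - shift r (parent J y).1 (parent J y).2)
    rw [← hpar] at hlim
    have hmap : Tendsto (fun t => t - varVal s z (parent J y)) (𝓝[≠] s y)
        (𝓝[≠] (s y - varVal s z (parent J y))) := by
      refine tendsto_nhdsWithin_iff.2 ⟨?_, ?_⟩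
      · exact ((continuous_id.sub continuous_const).tendsto (s y)).mono_left nhdsWithin_le_nhds
      · filter_upwards [self_mem_nhdsWithin] with t ht e
        exact ht (sub_left_injective e)
    refine (hlim.comp hmap).congr fun t => ?_
    simp only [Function.comp_apply]
    rw [sub_sub_sub_cancel_right]

end

section Weights

variable {E : Type*} [NormedAddCommGroup E] [NormedSpace ℂ E] {q : E}
  {z : E → Fin (size lam) → ℂ} {h : E → ℂ}

theorem differentiableAt_siteWord (J : Parts lam) (hz : DifferentiableAt ℂ z q)
    (hh : DifferentiableAt ℂ h q) (hg : Generic κ (z q) (h q)) (p : Fin (size lam) → ℕ)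
    (r : TVar lam → ℤ) :
    DifferentiableAt ℂ (fun q => siteWord κ J (z q) (h q) p r Finset.univ) q := by
  simp only [siteWord_univ]
  refine DifferentiableAt.fun_sum fun γ _ => DifferentiableAt.mul ?_
    (differentiableAt_prod fun u _ => differentiableAt_prod fun w _ => ?_)
  · exact differentiableAt_const (∏ b, (latticeVars κ J (z q) (h q)).site (zVar b) (p b) r
      (Finset.univ.filter fun v => γ v = b))
  · split_ifs
    · exact differentiableAt_kernel J hz hh hg r u w
    · exact differentiableAt_const _

theorem tempered_siteWord (hκ : κ ≠ 0) (J : Parts lam) (hz : DifferentiableAt ℂ z q)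
    (hh : DifferentiableAt ℂ h q) (hg : Generic κ (z q) (h q)) (p : Fin (size lam) → ℕ) :
    Tempered (𝓝 q) fun r q => siteWord κ J (z q) (h q) p r Finset.univ := by
  simp only [siteWord_univ]
  refine Tempered.sum _ fun γ _ => Tempered.mul ?_
    (Tempered.prod _ fun u _ => Tempered.prod _ fun w _ => ?_)
  · exact Tempered.const (∏ b, (latticeVars κ J (z q) (h q)).site (zVar b) (p b) 0
      (Finset.univ.filter fun v => γ v = b))
  · split_ifs
    · exact tempered_kernel hκ J hz hh hg u w
    · exact Tempered.const _

end Weights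

end

/-! ### Dependence on the parameters -/

section

variable {M : ℕ} {lam : Fin (M + 1) → ℕ} {κ : ℂ}

section Log

variable {U : Set (Fin (M + 1) → ℂ)} {logq : (Fin (M + 1) → ℂ) → Fin (M + 1) → ℂ}
  (hU : IsOpen U) (hcont : ContinuousOn logq U) (hlog : ∀ q ∈ U, ∀ i, Complex.exp (logq q i) = q i)
include hU hcont hlog

/-- A continuous branch of the logarithm is locally the principal one up to a constant. -/
theorem eventually_logq_eq {q₀ : Fin (M + 1) → ℂ} (hq₀ : q₀ ∈ U) :
    ∀ᶠ q in 𝓝 q₀, ∀ i, logq q i = logq q₀ i + Complex.log (q i / q₀ i) := by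
  refine eventually_all.2 fun i => ?_
  have hc : ContinuousAt (fun q => logq q i - logq q₀ i) q₀ :=
    ((continuousAt_pi.1 (hcont.continuousAt (hU.mem_nhds hq₀)) i).sub continuousAt_const)
  have h1 : ∀ᶠ q in 𝓝 q₀, ‖logq q i - logq q₀ i‖ < Real.pi := by
    refine hc.norm.eventually (gt_mem_nhds ?_)
    simpa using Real.pi_pos
  filter_upwards [h1, hU.mem_nhds hq₀] with q h1 hq
  have h2 := (Complex.abs_im_le_norm _).trans_lt h1
  rw [abs_lt] at h2
  rw [← hlog q hq i, ← hlog q₀ hq₀ i, ← Complex.exp_sub, Complex.log_exp h2.1 h2.2.le]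
  ring

theorem differentiableAt_logq {q₀ : Fin (M + 1) → ℂ} (hq₀ : q₀ ∈ U) :
    DifferentiableAt ℂ logq q₀ := by
  rw [differentiableAt_pi]
  intro i
  have hne : q₀ i ≠ 0 := by rw [← hlog q₀ hq₀ i]; exact Complex.exp_ne_zero _
  have h1 : (fun q => logq q i) =ᶠ[𝓝 q₀] fun q => logq q₀ i + Complex.log (q i / q₀ i) := by
    filter_upwards [eventually_logq_eq hU hcont hlog hq₀] with q hq using hq i
  rw [h1.differentiableAt_iff]
  have h2 : DifferentiableAt ℂ (fun q : Fin (M + 1) → ℂ => q i / q₀ i) q₀ := by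
    simp only [div_eq_mul_inv]
    exact (differentiableAt_pi.1 differentiableAt_id i).mul_const _
  exact (h2.clog (by rw [div_self hne]; exact Complex.one_mem_slitPlane)).const_add _

theorem hasDerivAt_logq_update {q₀ : Fin (M + 1) → ℂ} (hq₀ : q₀ ∈ U) (i k : Fin (M + 1)) :
    HasDerivAt (fun x => logq (Function.update q₀ i x) k) (if k = i then (q₀ i)⁻¹ else 0)
      (q₀ i) := by
  have hne : q₀ k ≠ 0 := by rw [← hlog q₀ hq₀ k]; exact Complex.exp_ne_zero _
  have hupd : Tendsto (fun x => Function.update q₀ i x) (𝓝 (q₀ i)) (𝓝 q₀) := by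
    have : Continuous fun x => Function.update q₀ i x := continuous_const.update i continuous_id
    simpa using this.tendsto (q₀ i)
  have h1 : (fun x => logq (Function.update q₀ i x) k) =ᶠ[𝓝 (q₀ i)]
      fun x => logq q₀ k + Complex.log (Function.update q₀ i x k / q₀ k) :=
    (hupd.eventually (eventually_logq_eq hU hcont hlog hq₀)).mono fun x hx => hx k
  refine HasDerivAt.congr_of_eventuallyEq ?_ h1
  by_cases hk : k = i
  · subst hk
    simp only [Function.update_self, if_true]
    have h2 : HasDerivAt (fun x => x / q₀ k) (1 / q₀ k) (q₀ k) := (hasDerivAt_id _).div_const _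
    have h3 := (h2.clog (by rw [div_self hne]; exact Complex.one_mem_slitPlane)).const_add
      (logq q₀ k)
    rw [div_self hne, div_one, one_div] at h3
    exact h3
  · simp only [Function.update_of_ne hk, if_neg hk]
    exact hasDerivAt_const _ _

omit hU hcont in
theorem norm_exp_logq_sub_lt (hUq : ∀ q ∈ U, ∀ i : Fin M, ‖q i.succ / q i.castSucc‖ < 1)
    {q : Fin (M + 1) → ℂ} (hq : q ∈ U) (i : Fin M) :
    ‖Complex.exp (logq q i.succ - logq q i.castSucc)‖ < 1 := by
  rw [Complex.exp_sub, hlog q hq, hlog q hq]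
  exact hUq q hq i

end Log

theorem generic_of_mem_bigDomain {U : Set (Fin (M + 1) → ℂ)} {n : ℕ} {p : Param M n}
    (hp : p ∈ bigDomain κ U) : Generic κ p.1 p.2.1 :=
  ⟨hp.1, fun a b hab m => (hp.2.1 a b hab m).1, fun a b hab m => (hp.2.1 a b hab m).2⟩

theorem smallDomain_subset_bigDomain {U : Set (Fin (M + 1) → ℂ)} {n : ℕ} :
    smallDomain κ U ⊆ (bigDomain κ U : Set (Param M n)) :=
  fun _ hp => ⟨fun m _ => hp.1 m, hp.2⟩

/-- The Jackson sum of a word, which is the Jackson integral `M_J(Φ_λ W_I)` continued to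
`bigDomain` if the word is that of `I`. -/
def siteSum (κ : ℂ) (J : Parts lam) (z : Fin (size lam) → ℂ) (h : ℂ) (l : Fin (M + 1) → ℂ)
    (p : Fin (size lam) → ℕ) : ℂ :=
  jackSum l (siteWord κ J z h p)

theorem siteSum_eq (J : Parts lam) (z : Fin (size lam) → ℂ) (h : ℂ) (l : Fin (M + 1) → ℂ)
    (p : Fin (size lam) → ℕ) : siteSum κ J z h l p =
      ∑' r, masterCoef κ J z h l r * siteWord κ J z h p r Finset.univ := rfl

theorem differentiableAt_siteSum {E : Type*} [NormedAddCommGroup E] [NormedSpace ℂ E] {q : E}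
    {z : E → Fin (size lam) → ℂ} {h : E → ℂ} {l : E → Fin (M + 1) → ℂ}
    (hκ : κ ≠ 0) (J : Parts lam) (hz : ∀ᶠ q in 𝓝 q, DifferentiableAt ℂ z q)
    (hh : ∀ᶠ q in 𝓝 q, DifferentiableAt ℂ h q) (hl : ∀ᶠ q in 𝓝 q, DifferentiableAt ℂ l q)
    (hg : ∀ᶠ q in 𝓝 q, Generic κ (z q) (h q))
    (hq : ∀ i : Fin M, ‖Complex.exp (l q i.succ - l q i.castSucc)‖ < 1) (p : Fin (size lam) → ℕ) :
    (Summable fun r => fderiv ℂ (fun q => masterCoef κ J (z q) (h q) (l q) r *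
        siteWord κ J (z q) (h q) p r Finset.univ) q) ∧
    HasFDerivAt (fun q => siteSum κ J (z q) (h q) (l q) p)
      (∑' r, fderiv ℂ (fun q => masterCoef κ J (z q) (h q) (l q) r *
        siteWord κ J (z q) (h q) p r Finset.univ) q) q := by
  obtain ⟨b, hb, hev⟩ := exists_summable_bound hκ J hz.self_of_nhds hh.self_of_nhds
    hl.self_of_nhds hg.self_of_nhds hq
    (tempered_siteWord hκ J hz.self_of_nhds hh.self_of_nhds hg.self_of_nhds p)
  refine hasFDerivAt_tsum_of_norm_le hb ?_ hev
  filter_upwards [hz, hh, hl, hg] with q hz hh hl hg r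
  exact (differentiableAt_masterCoef hκ J hz hh hl hg r).mul
    (differentiableAt_siteWord J hz hh hg p r)

/-- Differentiation in `log q_i` multiplies by the difference of the sums of two consecutive groups
of variables. -/
theorem hasDerivAt_expPart (T : TVar lam → ℂ) (z : Fin (size lam) → ℂ)
    {l : ℂ → Fin (M + 1) → ℂ} {x c : ℂ} {i : Fin (M + 1)}
    (hl : ∀ k, HasDerivAt (fun x => l x k) (if k = i then c else 0) x) :
    HasDerivAt (fun x => expPart lam κ T z (l x))
      (expPart lam κ T z (l x) * (c / κ * ((∑ a, tz T z i a) -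
        ∑ k : Fin M, if k.succ = i then ∑ a, tz T z k.castSucc a else 0))) x := by
  set S : Fin (M + 1) → ℂ := fun k => ∑ a, tz T z k a with hS
  have hlast : ∑ a, z a = S (Fin.last M) := by
    simp only [hS, tz_last]
    exact (Equiv.sum_comp (finCongr (psum_last lam)) z).symm
  have hexp : ∀ l, expPart lam κ T z l = Complex.exp (
      (Real.pi * Complex.I * ((size lam : ℂ) - lam (Fin.last M)) + l (Fin.last M)) *
        (S (Fin.last M) / κ) + ∑ i : Fin M,
      (Real.pi * Complex.I * ((lam i.succ : ℂ) - lam i.castSucc) + (l i.castSucc - l i.succ)) *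
        (S i.castSucc / κ)) := by
    intro l
    rw [Complex.exp_add, Complex.exp_sum, expPart, hlast]
  simp only [hexp]
  have h1 := ((((hl (Fin.last M)).const_add (Real.pi * Complex.I * ((size lam : ℂ) -
    lam (Fin.last M)))).mul_const (S (Fin.last M) / κ)).fun_add
    (HasDerivAt.fun_sum fun (k : Fin M) (_ : k ∈ Finset.univ) =>
      ((((hl k.castSucc).fun_sub (hl k.succ)).const_add (Real.pi * Complex.I *
        ((lam k.succ : ℂ) - lam k.castSucc))).mul_const (S k.castSucc / κ)))).cexp
  refine h1.congr_deriv (congrArg₂ (· * ·) rfl ?_)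
  have h2 : ∑ k : Fin M, ((if k.castSucc = i then c else 0) - if k.succ = i then c else 0) *
      (S k.castSucc / κ) = (∑ k : Fin M, if k.castSucc = i then c * (S k.castSucc / κ) else 0) -
        ∑ k : Fin M, if k.succ = i then c * (S k.castSucc / κ) else 0 := by
    rw [← Finset.sum_sub_distrib]
    refine Finset.sum_congr rfl fun k _ => ?_
    rw [sub_mul, ite_mul, ite_mul, zero_mul]
  have h3 : ∑ k : Fin (M + 1), (if k = i then c * (S k / κ) else 0) = c * (S i / κ) := by simp
  rw [Fin.sum_univ_castSucc] at h3
  change _ = c / κ * (S i - ∑ k : Fin M, if k.succ = i then S k.castSucc else 0)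
  rw [h2, mul_sub, ite_mul, zero_mul]
  have h4 : ∑ k : Fin M, c / κ * (if k.succ = i then S k.castSucc else 0) =
      ∑ k : Fin M, if k.succ = i then c * (S k.castSucc / κ) else 0 := by
    refine Finset.sum_congr rfl fun k _ => ?_
    rw [mul_ite, mul_zero]
    congr 1; ring
  rw [← Finset.mul_sum] at h4
  rw [h4]
  linear_combination h3

theorem sum_col_latticeVars (J : Parts lam) (z : Fin (size lam) → ℂ) (h : ℂ) (r : TVar lam → ℤ)
    (i : Fin (M + 1)) :
    (∑ u : Vars lam, if (latticeVars κ J z h).col u = i then (latticeVars κ J z h).val r u else 0) =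
      ∑ a, tz (latticePoint κ J z r) z i a := by
  rw [Fintype.sum_sigma, Finset.sum_eq_single i]
  · refine Finset.sum_congr rfl fun a _ => ?_
    rw [tz_latticePoint J z h]
    exact if_pos rfl
  · intro k _ hk
    refine Finset.sum_eq_zero fun a _ => if_neg fun e => hk (Fin.ext e)
  · simp

theorem cartanDeg_siteWord_univ (J : Parts lam) (z : Fin (size lam) → ℂ) (h : ℂ)
    (r : TVar lam → ℤ) (i : Fin (M + 1)) (f : Shuffle (latticeVars κ J z h).kernel) :
    (latticeVars κ J z h).cartanDeg i f r Finset.univ =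
      ((∑ a, tz (latticePoint κ J z r) z i a) -
        ∑ k : Fin M, if k.succ = i then ∑ a, tz (latticePoint κ J z r) z k.castSucc a else 0) *
          f r Finset.univ := by
  have hdeg : ∀ k : Fin (M + 1), (latticeVars κ J z h).deg k f r Finset.univ =
      (∑ a, tz (latticePoint κ J z r) z k a) * f r Finset.univ := by
    intro k
    rw [ColoredVars.deg, Shuffle.weightMul_apply, sum_col_latticeVars]
  rw [ColoredVars.cartanDeg, LinearMap.sub_apply, Shuffle.sub_apply, hdeg, sub_mul]
  congr 1
  induction i using Fin.cases with
  | zero =>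
    rw [if_pos (by simp)]
    simp [Fin.succ_ne_zero]
  | succ j =>
    have := hdeg j.castSucc
    rw [Fin.val_castSucc] at this
    rw [if_neg (by simp), Fin.val_succ, Nat.add_sub_cancel, this]
    simp

/-- Differentiation in `log q_i` acts on the Jackson sums as the Cartan degree, up to `κ`. -/
theorem hasDerivAt_siteSum (hκ : κ ≠ 0) (J : Parts lam) {z : Fin (size lam) → ℂ} {h : ℂ}
    (hg : Generic κ z h) {l : ℂ → Fin (M + 1) → ℂ} {x c : ℂ} {i : Fin (M + 1)}
    (hl : ∀ k, HasDerivAt (fun x => l x k) (if k = i then c else 0) x)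
    (hl' : ∀ᶠ x in 𝓝 x, DifferentiableAt ℂ l x)
    (hq : ∀ i : Fin M, ‖Complex.exp (l x i.succ - l x i.castSucc)‖ < 1) (p : Fin (size lam) → ℕ) :
    HasDerivAt (fun x => siteSum κ J z h (l x) p)
      (c / κ * jackSum (l x) ((latticeVars κ J z h).cartanDeg i (siteWord κ J z h p))) x := by
  obtain ⟨h1, h2⟩ := differentiableAt_siteSum (z := fun _ => z) (h := fun _ => h) (l := l) hκ J
    (Eventually.of_forall fun _ => differentiableAt_const _)
    (Eventually.of_forall fun _ => differentiableAt_const _) hl' (Eventually.of_forall fun _ => hg)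
    hq p
  refine h2.hasDerivAt.congr_deriv ?_
  rw [← ContinuousLinearMap.apply_apply (1 : ℂ), ContinuousLinearMap.map_tsum _ h1, jackSum,
    ← tsum_mul_left]
  refine tsum_congr fun r => ?_
  rw [ContinuousLinearMap.apply_apply, fderiv_apply_one_eq_deriv]
  have h3 := ((hasDerivAt_expPart (lam := lam) (κ := κ) (latticePoint κ J z r) z hl).mul_const
    (∏ u : Vars lam, ∏ w : Vars lam, pairCoef κ J z h r u w)).mul_const
      (siteWord κ J z h p r Finset.univ)
  refine h3.deriv.trans ?_
  rw [cartanDeg_siteWord_univ, masterCoef]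
  ring

end

/-! ### The Hamiltonians in coordinates -/

section Tensor

variable {M n : ℕ}

/-- The vector with given coordinates in the basis `v_p`. -/
def toVec : ((Fin n → Fin (M + 1)) → ℂ) →ₗ[ℂ] TensorPow M n where
  toFun g := ∑ p, g p • basisVec p
  map_add' g g' := by simp [add_smul, Finset.sum_add_distrib]
  map_smul' c g := by simp [Finset.smul_sum, smul_smul]

theorem toVec_apply (g : (Fin n → Fin (M + 1)) → ℂ) : toVec g = ∑ p, g p • basisVec p := rfl

theorem eOp_basisVec (i j : Fin (M + 1)) (a : Fin n) (p : Fin n → Fin (M + 1)) :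
    eOp i j a (basisVec p) = if p a = j then basisVec (Function.update p a i) else 0 := by
  rw [eOp, basisVec, PiTensorProduct.map_tprod]
  split_ifs with h
  · rw [basisVec]
    congr 1
    funext b
    by_cases hb : b = a
    · subst hb
      ext c
      simp [h, Matrix.single_apply, Pi.single_apply, eq_comm]
    · simp [hb]
  · refine MultilinearMap.map_coord_zero _ a ?_
    ext c
    simp [Ne.symm h]

/-- The action of `e_{i,j}^{(a)}` on coordinates. The coefficient at `p` comes from the basis
vector with `j` in place of the letter `i` at position `a`. -/
def actE (i j : Fin (M + 1)) (a : Fin n) (g : (Fin n → Fin (M + 1)) → ℂ) :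
    (Fin n → Fin (M + 1)) → ℂ := fun p => if p a = i then g (Function.update p a j) else 0

theorem eOp_toVec (i j : Fin (M + 1)) (a : Fin n) (g : (Fin n → Fin (M + 1)) → ℂ) :
    eOp i j a (toVec g) = toVec (actE i j a g) := by
  simp only [toVec_apply, map_sum, map_smul, eOp_basisVec, actE, smul_ite, smul_zero, ite_smul,
    zero_smul]
  rw [← Finset.sum_filter, ← Finset.sum_filter]
  refine Finset.sum_bij' (fun p _ => Function.update p a i) (fun p _ => Function.update p a j)
    ?_ ?_ ?_ ?_ ?_
  · intro p _; simp
  · intro p _; simp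
  · intro p hp
    simp only [Finset.mem_filter, Finset.mem_univ, true_and] at hp
    simp [← hp]
  · intro p hp
    simp only [Finset.mem_filter, Finset.mem_univ, true_and] at hp
    simp [← hp]
  · intro p hp
    simp only [Finset.mem_filter, Finset.mem_univ, true_and] at hp
    simp [← hp]

theorem etaOp_toVec (i j : Fin (M + 1)) (g : (Fin n → Fin (M + 1)) → ℂ) :
    etaOp i j (toVec g) = toVec (∑ a, actE i j a g) := by
  rw [etaOp, LinearMap.sum_apply, map_sum]
  exact Finset.sum_congr rfl fun a _ => eOp_toVec i j a g

end Tensor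

section Swap

variable {n : ℕ} {α : Type*} [DecidableEq α]

/-- The sum of values of `g` at sequences obtained from `p` by exchanging a letter `i`
with a letter `j` further to the right. -/
def swapSum (g : (Fin n → α) → ℂ) (i j : α) (p : Fin n → α) : ℂ :=
  ∑ a, ∑ b, if a < b ∧ p a = i ∧ p b = j then
    g (Function.update (Function.update p a j) b i) else 0

theorem sum_update_update (g : (Fin n → α) → ℂ) (i j : α) (p : Fin n → α) :
    (∑ a, if p a = i then ∑ b, (if Function.update p a j b = j then
      g (Function.update (Function.update p a j) b i) else 0) else 0) =
      (Finset.univ.filter fun a => p a = i).card * g p + swapSum g i j p + swapSum g j i p := by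
  have h1 : ∀ a, p a = i → ∑ b, (if Function.update p a j b = j then
      g (Function.update (Function.update p a j) b i) else 0) = g p +
      (∑ b, if a < b ∧ p b = j then g (Function.update (Function.update p a j) b i) else 0) +
      ∑ b, if b < a ∧ p b = j then g (Function.update (Function.update p b i) a j) else 0 := by
    intro a ha
    have h2 : ∀ b, (if Function.update p a j b = j then
        g (Function.update (Function.update p a j) b i) else 0) = (if b = a then g p else 0) +
        (if a < b ∧ p b = j then g (Function.update (Function.update p a j) b i) else 0) +
        (if b < a ∧ p b = j then g (Function.update (Function.update p b i) a j) else 0) := by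
      intro b
      rcases lt_trichotomy a b with h | rfl | h
      · simp [h.ne', h, h.not_gt]
      · simp [← ha]
      · simp [h.ne, h, h.not_gt, Function.update_comm h.ne]
    rw [Finset.sum_congr rfl fun b _ => h2 b, Finset.sum_add_distrib, Finset.sum_add_distrib,
      Finset.sum_ite_eq' Finset.univ a, if_pos (Finset.mem_univ a)]
  have h3 : swapSum g j i p = ∑ a, if p a = i then
      ∑ b, (if b < a ∧ p b = j then g (Function.update (Function.update p b i) a j) else 0) else 0 := by
    rw [swapSum, Finset.sum_comm]
    refine Finset.sum_congr rfl fun a _ => ?_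
    split_ifs with ha
    · simp [ha]
    · simp [ha]
  have h4 : swapSum g i j p = ∑ a, if p a = i then
      ∑ b, (if a < b ∧ p b = j then g (Function.update (Function.update p a j) b i) else 0) else 0 := by
    rw [swapSum]
    refine Finset.sum_congr rfl fun a _ => ?_
    split_ifs with ha
    · simp [ha]
    · simp [ha]
  have h5 : ((Finset.univ.filter fun a => p a = i).card : ℂ) * g p =
      ∑ a, if p a = i then g p else 0 := by
    rw [← Finset.sum_filter, Finset.sum_const, nsmul_eq_mul]
  rw [h3, h4, h5, ← Finset.sum_add_distrib, ← Finset.sum_add_distrib]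
  refine Finset.sum_congr rfl fun a _ => ?_
  split_ifs with ha
  · exact h1 a ha
  · simp

theorem sum_update_update_add (g : (Fin n → α) → ℂ) (i j : α) (p : Fin n → α)
    (x : ℂ) :
    (∑ a, if p a = i then (x * (∑ b, if Function.update p a j b = j then
        g (Function.update (Function.update p a j) b i) else 0) +
      ∑ b, if a < b ∧ p b = j then g (Function.update (Function.update p a j) b i) else 0) else 0) =
      x * ((Finset.univ.filter fun a => p a = i).card * g p + swapSum g i j p + swapSum g j i p) +
        swapSum g i j p := by
  rw [← sum_update_update g i j p, Finset.mul_sum]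
  conv_rhs => rw [swapSum, ← Finset.sum_add_distrib]
  refine Finset.sum_congr rfl fun a _ => ?_
  split_ifs with ha
  · simp [ha]
  · simp [ha]

end Swap

section Hamiltonian

variable {M n : ℕ}

theorem sum_sum_actE_actE (i : Fin (M + 1)) (g : (Fin n → Fin (M + 1)) → ℂ)
    (p : Fin n → Fin (M + 1)) :
    (∑ a : Fin n, ∑ b with a < b, ∑ k, actE i k a (actE k i b g) p) =
      (∑ a : Fin n, ∑ b : Fin n, if a < b ∧ p a = i ∧ p b = i then g p else 0) +
        ∑ j with j ≠ i, swapSum g i j p := by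
  have h1 : ∀ a b : Fin n, a < b → ∀ k, actE i k a (actE k i b g) p =
      if p a = i ∧ p b = k then g (Function.update (Function.update p a k) b i) else 0 := by
    intro a b hab k
    simp [actE, hab.ne', ite_and]
  have h2 : (∑ a : Fin n, ∑ b with a < b, ∑ k, actE i k a (actE k i b g) p) =
      ∑ k, swapSum g i k p := by
    simp only [swapSum]
    conv_rhs => rw [Finset.sum_comm]
    refine Finset.sum_congr rfl fun a _ => ?_
    conv_rhs => rw [Finset.sum_comm]
    rw [Finset.sum_filter]
    refine Finset.sum_congr rfl fun b _ => ?_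
    split_ifs with hab
    · refine Finset.sum_congr rfl fun k _ => ?_
      rw [h1 a b hab]
      simp [hab]
    · simp [hab]
  rw [h2, ← Finset.add_sum_erase _ _ (Finset.mem_univ i)]
  congr 1
  · simp only [swapSum]
    refine Finset.sum_congr rfl fun a _ => Finset.sum_congr rfl fun b _ => ?_
    split_ifs with hab
    · have e1 : Function.update p a i = p := by rw [← hab.2.1, Function.update_eq_self]
      have e2 : Function.update p b i = p := by rw [← hab.2.2, Function.update_eq_self]
      rw [e1, e2]
    · rfl
  · refine Finset.sum_congr ?_ fun _ _ => rfl
    ext j; simp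

theorem sum_lt_ite (c : Fin n → Prop) [DecidablePred c] (x : ℂ) :
    (∑ a : Fin n, ∑ b : Fin n, if a < b ∧ c a ∧ c b then x else 0) =
      (1 / 2) * ((Finset.univ.filter c).card * ((Finset.univ.filter c).card - 1)) * x := by
  set A : ℂ := ∑ a : Fin n, ∑ b : Fin n, if a < b ∧ c a ∧ c b then x else 0 with hA
  have h1 : A = ∑ a : Fin n, ∑ b : Fin n, if b < a ∧ c a ∧ c b then x else 0 := by
    rw [hA, Finset.sum_comm]
    refine Finset.sum_congr rfl fun a _ => Finset.sum_congr rfl fun b _ => ?_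
    congr 1
    simp only [eq_iff_iff]; tauto
  have h2 : ∑ a : Fin n, ∑ b : Fin n, (if c a ∧ c b then x else 0) =
      (Finset.univ.filter c).card * (Finset.univ.filter c).card * x := by
    have : ∀ a, ∑ b : Fin n, (if c a ∧ c b then x else 0) =
        if c a then (Finset.univ.filter c).card * x else 0 := by
      intro a
      split_ifs with h
      · simp only [h, true_and]
        rw [← Finset.sum_filter, Finset.sum_const, nsmul_eq_mul]
      · simp [h]
    simp only [this]
    rw [← Finset.sum_filter, Finset.sum_const, nsmul_eq_mul, mul_assoc]
  have h3 : ∑ a : Fin n, (if c a then x else 0) = (Finset.univ.filter c).card * x := by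
    rw [← Finset.sum_filter, Finset.sum_const, nsmul_eq_mul]
  have h4 : ∑ a : Fin n, ∑ b : Fin n, (if c a ∧ c b then x else 0) =
      A + A + ∑ a : Fin n, (if c a then x else 0) := by
    conv_rhs => arg 1; arg 2; rw [h1]
    rw [hA, ← Finset.sum_add_distrib, ← Finset.sum_add_distrib]
    refine Finset.sum_congr rfl fun a _ => ?_
    have : (if c a then x else 0) = ∑ b, if b = a then (if c a then x else 0) else 0 := by simp
    rw [this, ← Finset.sum_add_distrib, ← Finset.sum_add_distrib]
    refine Finset.sum_congr rfl fun b _ => ?_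
    rcases lt_trichotomy a b with h | rfl | h
    · simp [h, h.ne', h.not_gt]
    · simp
    · simp [h, h.ne, h.not_gt]
  rw [h2, h3] at h4
  linear_combination (-1 / 2 : ℂ) * h4

theorem sum_actE_self (i : Fin (M + 1)) (g : (Fin n → Fin (M + 1)) → ℂ)
    (p : Fin n → Fin (M + 1)) :
    (∑ a, actE i i a g) p = (Finset.univ.filter fun a => p a = i).card * g p := by
  rw [Finset.sum_apply]
  have : ∀ a, actE i i a g p = if p a = i then g p else 0 := by
    intro a
    unfold actE
    split_ifs with h
    · rw [Function.update_eq_iff.2 ⟨h.symm, fun _ _ => rfl⟩]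
    · rfl
  simp only [this]
  rw [← Finset.sum_filter, Finset.sum_const, nsmul_eq_mul]

theorem sum_actE_sum_actE (i j : Fin (M + 1)) (g : (Fin n → Fin (M + 1)) → ℂ)
    (p : Fin n → Fin (M + 1)) :
    (∑ a, actE i j a (∑ b, actE j i b g)) p =
      (Finset.univ.filter fun a => p a = i).card * g p + swapSum g i j p + swapSum g j i p := by
  rw [← sum_update_update g i j p, Finset.sum_apply]
  simp only [actE, Finset.sum_apply]

/-- The diagonal terms of the Hamiltonian other than those with `z_a` cancel in coordinates. -/
theorem hamiltonian_toVec (i : Fin (M + 1)) (z : Fin n → ℂ) (h : ℂ) (q : Fin (M + 1) → ℂ)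
    (g : (Fin n → Fin (M + 1)) → ℂ) :
    hamiltonian i z h q (toVec g) = toVec fun p => (∑ a, if p a = i then z a else 0) * g p -
      h * ∑ j with j ≠ i, (swapSum g i j p +
        q j / (q i - q j) * (swapSum g i j p + swapSum g j i p)) := by
  have h1 : hamiltonian i z h q (toVec g) = toVec ((∑ a, z a • actE i i a g) -
      h • ((1 / 2 : ℂ) • (∑ a, actE i i a (g - ∑ b, actE i i b g)) +
        (∑ a : Fin n, ∑ b with a < b, ∑ k, actE i k a (actE k i b g)) +
        ∑ j with j ≠ i, (q j / (q i - q j)) •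
          ((∑ a, actE i j a (∑ b, actE j i b g)) - ∑ a, actE i i a g))) := by
    simp only [hamiltonian, LinearMap.sub_apply, LinearMap.add_apply, LinearMap.smul_apply,
      LinearMap.sum_apply, Module.End.mul_apply, Module.End.one_apply, eOp_toVec, etaOp_toVec,
      ← map_sub (toVec (M := M) (n := n)), ← map_add (toVec (M := M) (n := n)),
      ← map_smul (toVec (M := M) (n := n)), ← map_sum (toVec (M := M) (n := n))]
  rw [h1]
  congr 1
  funext p
  have hc := sum_sum_actE_actE i g p
  have hs := sum_lt_ite (fun a => p a = i) (g p)
  simp only [Pi.sub_apply, Pi.smul_apply, Pi.add_apply, smul_eq_mul, sum_actE_self]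
  rw [Finset.sum_apply, Finset.sum_apply, Finset.sum_apply]
  simp only [Finset.sum_apply, Pi.sub_apply, Pi.smul_apply, smul_eq_mul]
  rw [hc, hs]
  have h5 : ∑ a, z a * actE i i a g p = (∑ a, if p a = i then z a else 0) * g p := by
    rw [Finset.sum_mul]
    refine Finset.sum_congr rfl fun a _ => ?_
    unfold actE
    split_ifs with h
    · rw [Function.update_eq_iff.2 ⟨h.symm, fun _ _ => rfl⟩]
    · simp
  have h6 : ∑ j with j ≠ i, q j / (q i - q j) * (∑ a, actE i j a (∑ b, actE j i b g) p -
      ∑ a, actE i i a g p) = ∑ j with j ≠ i, q j / (q i - q j) *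
        (swapSum g i j p + swapSum g j i p) := by
    refine Finset.sum_congr rfl fun j _ => ?_
    have e1 := sum_actE_sum_actE i j g p
    have e2 := sum_actE_self i g p
    rw [Finset.sum_apply] at e1 e2
    rw [e1, e2]
    ring
  rw [h5, h6, Finset.sum_add_distrib]
  ring

end Hamiltonian

/-! ### The solution -/

section

variable {M : ℕ} {lam : Fin (M + 1) → ℕ} {κ : ℂ}

section Omega

theorem norm_div_lt_one_of_lt {q : Fin (M + 1) → ℂ} (hne : ∀ i, q i ≠ 0)
    (hq : ∀ i : Fin M, ‖q i.succ / q i.castSucc‖ < 1) {i j : Fin (M + 1)} (hij : i < j) :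
    ‖q j / q i‖ < 1 := by
  have hanti : StrictAnti fun i => ‖q i‖ := by
    refine Fin.strictAnti_iff_succ_lt.2 fun k => ?_
    have := hq k
    rwa [norm_div, div_lt_one (norm_pos_iff.2 (hne _))] at this
  rw [norm_div, div_lt_one (norm_pos_iff.2 (hne _))]
  exact hanti hij

theorem one_sub_mem_slitPlane {x : ℂ} (hx : ‖x‖ < 1) : 1 - x ∈ Complex.slitPlane := by
  rw [sub_eq_add_neg]
  exact Complex.mem_slitPlane_of_norm_lt_one (by rwa [norm_neg])

theorem differentiableAt_omega {E : Type*} [NormedAddCommGroup E] [NormedSpace ℂ E]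
    (lam : Fin (M + 1) → ℕ) {h : E → ℂ} {q : E → Fin (M + 1) → ℂ} {p : E}
    (hh : DifferentiableAt ℂ h p) (hqd : DifferentiableAt ℂ q p) (hne : ∀ i, q p i ≠ 0)
    (hq : ∀ i : Fin M, ‖q p i.succ / q p i.castSucc‖ < 1) :
    DifferentiableAt ℂ (fun x => omega lam κ (h x) (q x)) p := by
  have hqa : ∀ a, DifferentiableAt ℂ (fun x => q x a) p := fun a => differentiableAt_pi.1 hqd a
  unfold omega
  refine differentiableAt_prod fun i _ => differentiableAt_prod fun j hj => ?_
  have hlt := norm_div_lt_one_of_lt hne hq (Finset.mem_filter.1 hj).2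
  refine DifferentiableAt.cpow ?_ ?_ (one_sub_mem_slitPlane hlt)
  · simp only [div_eq_mul_inv]
    exact ((hqa j).mul ((hqa i).inv (hne i))).const_sub 1
  · simp only [div_eq_mul_inv]
    exact (hh.mul_const _).mul_const _

theorem hasDerivAt_prod_of_mul {α : Type*} (s : Finset α) {f : α → ℂ → ℂ} {c : α → ℂ} {x : ℂ}
    (hf : ∀ a ∈ s, HasDerivAt (f a) (f a x * c a) x) :
    HasDerivAt (fun y => ∏ a ∈ s, f a y) ((∏ a ∈ s, f a x) * ∑ a ∈ s, c a) x := by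
  classical
  induction s using Finset.induction_on with
  | empty => simpa using hasDerivAt_const x (1 : ℂ)
  | insert a s ha ih =>
    simp only [Finset.prod_insert ha, Finset.sum_insert ha]
    refine ((hf a (Finset.mem_insert_self a s)).fun_mul
      (ih fun b hb => hf b (Finset.mem_insert_of_mem hb))).congr_deriv ?_
    ring

/-- The logarithmic derivative `κ q_i ∂(log Ω_λ)/∂q_i`. -/
def gaugeCoef (lam : Fin (M + 1) → ℕ) (h : ℂ) (q : Fin (M + 1) → ℂ) (i : Fin (M + 1)) : ℂ :=
  ∑ j, ((if i < j then h * lam i * (q j / (q i - q j)) else 0) +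
    if j < i then h * lam j * (q i / (q i - q j)) else 0)

theorem hasDerivAt_omega (lam : Fin (M + 1) → ℕ) (hκ : κ ≠ 0) (h : ℂ) {q : Fin (M + 1) → ℂ}
    (hne : ∀ i, q i ≠ 0) (hq : ∀ i : Fin M, ‖q i.succ / q i.castSucc‖ < 1) (i : Fin (M + 1)) :
    HasDerivAt (fun x => omega lam κ h (Function.update q i x))
      (omega lam κ h q * (gaugeCoef lam h q i / (κ * q i))) (q i) := by
  set c : Fin (M + 1) → Fin (M + 1) → ℂ := fun a b =>
    (if a = i then h * lam a * (q b / (q a - q b)) / (κ * q i) else 0) +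
      if b = i then h * lam a * (q b / (q b - q a)) / (κ * q i) else 0 with hc
  have hfac : ∀ a b, a < b → HasDerivAt (fun x => (1 - Function.update q i x b /
      Function.update q i x a) ^ (h * lam a / κ)) ((1 - q b / q a) ^ (h * lam a / κ) * c a b)
        (q i) := by
    intro a b hab
    have hlt := norm_div_lt_one_of_lt hne hq hab
    have hslit := one_sub_mem_slitPlane hlt
    have hne1 : 1 - q b / q a ≠ 0 := Complex.slitPlane_ne_zero hslit
    have hne2 : q a - q b ≠ 0 := by
      intro e
      rw [← sub_eq_zero.1 e, div_self (hne a), sub_self] at hne1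
      exact hne1 rfl
    have hne3 : q b - q a ≠ 0 := by rw [← neg_sub]; exact neg_ne_zero.2 hne2
    -- `d` is the derivative of the base of the power, zero unless `i` is one of `a`, `b`
    obtain ⟨d, hd, hd'⟩ : ∃ d, HasDerivAt (fun x => 1 - Function.update q i x b /
        Function.update q i x a) d (q i) ∧ h * lam a / κ * (d / (1 - q b / q a)) = c a b := by
      have ha0 := hne a
      have hb0 := hne b
      have hsub : 1 - q b / q a = (q a - q b) / q a := by field_simp
      by_cases ha : a = i
      · subst ha
        have hba : b ≠ a := hab.ne'
        refine ⟨-(q b * (-(1 : ℂ) / q a ^ 2)), ?_, ?_⟩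
        · simp only [Function.update_self, Function.update_of_ne hba, div_eq_mul_inv (q b)]
          exact (((hasDerivAt_id (q a)).fun_inv (hne a)).const_mul (q b)).const_sub 1
        · simp only [hc, if_true, if_neg hba, hsub]
          field_simp
          ring
      · by_cases hb : b = i
        · subst hb
          refine ⟨-(1 / q a), ?_, ?_⟩
          · simp only [Function.update_self, Function.update_of_ne hab.ne]
            exact ((hasDerivAt_id (q b)).div_const (q a)).const_sub 1
          · simp only [hc, if_true, if_neg ha, hsub]
            rw [show q b - q a = -(q a - q b) by ring]
            field_simp
            ring
        · refine ⟨0, ?_, ?_⟩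
          · simp only [Function.update_of_ne ha, Function.update_of_ne hb]
            exact hasDerivAt_const _ _
          · simp only [hc, if_neg ha, if_neg hb]
            simp
    have h1 := hd.cpow_const (c := h * lam a / κ) (by rwa [Function.update_eq_self])
    rw [Function.update_eq_self, Complex.cpow_sub _ _ hne1, Complex.cpow_one] at h1
    refine h1.congr_deriv ?_
    rw [← hd']
    field_simp
  have h2 := hasDerivAt_prod_of_mul Finset.univ (f := fun a x => ∏ b with a < b,
      (1 - Function.update q i x b / Function.update q i x a) ^ (h * lam a / κ))
      (c := fun a => ∑ b with a < b, c a b) (x := q i) (fun a _ => by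
    have := hasDerivAt_prod_of_mul (Finset.univ.filter fun b => a < b) (f := fun b x =>
      (1 - Function.update q i x b / Function.update q i x a) ^ (h * lam a / κ))
      (c := fun b => c a b) (x := q i) (fun b hb => by
        simp only [Function.update_eq_self]
        exact hfac a b (Finset.mem_filter.1 hb).2)
    exact this)
  simp only [Function.update_eq_self] at h2
  refine h2.congr_deriv (congrArg₂ (· * ·) rfl ?_)
  simp only [hc, Finset.sum_add_distrib, gaugeCoef, Finset.sum_div, Finset.sum_filter, add_div]
  congr 1
  · rw [Finset.sum_eq_single i]
    · refine Finset.sum_congr rfl fun b _ => ?_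
      simp [ite_div]
    · intro a _ ha
      simp [ha]
    · simp
  · rw [Finset.sum_comm, Finset.sum_eq_single i]
    · refine Finset.sum_congr rfl fun b _ => ?_
      simp [ite_div]
    · intro a _ ha
      simp [ha]
    · simp

end Omega

section Coordinates

variable {J : Parts lam} {z : Fin (size lam) → ℂ} {h : ℂ} {l q : Fin (M + 1) → ℂ}

/-- `siteSum` with the letters in `Fin (M + 1)`. -/
def coordSum (κ : ℂ) (J : Parts lam) (z : Fin (size lam) → ℂ) (h : ℂ) (l : Fin (M + 1) → ℂ)
    (p : Fin (size lam) → Fin (M + 1)) : ℂ :=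
  siteSum κ J z h l fun a => (p a : ℕ)

theorem coordSum_eq_zero {p : Fin (size lam) → Fin (M + 1)}
    (hp : ¬ ∀ j, (Finset.univ.filter fun a => p a = j).card = lam j) :
    coordSum κ J z h l p = 0 := by
  simp [coordSum, siteSum, jackSum, siteWord_univ_eq_zero J z h _ hp]

/-- Both sides vanish unless `p` comes from a partition in `I_λ`. -/
theorem card_mul_coordSum (p : Fin (size lam) → Fin (M + 1)) (j : Fin (M + 1)) :
    ((Finset.univ.filter fun a => p a = j).card : ℂ) * coordSum κ J z h l p =
      lam j * coordSum κ J z h l p := by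
  by_cases hp : ∀ j, (Finset.univ.filter fun a => p a = j).card = lam j
  · rw [hp j]
  · rw [coordSum_eq_zero hp, mul_zero, mul_zero]

theorem sum_Ioc_fin (i : Fin (M + 1)) (F : ℕ → ℂ) :
    ∑ j ∈ Finset.Ioc (i : ℕ) M, F j = ∑ j : Fin (M + 1), if i < j then F j else 0 := by
  have : Finset.Ioc (i : ℕ) M = (Finset.range (M + 1)).filter fun j => (i : ℕ) < j := by
    ext j; simp only [Finset.mem_Ioc, Finset.mem_filter, Finset.mem_range]; omega
  rw [this, Finset.sum_filter, Finset.sum_range]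
  rfl

theorem sum_range_fin (i : Fin (M + 1)) (F : ℕ → ℂ) :
    ∑ j ∈ Finset.range (i : ℕ), F j = ∑ j : Fin (M + 1), if j < i then F j else 0 := by
  have : Finset.range (i : ℕ) = (Finset.range (M + 1)).filter fun j => j < (i : ℕ) := by
    ext j; have := i.isLt; simp only [Finset.mem_filter, Finset.mem_range]; omega
  rw [this, Finset.sum_filter, Finset.sum_range]
  rfl

theorem swapSum_siteSum (i j : Fin (M + 1)) (p : Fin (size lam) → Fin (M + 1)) :
    swapSum (siteSum κ J z h l) (i : ℕ) (j : ℕ) (fun a => (p a : ℕ)) =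
      swapSum (coordSum κ J z h l) i j p := by
  unfold swapSum
  refine Finset.sum_congr rfl fun a _ => Finset.sum_congr rfl fun b _ => ?_
  simp only [Fin.ext_iff]
  congr 1
  unfold coordSum
  congr 1
  funext c
  simp only [Function.update_apply]
  split_ifs <;> rfl

theorem sum_combination {α : Type*} [Fintype α] {G X Y R : α → ℂ} {c h Z : ℂ}
    (hj : ∀ j, G j * c - h * X j + h * Y j = -(h * R j)) :
    Z - h * ∑ j, X j + h * ∑ j, Y j + (∑ j, G j) * c = Z - h * ∑ j, R j := by
  have := Finset.sum_congr rfl fun j (_ : j ∈ Finset.univ) => hj j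
  simp only [Finset.sum_add_distrib, Finset.sum_sub_distrib, Finset.sum_neg_distrib,
    ← Finset.mul_sum, ← Finset.sum_mul] at this
  linear_combination this

/-- The differential equation in coordinates: the diagonal terms which `jackSum_cartanDeg` has in
excess of the Hamiltonian are cancelled by the logarithmic derivative of `Ω_λ`. -/
theorem jackSum_cartanDeg_add (hκ : κ ≠ 0) (hg : Generic κ z h)
    (hq : ∀ i : Fin M, ‖Complex.exp (l i.succ - l i.castSucc)‖ < 1)
    (hl : ∀ i, Complex.exp (l i) = q i) (i : Fin (M + 1)) (p : Fin (size lam) → Fin (M + 1)) :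
    jackSum l ((latticeVars κ J z h).cartanDeg i (siteWord κ J z h fun a => (p a : ℕ))) +
        gaugeCoef lam h q i * coordSum κ J z h l p =
      (∑ a, if p a = i then z a else 0) * coordSum κ J z h l p -
        h * ∑ j with j ≠ i, (swapSum (coordSum κ J z h l) i j p +
          q j / (q i - q j) * (swapSum (coordSum κ J z h l) i j p +
            swapSum (coordSum κ J z h l) j i p)) := by
  -- the `q i` as a function on `ℕ`, with the junk value `0` beyond the range of indices
  set y : ℕ → ℂ := fun k => if hk : k < M + 1 then q ⟨k, hk⟩ else 0 with hydef
  have hyq : ∀ i : Fin (M + 1), y i = q i := fun i => dif_pos i.isLt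
  have hy : ∀ i : Fin (M + 1), y i = Complex.exp (l i) := fun i => by rw [hyq, hl]
  have hne : ∀ {a b : Fin (M + 1)}, a < b → q a - q b ≠ 0 := by
    intro a b hab
    have := norm_lt_norm_of_lt hq hy (show (a : ℕ) < b from hab) (Nat.lt_succ_iff.1 b.isLt)
    rw [hyq, hyq] at this
    rw [sub_ne_zero]; rintro e; rw [e] at this; exact lt_irrefl _ this
  have h1 := jackSum_cartanDeg (J := J) hκ hg hq hy (i := i) (Nat.lt_succ_iff.1 i.isLt)
    (fun a => (p a : ℕ))
  have hG : ∀ p', jackSum l (siteWord κ J z h p') = siteSum κ J z h l p' := fun _ => rfl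
  simp only [hG, sum_update_update_add] at h1
  rw [sum_Ioc_fin, sum_range_fin] at h1
  simp only [hyq, swapSum_siteSum, Fin.val_inj] at h1
  have hcard := card_mul_coordSum (κ := κ) (J := J) (z := z) (h := h) (l := l) p
  have hcoord : siteSum κ J z h l (fun a => (p a : ℕ)) = coordSum κ J z h l p := rfl
  simp only [hcoord, hcard] at h1
  rw [h1, gaugeCoef, Finset.sum_filter]
  refine sum_combination fun j => ?_
  set A := swapSum (coordSum κ J z h l) i j p
  set B := swapSum (coordSum κ J z h l) j i p
  rcases lt_trichotomy i j with hij | rfl | hij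
  · simp only [if_pos hij, if_neg hij.not_gt, if_pos hij.ne']
    ring
  · simp
  · have h2 := hne hij
    have h3 : q i - q j ≠ 0 := by rw [← neg_sub]; exact neg_ne_zero.2 h2
    have h4 : q j / (q i - q j) = -1 - q i / (q j - q i) := by
      rw [show q i - q j = -(q j - q i) by ring]; field_simp; ring
    have h5 : q i / (q i - q j) = - (q i / (q j - q i)) := by
      rw [show q i - q j = -(q j - q i) by ring]; field_simp
    simp only [if_pos hij, if_neg hij.not_gt, if_pos hij.ne]
    rw [h4, h5]
    ring

end Coordinates

/-- The extension of `Ψ_J` to `bigDomain`, with the Jackson integrals replaced by Jackson sums of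
words. The words whose letters do not come from `I_λ` contribute zero. -/
def psiExt (κ : ℂ) (J : Parts lam) (logq : (Fin (M + 1) → ℂ) → Fin (M + 1) → ℂ)
    (p : Param M (size lam)) : TensorPow M (size lam) :=
  toVec fun w => omega lam κ p.2.1 p.2.2 * coordSum κ J p.1 p.2.1 (logq p.2.2) w

theorem psiExt_mem_weightSpace (J : Parts lam) (logq : (Fin (M + 1) → ℂ) → Fin (M + 1) → ℂ)
    (p : Param M (size lam)) : psiExt κ J logq p ∈ weightSpace lam := by
  rw [psiExt, toVec_apply]
  refine Submodule.sum_mem _ fun w _ => ?_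
  by_cases hw : ∀ j, (Finset.univ.filter fun a => w a = j).card = lam j
  · exact Submodule.smul_mem _ _ (Submodule.subset_span ⟨⟨w, hw⟩, rfl⟩)
  · rw [coordSum_eq_zero hw, mul_zero, zero_smul]
    exact Submodule.zero_mem _

section Extension

variable {J : Parts lam} {U : Set (Fin (M + 1) → ℂ)} {logq : (Fin (M + 1) → ℂ) → Fin (M + 1) → ℂ}

/-- On the smaller domain, the residues are the products of `masterCoef` with the value of a word
of site vectors. -/
theorem jacksonTerm_eq_siteWord (hκ : κ ≠ 0) {z : Fin (size lam) → ℂ} {h : ℂ}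
    {q : Fin (M + 1) → ℂ} (hp : (z, h, q) ∈ smallDomain κ U) (I : Parts lam)
    (l : Fin (M + 1) → ℂ) (r : TVar lam → ℤ) :
    jacksonTerm κ J I z h l r = masterCoef κ J z h l r *
      siteWord κ J z h (fun a => (I.1 a : ℕ)) r Finset.univ := by
  rw [jacksonTerm_eq hκ (generic_of_mem_bigDomain (smallDomain_subset_bigDomain hp)) hp.1,
    weightW_latticePoint]

theorem summable_jacksonTerm (hκ : κ ≠ 0)
    (hUq : ∀ q ∈ U, ∀ i : Fin M, ‖q i.succ / q i.castSucc‖ < 1)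
    (hlog : ∀ q ∈ U, ∀ i, Complex.exp (logq q i) = q i) {z : Fin (size lam) → ℂ} {h : ℂ}
    {q : Fin (M + 1) → ℂ} (hp : (z, h, q) ∈ smallDomain κ U) (I : Parts lam) :
    Summable fun r : TVar lam → ℤ => jacksonTerm κ J I z h (logq q) r := by
  simp only [jacksonTerm_eq_siteWord hκ hp I]
  have hg := generic_of_mem_bigDomain (smallDomain_subset_bigDomain hp)
  exact summable_masterCoef_mul hκ hg (norm_exp_logq_sub_lt hlog hUq hp.2.2)
    ((admissible_siteWord hκ hg _).temp _)

theorem eqOn_psiExt (hκ : κ ≠ 0) :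
    Set.EqOn (psiExt κ J logq) (psi κ J logq) (smallDomain κ U) := by
  rintro ⟨z, h, q⟩ hp
  rw [psiExt, psi, toVec_apply, Finset.smul_sum]
  symm
  refine Fintype.sum_of_injective Subtype.val Subtype.val_injective _ _ ?_ ?_
  · intro w hw
    rw [coordSum_eq_zero fun hw' => hw ⟨⟨w, hw'⟩, rfl⟩, mul_zero, zero_smul]
  · intro I
    rw [smul_smul, jackson, coordSum, siteSum_eq, tsum_congr (jacksonTerm_eq_siteWord hκ hp I _)]

variable (hκ : κ ≠ 0) (hU : IsOpen U)
  (hUq : ∀ q ∈ U, ∀ i : Fin M, ‖q i.succ / q i.castSucc‖ < 1) (hcont : ContinuousOn logq U)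
  (hlog : ∀ q ∈ U, ∀ i, Complex.exp (logq q i) = q i)
include hκ hU hUq hcont hlog

theorem isHolomorphicOn_psiExt : IsHolomorphicOn (psiExt κ J logq) (bigDomain κ U) := by
  have hqne : ∀ q ∈ U, ∀ i, q i ≠ 0 := fun q hq i => by
    rw [← hlog q hq i]; exact Complex.exp_ne_zero _
  intro ξ p hp
  refine DifferentiableAt.differentiableWithinAt ?_
  simp only [psiExt, toVec_apply, map_sum, map_smul, smul_eq_mul]
  have hd1 : ∀ p : Param M (size lam), DifferentiableAt ℂ (fun p : Param M (size lam) => p.1) p :=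
    fun p => differentiableAt_fst
  have hd2 : ∀ p : Param M (size lam),
    DifferentiableAt ℂ (fun p : Param M (size lam) => p.2.1) p :=
    fun p => by fun_prop
  have hd3 : ∀ p : Param M (size lam),
    DifferentiableAt ℂ (fun p : Param M (size lam) => p.2.2) p :=
    fun p => by fun_prop
  have hc3 : Continuous fun p : Param M (size lam) => p.2.2 := by fun_prop
  have hc12 : Continuous fun p : Param M (size lam) => (p.1, p.2.1) := by fun_prop
  have hS : ∀ w, DifferentiableAt ℂ
      (fun p : Param M (size lam) => coordSum κ J p.1 p.2.1 (logq p.2.2) w) p := by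
    intro w
    have := differentiableAt_siteSum (E := Param M (size lam)) (q := p) (z := fun p => p.1)
      (h := fun p => p.2.1) (l := fun p => logq p.2.2) hκ J (Eventually.of_forall hd1)
      (Eventually.of_forall hd2) ?_ ?_ (norm_exp_logq_sub_lt hlog hUq hp.2.2) fun a => (w a : ℕ)
    · exact this.2.differentiableAt
    · filter_upwards [hc3.continuousAt.eventually (hU.mem_nhds hp.2.2)] with p hp
      exact (differentiableAt_logq hU hcont hlog hp).fun_comp' p (hd3 p)
    · exact hc12.continuousAt.eventually
        ((isOpen_generic hκ _).mem_nhds (generic_of_mem_bigDomain hp))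
  have hΩ := differentiableAt_omega (κ := κ) lam (hd2 p) (hd3 p) (hqne _ hp.2.2) (hUq _ hp.2.2)
  exact DifferentiableAt.fun_sum fun w _ => (hΩ.mul (hS w)).mul_const _

theorem solvesDynamical_psiExt : SolvesDynamical κ (psiExt κ J logq) (bigDomain κ U) := by
  have hqne : ∀ q ∈ U, ∀ i, q i ≠ 0 := fun q hq i => by
    rw [← hlog q hq i]; exact Complex.exp_ne_zero _
  intro z h q hp i
  have hg := generic_of_mem_bigDomain hp
  have hqU : q ∈ U := hp.2.2
  have hqi := hqne q hqU i
  have hlt := norm_exp_logq_sub_lt hlog hUq hqU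
  have hupd : Continuous fun x => Function.update q i x := continuous_const.update i continuous_id
  have hΩ := hasDerivAt_omega lam hκ h (hqne q hqU) (hUq q hqU) i
  have hS : ∀ w : Fin (size lam) → Fin (M + 1), HasDerivAt
      (fun x => coordSum κ J z h (logq (Function.update q i x)) w)
      ((q i)⁻¹ / κ * jackSum (logq q) ((latticeVars κ J z h).cartanDeg i
        (siteWord κ J z h fun a => (w a : ℕ)))) (q i) := by
    intro w
    have := hasDerivAt_siteSum hκ J hg (l := fun x => logq (Function.update q i x)) (x := q i)
      (hasDerivAt_logq_update hU hcont hlog hqU i) ?_ ?_ (fun a => (w a : ℕ))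
    · simp only [Function.update_eq_self] at this
      exact this
    · have h1 : ∀ᶠ x in 𝓝 (q i), Function.update q i x ∈ U :=
        hupd.continuousAt.eventually (by simpa using hU.mem_nhds hqU)
      filter_upwards [h1] with x hx
      refine (differentiableAt_logq hU hcont hlog hx).fun_comp' x ?_
      rw [differentiableAt_pi]
      intro k
      by_cases hk : k = i
      · subst hk; simp
      · simp [hk]
    · simpa only [Function.update_eq_self] using hlt
  refine ⟨toVec fun w => omega lam κ h q / (κ * q i) *
    (jackSum (logq q) ((latticeVars κ J z h).cartanDeg i
      (siteWord κ J z h fun a => (w a : ℕ))) +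
      gaugeCoef lam h q i * coordSum κ J z h (logq q) w), fun ξ => ?_, ?_⟩
  · simp only [psiExt, toVec_apply, map_sum, map_smul, smul_eq_mul]
    refine HasDerivAt.fun_sum fun w _ => HasDerivAt.mul_const ?_ _
    refine (hΩ.fun_mul (hS w)).congr_deriv ?_
    rw [Function.update_eq_self]
    field_simp
    ring
  · rw [psiExt, hamiltonian_toVec, ← map_smul]
    congr 1
    funext w
    rw [Pi.smul_apply, smul_eq_mul, jackSum_cartanDeg_add hκ hg hlt (hlog q hqU)]
    have hsw : ∀ i j : Fin (M + 1), swapSum (fun w => omega lam κ h q *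
        coordSum κ J z h (logq q) w) i j w =
        omega lam κ h q * swapSum (coordSum κ J z h (logq q)) i j w := by
      intro i j
      simp only [swapSum, Finset.mul_sum, mul_ite, mul_zero]
    simp only [hsw]
    have hsum : ∑ j with j ≠ i, (omega lam κ h q * swapSum (coordSum κ J z h (logq q)) i j w +
        q j / (q i - q j) * (omega lam κ h q * swapSum (coordSum κ J z h (logq q)) i j w +
          omega lam κ h q * swapSum (coordSum κ J z h (logq q)) j i w)) =
        omega lam κ h q * ∑ j with j ≠ i, (swapSum (coordSum κ J z h (logq q)) i j w +
        q j / (q i - q j) * (swapSum (coordSum κ J z h (logq q)) i j w +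
          swapSum (coordSum κ J z h (logq q)) j i w)) := by
      rw [Finset.mul_sum]
      refine Finset.sum_congr rfl fun j _ => ?_
      ring
    rw [hsum]
    field_simp

end Extension

end

end JacksonIntegral

end

open JacksonIntegral

theorem theorem9p4 {M : ℕ} (lam : Fin (M + 1) → ℕ) (κ : ℂ) (hκ : κ ≠ 0) (J : Parts lam)
    (U : Set (Fin (M + 1) → ℂ)) (hU : IsOpen U)
    (hUq : ∀ q ∈ U, ∀ i : Fin M, ‖q i.succ / q i.castSucc‖ < 1)
    (logq : (Fin (M + 1) → ℂ) → Fin (M + 1) → ℂ) (hcont : ContinuousOn logq U)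
    (hlog : ∀ q ∈ U, ∀ i, Complex.exp (logq q i) = q i) :
    (∀ z h q, (z, h, q) ∈ smallDomain κ U → ∀ I : Parts lam,
      Summable fun r : TVar lam → ℤ => jacksonTerm κ J I z h (logq q) r) ∧
    ∃ Ψ : Param M (size lam) → TensorPow M (size lam),
      Set.EqOn Ψ (psi κ J logq) (smallDomain κ U) ∧
      (∀ p ∈ bigDomain κ U, Ψ p ∈ weightSpace lam) ∧
      IsHolomorphicOn Ψ (bigDomain κ U) ∧
      SolvesDynamical κ Ψ (bigDomain κ U) := by
  exact ⟨fun _ _ _ hp I => summable_jacksonTerm hκ hUq hlog hp I, psiExt κ J logq,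
    eqOn_psiExt hκ, fun p _ => psiExt_mem_weightSpace J logq p,
    isHolomorphicOn_psiExt hκ hU hUq hcont hlog, solvesDynamical_psiExt hκ hU hUq hcont hlog⟩
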